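/- \textbf{Conventions.} A Picard category is a non-empty category $P$ with a bifunctor $\otimes$ and compatible associativity and commutativity constraints $\varphi,\psi$ ($\psi_{Y,X}\psi_{X,Y}=\mathrm{id}$, pentagon and hexagon axioms), in which every morphism is an isomorphism and every functor $X\mapsto W\otimes X$ is an autoequivalence. A unit is an object $U$ with an isomorphism $\delta:U\to U\otimes U$; a morphism of units $(U,\delta)\to(U',\delta')$ is $\alpha:U\to U'$ with $(\alpha\otimes\alpha)\delta=\delta'\alpha$; the product of $(U,\delta)$ and $(U',\delta')$ is $U\otimes U'$ with $\delta\otimes\delta'$ followed by the exchange of the two middle factors. For $X\in P$ let $\varepsilon(X)$ be the automorphism $\psi_{X,X}$ of $X\otimes X$; it acts on every object of $P$ through the canonical isomorphisms between the automorphism groups of the objects of $P$. A determinant functor on a (Quillen) exact category $E$ with values in $P$ is a pair $f=(f_1,f_2)$ of a functor $f_1:E_{\mathrm{iso}}\to P$ ($E_{\mathrm{iso}}$: all objects of $E$, and only the isomorphisms as morphisms) and isomorphisms $f_2(\Delta):f_1(B)\to f_1(A)\otimes f_1(C)$ for all short exact sequences $\Delta:A\to B\to C$ such that: (i) $f_2$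 is natural for isomorphisms of short exact sequences; (ii) for every commutative diagram with short exact rows $\Delta_{h1}:A\to B\to C'$, $\Delta_{h2}:A\to C\to B'$ and columns $\Delta_{v1}:B\to C\to A'$, $\Delta_{v2}:C'\to B'\to A'$ (with the identities of $A$ and $A'$) one has $\varphi\,(\mathrm{id}\otimes f_2(\Delta_{v2}))\,f_2(\Delta_{h2})=(f_2(\Delta_{h1})\otimes\mathrm{id})\,f_2(\Delta_{v1})$; (iii) for a direct sum, the sequences $\Delta_1:A\to A\oplus B\to B$ and $\Delta_2:B\to A\oplus B\to A$ satisfy $\psi\, f_2(\Delta_1)=f_2(\Delta_2)$. A morphism $f\to g$ is a natural isomorphism $\lambda:f_1\to g_1$ with $(\lambda_A\otimes\lambda_C)f_2(\Delta)=g_2(\Delta)\lambda_B$ for all $\Delta$. These form the category $\det(E,P)$. For an exact automorphism $T$ of an exact category $E'$, a determinant functor on $(E',T)$ is a triple $(g_1,g_2,\mu)$, where $(g_1,g_2)$ is a determinant functor on $E'$ and $\mu_A$ is a unit structure on $g_1(A)\otimes g_1(TA)$ for every object $A$, such that (i) $g_1(a)\otimes g_1(Ta)$ is a morphism of units for every isomorphism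 $a$, and (ii) for every short exact sequence $\Delta:A\to B\to C$ the map $g_2(\Delta)\otimes g_2(T\Delta)$, followed by the exchange of the two middle factors, is a morphism of units from $g_1(B)\otimes g_1(TB)$ to the product of the units $g_1(A)\otimes g_1(TA)$ and $g_1(C)\otimes g_1(TC)$. A morphism is a morphism $\lambda$ of determinant functors on $E'$ such that all $\lambda_A\otimes\lambda_{TA}$ are morphisms of units. These form the category $\det((E',T),P)$. Let $\mathrm{Gr}^b(E)$ be the exact category of families $A=(A_i)_{i\in\mathbb Z}$ of objects of $E$ with $A_i$ zero for all but finitely many $i$ (morphisms and short exact sequences are degreewise), with translation $(TA)_j=A_{j+1}$. Embed $E$ into it as the objects concentrated in degree $0$, and put $A^{ev}=\bigoplus_{i\text{ even}}A_i$, $A^{od}=\bigoplus_{i\text{ odd}}A_i$. \textbf{Proposition.} Let $E$ be an exact category and $P$ a Picard category. Then the functor $$W:\det((\mathrm{Gr}^b(E),T),P)\to\det(E,P),$$ which restricts $(g_1,g_2)$ to $E$, is an equivalence of categories. Moreover, let a right inverse $X^*$ of every object $X$ of $P$ be fixed (an object $X^*$ with a unit structure on $X\otimes X^*$); for $\alpha:X\to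 Y$ let $\alpha^*:X^*\to Y^*$ be the unique morphism for which $\alpha\otimes\alpha^*$ is a morphism of units, and let $(X\otimes Y)^*\cong X^*\otimes Y^*$ be the canonical isomorphism. Then there is a functor $R:\det(E,P)\to\det((\mathrm{Gr}^b(E),T),P)$ with $W\circ R\cong\mathrm{id}$ and $R\circ W\cong\mathrm{id}$, which sends $f=(f_1,f_2)$ to the following triple $(g_1,g_2,\mu)$ and a morphism $\lambda$ to $A\mapsto\lambda_{A^{ev}}\otimes(\lambda_{A^{od}})^*$: \begin{itemize} \item $g_1(A)=f_1(A^{ev})\otimes f_1(A^{od})^*$ and $g_1(a)=f_1(a^{ev})\otimes f_1(a^{od})^*$; \item $g_2(\Delta)$, for $\Delta:A\to B\to C$, is $f_2(\Delta^{ev})\otimes f_2(\Delta^{od})^*$ followed by the canonical isomorphisms from $(f_1(A^{ev})\otimes f_1(C^{ev}))\otimes(f_1(A^{od})\otimes f_1(C^{od}))^*$ to $(f_1(A^{ev})\otimes f_1(C^{ev}))\otimes(f_1(A^{od})^*\otimes f_1(C^{od})^*)$ and on to $g_1(A)\otimes g_1(C)$; \item $\mu_A$ is induced from the product unit structure on $(f_1(A^{ev})\otimes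 f_1(A^{ev})^*)\otimes(f_1(A^{od})\otimes f_1(A^{od})^*)$ by the isomorphism from $g_1(A)\otimes g_1(TA)$ to this object that identifies $(TA)^{ev}=A^{od}$ and $(TA)^{od}=A^{ev}$, permutes the factors and then applies $\varepsilon(f_1(A^{od}))$. \end{itemize} -/

import Mathlib

open CategoryTheory CategoryTheory.Limits CategoryTheory.MonoidalCategory

universe v u w v₁ u₁ v₂ u₂

open scoped ZeroObject

set_option linter.unusedVariables false
set_option linter.unusedSectionVars false

noncomputable section

namespace DetFunctors

/-! ### Exact categories (in the sense of Quillen) -/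

section ExactCategories

/-- `f` is the first map of a short exact sequence of the class `conf`. -/
def IsInflationOf {E : Type u} [Category.{v} E] [HasZeroMorphisms E]
    (conf : ShortComplex E → Prop) {A B : E} (f : A ⟶ B) : Prop :=
  ∃ (C : E) (g : B ⟶ C) (w : f ≫ g = 0), conf (ShortComplex.mk f g w)

/-- `g` is the second map of a short exact sequence of the class `conf`. -/
def IsDeflationOf {E : Type u} [Category.{v} E] [HasZeroMorphisms E]
    (conf : ShortComplex E → Prop) {B C : E} (g : B ⟶ C) : Prop :=
  ∃ (A : E) (f : A ⟶ B) (w : f ≫ g = 0), conf (ShortComplex.mk f g w)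

/-- A (Quillen) exact category: an additive category with a class `Conflation` of kernel-cokernel
pairs, the *short exact sequences*, which is closed under isomorphism and satisfies the usual
axioms on admissible monomorphisms (inflations) and admissible epimorphisms (deflations). -/
class ExactCategory (E : Type u) [Category.{v} E] [Preadditive E]
    extends HasZeroObject E, HasFiniteBiproducts E where
  /-- the short exact sequences -/
  Conflation : ShortComplex E → Prop
  of_iso : ∀ {S S' : ShortComplex E}, Conflation S → (S ≅ S') → Conflation S'
  isKernel : ∀ {S : ShortComplex E}, Conflation S → Nonempty (IsLimit (KernelFork.ofι S.f S.zero))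
  isCokernel : ∀ {S : ShortComplex E}, Conflation S →
    Nonempty (IsColimit (CokernelCofork.ofπ S.g S.zero))
  inflation_id : ∀ A : E, IsInflationOf Conflation (𝟙 A)
  deflation_id : ∀ A : E, IsDeflationOf Conflation (𝟙 A)
  inflation_comp : ∀ {A B C : E} (f : A ⟶ B) (g : B ⟶ C),
    IsInflationOf Conflation f → IsInflationOf Conflation g → IsInflationOf Conflation (f ≫ g)
  deflation_comp : ∀ {A B C : E} (f : A ⟶ B) (g : B ⟶ C),
    IsDeflationOf Conflation f → IsDeflationOf Conflation g → IsDeflationOf Conflation (f ≫ g)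
  pushout_inflation : ∀ {A B C : E} (f : A ⟶ B) (g : A ⟶ C), IsInflationOf Conflation f →
    ∃ (D : E) (h : B ⟶ D) (k : C ⟶ D), IsPushout f g h k ∧ IsInflationOf Conflation k
  pullback_deflation : ∀ {A B C : E} (f : B ⟶ A) (g : C ⟶ A), IsDeflationOf Conflation f →
    ∃ (D : E) (h : D ⟶ B) (k : D ⟶ C), IsPullback h k f g ∧ IsDeflationOf Conflation k

variable {E : Type u} [Category.{v} E] [Preadditive E] [ExactCategory E]

/-- The short exact sequences of an exact category. -/
abbrev Conflation (S : ShortComplex E) : Prop := ExactCategory.Conflation S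

instance : HasBinaryBiproducts E := hasBinaryBiproducts_of_finite_biproducts E

abbrev Inflation {A B : E} (f : A ⟶ B) : Prop := IsInflationOf (E := E) Conflation f
abbrev Deflation {A B : E} (f : A ⟶ B) : Prop := IsDeflationOf (E := E) Conflation f

theorem conflation_of_inflation {A B C : E} {f : A ⟶ B} (hf : Inflation f) (g : B ⟶ C)
    (w : f ≫ g = 0) (hg : IsColimit (CokernelCofork.ofπ g w)) :
    Conflation (ShortComplex.mk f g w) := by
  obtain ⟨C', g', w', h⟩ := hf
  obtain ⟨hc⟩ := ExactCategory.isCokernel h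
  let e := IsColimit.coconePointUniqueUpToIso hc hg
  have he : g' ≫ e.hom = g :=
    IsColimit.comp_coconePointUniqueUpToIso_hom hc hg WalkingParallelPair.one
  exact ExactCategory.of_iso h (ShortComplex.isoMk (Iso.refl _) (Iso.refl _) e (by simp)
    (by simpa using he.symm))

theorem conflation_of_deflation {A B C : E} {g : B ⟶ C} (hg : Deflation g) (f : A ⟶ B)
    (w : f ≫ g = 0) (hf : IsLimit (KernelFork.ofι f w)) :
    Conflation (ShortComplex.mk f g w) := by
  obtain ⟨A', f', w', h⟩ := hg
  obtain ⟨hc⟩ := ExactCategory.isKernel h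
  let e := IsLimit.conePointUniqueUpToIso hc hf
  have he : e.hom ≫ f = f' :=
    IsLimit.conePointUniqueUpToIso_hom_comp hc hf WalkingParallelPair.zero
  exact ExactCategory.of_iso h (ShortComplex.isoMk e (Iso.refl _) (Iso.refl _)
    (by simpa using he) (by simp))

theorem inflation_comp_iso {A B B' : E} {f : A ⟶ B} (hf : Inflation f) (e : B ≅ B') :
    Inflation (f ≫ e.hom) := by
  obtain ⟨C, g, w, h⟩ := hf
  exact ⟨C, e.inv ≫ g, by simp [w], ExactCategory.of_iso h
    (ShortComplex.isoMk (Iso.refl _) e (Iso.refl _) (by simp) (by simp))⟩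

theorem inflation_of_isPushout {A B C D : E} {f : A ⟶ B} {g : A ⟶ C} {h : B ⟶ D} {k : C ⟶ D}
    (sq : IsPushout f g h k) (hf : Inflation f) : Inflation k := by
  obtain ⟨D', h', k', sq', hk'⟩ := ExactCategory.pushout_inflation f g hf
  have := inflation_comp_iso hk' (sq'.isoIsPushout _ _ sq)
  simpa using this

theorem isZero_left_of_conflation {S : ShortComplex E} (h : Conflation S) (h2 : IsZero S.X₂) :
    IsZero S.X₁ := by
  obtain ⟨hk⟩ := ExactCategory.isKernel h
  rw [IsZero.iff_id_eq_zero]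
  exact Fork.IsLimit.hom_ext hk (h2.eq_of_tgt _ _)

theorem isZero_right_of_conflation {S : ShortComplex E} (h : Conflation S) (h2 : IsZero S.X₂) :
    IsZero S.X₃ := by
  obtain ⟨hk⟩ := ExactCategory.isCokernel h
  rw [IsZero.iff_id_eq_zero]
  exact Cofork.IsColimit.hom_ext hk (h2.eq_of_src _ _)

theorem conflation_id_left (A : E) {Z : E} (hZ : IsZero Z) :
    Conflation (ShortComplex.mk (𝟙 A) (0 : A ⟶ Z) comp_zero) :=
  conflation_of_inflation (ExactCategory.inflation_id A) _ _
    (CokernelCofork.IsColimit.ofπ _ _ (fun _ _ => 0)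
      (fun k hk => by rw [Category.id_comp] at hk; simp [hk])
      (fun _ _ _ _ => hZ.eq_of_src _ _))

theorem conflation_id_right (A : E) {Z : E} (hZ : IsZero Z) :
    Conflation (ShortComplex.mk (0 : Z ⟶ A) (𝟙 A) zero_comp) :=
  conflation_of_deflation (ExactCategory.deflation_id A) _ _
    (KernelFork.IsLimit.ofι _ _ (fun _ _ => 0)
      (fun k hk => by rw [Category.comp_id] at hk; simp [hk])
      (fun _ _ _ _ => hZ.eq_of_tgt _ _))

theorem conflation_of_isZero (S : ShortComplex E) (h1 : IsZero S.X₁) (h2 : IsZero S.X₂)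
    (h3 : IsZero S.X₃) : Conflation S :=
  ExactCategory.of_iso (conflation_id_left S.X₁ h3) (ShortComplex.isoMk (Iso.refl _) (h1.iso h2)
    (Iso.refl _) (h1.eq_of_src _ _) (h1.eq_of_src _ _))

/-- A direct sum of two short exact sequences is a short exact sequence. -/
theorem conflation_of_sum {S₁ S₂ S : ShortComplex E} (h₁ : Conflation S₁) (h₂ : Conflation S₂)
    (i₁ : S₁ ⟶ S) (i₂ : S₂ ⟶ S) (p₁ : S ⟶ S₁) (p₂ : S ⟶ S₂)
    (h11 : i₁ ≫ p₁ = 𝟙 _) (h22 : i₂ ≫ p₂ = 𝟙 _) (h12 : i₁ ≫ p₂ = 0) (h21 : i₂ ≫ p₁ = 0)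
    (tot : p₁ ≫ i₁ + p₂ ≫ i₂ = 𝟙 S) : Conflation S := by
  have t1 := congrArg ShortComplex.Hom.τ₁ tot
  have t2 := congrArg ShortComplex.Hom.τ₂ tot
  have t3 := congrArg ShortComplex.Hom.τ₃ tot
  have a11 := congrArg ShortComplex.Hom.τ₁ h11
  have a22 := congrArg ShortComplex.Hom.τ₁ h22
  have a12 := congrArg ShortComplex.Hom.τ₁ h12
  have a21 := congrArg ShortComplex.Hom.τ₁ h21
  have b11 := congrArg ShortComplex.Hom.τ₂ h11
  have b22 := congrArg ShortComplex.Hom.τ₂ h22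
  have b12 := congrArg ShortComplex.Hom.τ₂ h12
  have b21 := congrArg ShortComplex.Hom.τ₂ h21
  simp only [ShortComplex.add_τ₁, ShortComplex.add_τ₂, ShortComplex.add_τ₃, ShortComplex.comp_τ₁,
    ShortComplex.comp_τ₂, ShortComplex.comp_τ₃, ShortComplex.id_τ₁, ShortComplex.id_τ₂,
    ShortComplex.id_τ₃, ShortComplex.zero_τ₁, ShortComplex.zero_τ₂] at *
  have hi1 : Inflation S₁.f := ⟨_, _, _, h₁⟩
  have hi2 : Inflation S₂.f := ⟨_, _, _, h₂⟩
  let u : S.X₁ ⟶ S₁.X₂ ⊞ S₂.X₁ := biprod.lift (p₁.τ₁ ≫ S₁.f) p₂.τ₁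
  let v : S₁.X₂ ⊞ S₂.X₁ ⟶ S.X₂ := biprod.desc i₁.τ₂ (S₂.f ≫ i₂.τ₂)
  have huv : u ≫ v = S.f := by
    have : S.f = (p₁.τ₁ ≫ i₁.τ₁ + p₂.τ₁ ≫ i₂.τ₁) ≫ S.f := by rw [t1, Category.id_comp]
    rw [this]
    simp [u, v, i₁.comm₁₂, i₂.comm₁₂]
  have squ : IsPushout S₁.f i₁.τ₁ biprod.inl u := by
    refine ⟨⟨?_⟩, ⟨PushoutCocone.IsColimit.mk _
      (fun s => biprod.desc s.inl (i₂.τ₁ ≫ s.inr)) ?_ ?_ ?_⟩⟩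
    · apply biprod.hom_ext
      · simp [u, reassoc_of% a11]
      · simp [u, a12]
    · intro s; simp
    · intro s
      have : s.inr = (p₁.τ₁ ≫ i₁.τ₁ + p₂.τ₁ ≫ i₂.τ₁) ≫ s.inr := by rw [t1, Category.id_comp]
      rw [this]
      simp [u, s.condition, reassoc_of% a21]
      simp [reassoc_of% a22]
    · intro s m h1 h2
      apply biprod.hom_ext'
      · simpa using h1
      · rw [biprod.inr_desc, ← h2, ← Category.assoc]
        congr 1
        apply biprod.hom_ext
        · simp [u, reassoc_of% a21]
        · simp [u, a22]
  have sqv : IsPushout S₂.f biprod.inr i₂.τ₂ v := by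
    refine ⟨⟨by simp [v]⟩, ⟨PushoutCocone.IsColimit.mk _
      (fun s => p₁.τ₂ ≫ biprod.inl ≫ s.inr + p₂.τ₂ ≫ s.inl) ?_ ?_ ?_⟩⟩
    · intro s; simp [reassoc_of% b21, reassoc_of% b22]
    · intro s
      apply biprod.hom_ext'
      · simp [v, reassoc_of% b11, reassoc_of% b12]
      · simp [v, reassoc_of% b21, reassoc_of% b22, s.condition]
    · intro s m h1 h2
      rw [← h1, ← h2]
      simp only [v, ← Category.assoc, ← Preadditive.add_comp]
      simp [t2]
  have hf : Inflation S.f := by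
    rw [← huv]
    exact ExactCategory.inflation_comp _ _ (inflation_of_isPushout squ hi1)
      (inflation_of_isPushout sqv hi2)
  obtain ⟨c1⟩ := ExactCategory.isCokernel h₁
  obtain ⟨c2⟩ := ExactCategory.isCokernel h₂
  have key1 : ∀ {Z : E} (z : S.X₂ ⟶ Z), S.f ≫ z = 0 → S₁.f ≫ i₁.τ₂ ≫ z = 0 := by
    intro Z z hz; rw [← i₁.comm₁₂_assoc, hz, comp_zero]
  have key2 : ∀ {Z : E} (z : S.X₂ ⟶ Z), S.f ≫ z = 0 → S₂.f ≫ i₂.τ₂ ≫ z = 0 := by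
    intro Z z hz; rw [← i₂.comm₁₂_assoc, hz, comp_zero]
  have ex1 : ∀ (Z : E) (z : S.X₂ ⟶ Z), S.f ≫ z = 0 → ∃ d : S₁.X₃ ⟶ Z, S₁.g ≫ d = i₁.τ₂ ≫ z :=
    fun Z z hz => ⟨c1.desc (CokernelCofork.ofπ _ (key1 z hz)),
      c1.fac (CokernelCofork.ofπ _ (key1 z hz)) WalkingParallelPair.one⟩
  have ex2 : ∀ (Z : E) (z : S.X₂ ⟶ Z), S.f ≫ z = 0 → ∃ d : S₂.X₃ ⟶ Z, S₂.g ≫ d = i₂.τ₂ ≫ z :=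
    fun Z z hz => ⟨c2.desc (CokernelCofork.ofπ _ (key2 z hz)),
      c2.fac (CokernelCofork.ofπ _ (key2 z hz)) WalkingParallelPair.one⟩
  choose d1 fac1 using ex1
  choose d2 fac2 using ex2
  refine conflation_of_inflation hf S.g S.zero (CokernelCofork.IsColimit.ofπ _ _
    (fun {Z} z hz => p₁.τ₃ ≫ d1 Z z hz + p₂.τ₃ ≫ d2 Z z hz) ?_ ?_)
  · intro Z z hz
    rw [Preadditive.comp_add, ← p₁.comm₂₃_assoc, ← p₂.comm₂₃_assoc, fac1, fac2,
      ← Category.assoc, ← Category.assoc, ← Preadditive.add_comp, t2, Category.id_comp]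
  · intro Z z hz m hm
    have e1 : d1 Z z hz = i₁.τ₃ ≫ m := by
      apply Cofork.IsColimit.hom_ext c1
      refine (fac1 _ _ _).trans ?_
      simp [← hm, i₁.comm₂₃_assoc]
    have e2 : d2 Z z hz = i₂.τ₃ ≫ m := by
      apply Cofork.IsColimit.hom_ext c2
      refine (fac2 _ _ _).trans ?_
      simp [← hm, i₂.comm₂₃_assoc]
    rw [e1, e2, ← Category.assoc, ← Category.assoc, ← Preadditive.add_comp, t3, Category.id_comp]

/-- An additive functor that preserves short exact sequences. -/
structure IsExactFunctor {E' : Type u₁} [Category.{v₁} E'] [Preadditive E'] [ExactCategory E']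
    (F : E ⥤ E') : Prop where
  additive : F.Additive
  map_conflation : ∀ (S : ShortComplex E), Conflation S →
    haveI := additive
    Conflation (S.map F)

/-- A translation functor: an exact automorphism of an exact category. -/
structure Translation (E : Type u) [Category.{v} E] [Preadditive E] [ExactCategory E] where
  functor : E ⥤ E
  inverse : E ⥤ E
  functor_inverse : functor ⋙ inverse = 𝟭 E
  inverse_functor : inverse ⋙ functor = 𝟭 E
  exact_functor : IsExactFunctor functor
  exact_inverse : IsExactFunctor inverse

end ExactCategories

/-! ### Bounded graded objects -/

section Graded

variable (E : Type u) [Category.{v} E] [Preadditive E] [ExactCategory E]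

/-- Bounded `ℤ`-graded objects: families `(A_i)` of objects of `E` with `A_i` a zero object for all
but finitely many `i`. -/
structure GrB where
  obj : ℤ → E
  bounded : {i : ℤ | ¬ IsZero (obj i)}.Finite

variable {E}

namespace GrB

/-- A morphism of graded objects is a family of morphisms. -/
@[ext]
structure Hom (A B : GrB E) where
  app : ∀ i : ℤ, A.obj i ⟶ B.obj i

instance : Category (GrB E) where
  Hom := Hom
  id A := ⟨fun _ => 𝟙 _⟩
  comp f g := ⟨fun i => f.app i ≫ g.app i⟩
  id_comp f := Hom.ext (funext fun _ => Category.id_comp _)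
  comp_id f := Hom.ext (funext fun _ => Category.comp_id _)
  assoc f g h := Hom.ext (funext fun _ => Category.assoc _ _ _)

@[ext] theorem hom_ext {A B : GrB E} {f g : A ⟶ B} (h : ∀ i, f.app i = g.app i) : f = g :=
  Hom.ext (funext h)

@[simp] theorem id_app (A : GrB E) (i : ℤ) : Hom.app (𝟙 A) i = 𝟙 (A.obj i) := rfl
@[simp] theorem comp_app {A B C : GrB E} (f : A ⟶ B) (g : B ⟶ C) (i : ℤ) :
    (f ≫ g).app i = f.app i ≫ g.app i := rfl

/-- Morphisms are added degreewise. -/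
def homEquiv (A B : GrB E) : (A ⟶ B) ≃ (∀ i : ℤ, A.obj i ⟶ B.obj i) where
  toFun f := f.app
  invFun f := ⟨f⟩
  left_inv _ := rfl
  right_inv _ := rfl

instance : Preadditive (GrB E) where
  homGroup A B := (homEquiv A B).addCommGroup
  add_comp _ _ _ f f' g := hom_ext fun i => Preadditive.add_comp _ _ _ (f.app i) (f'.app i) (g.app i)
  comp_add _ _ _ f g g' := hom_ext fun i => Preadditive.comp_add _ _ _ (f.app i) (g.app i) (g'.app i)

@[simp] theorem add_app {A B : GrB E} (f g : A ⟶ B) (i : ℤ) :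
    (f + g).app i = f.app i + g.app i := rfl
@[simp] theorem zero_app {A B : GrB E} (i : ℤ) : Hom.app (0 : A ⟶ B) i = 0 := rfl

/-- The component of degree `i`. -/
@[simps] def eval (i : ℤ) : GrB E ⥤ E where
  obj A := A.obj i
  map f := f.app i

instance (i : ℤ) : (eval (E := E) i).Additive where

/-- An isomorphism of graded objects, degree by degree. -/
@[simps] def isoMk {A B : GrB E} (e : ∀ i, A.obj i ≅ B.obj i) : A ≅ B where
  hom := ⟨fun i => (e i).hom⟩
  inv := ⟨fun i => (e i).inv⟩

theorem isZero_of_forall {A : GrB E} (h : ∀ i, IsZero (A.obj i)) : IsZero A := by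
  rw [IsZero.iff_id_eq_zero]
  ext i
  exact (h i).eq_of_src _ _

instance : HasZeroObject (GrB E) :=
  ⟨⟨⟨fun _ => (0 : E), by simp [isZero_zero]⟩, isZero_of_forall fun _ => isZero_zero E⟩⟩

theorem isZero_biproduct {J : Type w} {f : J → E} [HasBiproduct f] (h : ∀ j, IsZero (f j)) :
    IsZero (⨁ f) := by
  rw [IsZero.iff_id_eq_zero]
  apply biproduct.hom_ext
  intro j
  exact (h j).eq_of_tgt _ _

theorem biproduct_total {J : Type} [Fintype J] (f : J → E) :
    ∑ j, biproduct.π f j ≫ biproduct.ι f j = 𝟙 (⨁ f) :=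
  IsBilimit.total (biproduct.isBilimit f)

theorem sum_app {A B : GrB E} {J : Type} (s : Finset J) (f : J → (A ⟶ B)) (i : ℤ) :
    (∑ j ∈ s, f j).app i = ∑ j ∈ s, (f j).app i := by
  classical
  induction s using Finset.induction_on with
  | empty => simp
  | insert a s ha ih => simp [Finset.sum_insert ha, ih]

/-- Finite direct sums are formed degreewise. -/
def sumBicone {n : ℕ} (F : Fin n → GrB E) : Bicone F where
  pt := ⟨fun i => ⨁ fun j => (F j).obj i, by
    refine (Set.finite_iUnion fun j => (F j).bounded).subset fun i hi => ?_
    by_contra h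
    exact hi (isZero_biproduct fun j => by
      by_contra hj
      exact h (Set.mem_iUnion.2 ⟨j, hj⟩))⟩
  π j := ⟨fun i => biproduct.π (fun j => (F j).obj i) j⟩
  ι j := ⟨fun i => biproduct.ι (fun j => (F j).obj i) j⟩
  ι_π j j' := by
    split_ifs with h
    · subst h; ext i; simp
    · ext i; simp [biproduct.ι_π_ne _ h]

instance : HasFiniteBiproducts (GrB E) where
  out n := ⟨fun F => hasBiproduct_of_total (sumBicone F) (by
    ext i
    rw [sum_app]
    exact biproduct_total _)⟩

/-- The degreewise short exact sequences. -/
def IsConflation (S : ShortComplex (GrB E)) : Prop :=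
  ∀ i, Conflation (S.map (eval i))

theorem inflation_iff {A B : GrB E} (f : A ⟶ B) :
    IsInflationOf IsConflation f ↔ ∀ i, Inflation (f.app i) := by
  constructor
  · rintro ⟨C, g, w, h⟩ i
    exact ⟨C.obj i, g.app i, _, h i⟩
  · intro h
    choose C g w hc using h
    refine ⟨⟨C, B.bounded.subset fun i hi hB => hi ?_⟩, ⟨g⟩, hom_ext w, hc⟩
    exact isZero_right_of_conflation (hc i) hB

theorem deflation_iff {B C : GrB E} (g : B ⟶ C) :
    IsDeflationOf IsConflation g ↔ ∀ i, Deflation (g.app i) := by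
  constructor
  · rintro ⟨A, f, w, h⟩ i
    exact ⟨A.obj i, f.app i, _, h i⟩
  · intro h
    choose A f w hc using h
    refine ⟨⟨A, B.bounded.subset fun i hi hB => hi ?_⟩, ⟨f⟩, hom_ext w, hc⟩
    exact isZero_left_of_conflation (hc i) hB

theorem isKernel_aux {S : ShortComplex (GrB E)} (h : IsConflation S) :
    Nonempty (IsLimit (KernelFork.ofι S.f S.zero)) := by
  have ex : ∀ (W : GrB E) (k : W ⟶ S.X₂), k ≫ S.g = 0 →
      ∀ i, ∃ l : W.obj i ⟶ S.X₁.obj i, l ≫ S.f.app i = k.app i := by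
    intro W k hk i
    obtain ⟨hl⟩ := ExactCategory.isKernel (h i)
    exact ⟨hl.lift (KernelFork.ofι (k.app i) (congrArg (fun x => x.app i) hk)),
      hl.fac (KernelFork.ofι (k.app i) (congrArg (fun x => x.app i) hk)) WalkingParallelPair.zero⟩
  choose l hl using ex
  refine ⟨KernelFork.IsLimit.ofι _ _ (fun {W} k hk => ⟨l W k hk⟩)
    (fun {W} k hk => hom_ext fun i => hl W k hk i) ?_⟩
  intro W k hk m hm
  ext i
  obtain ⟨hl'⟩ := ExactCategory.isKernel (h i)
  refine Fork.IsLimit.hom_ext hl' ?_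
  exact (congrArg (fun x => x.app i) hm).trans (hl W k hk i).symm

theorem isCokernel_aux {S : ShortComplex (GrB E)} (h : IsConflation S) :
    Nonempty (IsColimit (CokernelCofork.ofπ S.g S.zero)) := by
  have ex : ∀ (W : GrB E) (k : S.X₂ ⟶ W), S.f ≫ k = 0 →
      ∀ i, ∃ l : S.X₃.obj i ⟶ W.obj i, S.g.app i ≫ l = k.app i := by
    intro W k hk i
    obtain ⟨hl⟩ := ExactCategory.isCokernel (h i)
    exact ⟨hl.desc (CokernelCofork.ofπ (k.app i) (congrArg (fun x => x.app i) hk)),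
      hl.fac (CokernelCofork.ofπ (k.app i) (congrArg (fun x => x.app i) hk))
        WalkingParallelPair.one⟩
  choose l hl using ex
  refine ⟨CokernelCofork.IsColimit.ofπ _ _ (fun {W} k hk => ⟨l W k hk⟩)
    (fun {W} k hk => hom_ext fun i => hl W k hk i) ?_⟩
  intro W k hk m hm
  ext i
  obtain ⟨hl'⟩ := ExactCategory.isCokernel (h i)
  refine Cofork.IsColimit.hom_ext hl' ?_
  exact (congrArg (fun x => x.app i) hm).trans (hl W k hk i).symm

theorem isPushout_of_forall {A B C D : GrB E} {f : A ⟶ B} {g : A ⟶ C} {h : B ⟶ D} {k : C ⟶ D}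
    (sq : ∀ i, IsPushout (f.app i) (g.app i) (h.app i) (k.app i)) : IsPushout f g h k := by
  refine ⟨⟨hom_ext fun i => (sq i).w⟩, ⟨PushoutCocone.IsColimit.mk _
    (fun s => ⟨fun i => (sq i).desc (s.inl.app i) (s.inr.app i)
      (congrArg (fun x => x.app i) s.condition)⟩) ?_ ?_ ?_⟩⟩
  · intro s; ext i; exact (sq i).inl_desc _ _ _
  · intro s; ext i; exact (sq i).inr_desc _ _ _
  · intro s m h1 h2
    ext i
    refine (sq i).hom_ext ?_ ?_
    · exact (congrArg (fun x => x.app i) h1).trans ((sq i).inl_desc _ _ _).symm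
    · exact (congrArg (fun x => x.app i) h2).trans ((sq i).inr_desc _ _ _).symm

theorem isPullback_of_forall {A B C D : GrB E} {h : D ⟶ B} {k : D ⟶ C} {f : B ⟶ A} {g : C ⟶ A}
    (sq : ∀ i, IsPullback (h.app i) (k.app i) (f.app i) (g.app i)) : IsPullback h k f g := by
  refine ⟨⟨hom_ext fun i => (sq i).w⟩, ⟨PullbackCone.IsLimit.mk _
    (fun s => ⟨fun i => (sq i).lift (s.fst.app i) (s.snd.app i)
      (congrArg (fun x => x.app i) s.condition)⟩) ?_ ?_ ?_⟩⟩
  · intro s; ext i; exact (sq i).lift_fst _ _ _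
  · intro s; ext i; exact (sq i).lift_snd _ _ _
  · intro s m h1 h2
    ext i
    refine (sq i).hom_ext ?_ ?_
    · exact (congrArg (fun x => x.app i) h1).trans ((sq i).lift_fst _ _ _).symm
    · exact (congrArg (fun x => x.app i) h2).trans ((sq i).lift_snd _ _ _).symm

/-- `Gr^b(E)` is an exact category; a sequence is short exact if it is so in every degree. -/
instance : ExactCategory (GrB E) where
  Conflation := IsConflation
  of_iso h e i := ExactCategory.of_iso (h i) ((eval i).mapShortComplex.mapIso e)
  isKernel h := isKernel_aux h
  isCokernel h := isCokernel_aux h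
  inflation_id A := (inflation_iff _).2 fun i => ExactCategory.inflation_id (A.obj i)
  deflation_id A := (deflation_iff _).2 fun i => ExactCategory.deflation_id (A.obj i)
  inflation_comp f g hf hg := (inflation_iff _).2 fun i =>
    ExactCategory.inflation_comp _ _ ((inflation_iff _).1 hf i) ((inflation_iff _).1 hg i)
  deflation_comp f g hf hg := (deflation_iff _).2 fun i =>
    ExactCategory.deflation_comp _ _ ((deflation_iff _).1 hf i) ((deflation_iff _).1 hg i)
  pushout_inflation {A B C} f g hf := by
    have := fun i => ExactCategory.pushout_inflation (f.app i) (g.app i) ((inflation_iff _).1 hf i)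
    choose D h k sq hk using this
    refine ⟨⟨D, (B.bounded.union C.bounded).subset fun i hi => ?_⟩, ⟨h⟩, ⟨k⟩,
      isPushout_of_forall sq, (inflation_iff _).2 hk⟩
    by_contra hBC
    simp only [Set.mem_union, Set.mem_ofPred_eq, not_or, not_not] at hBC
    refine hi ((IsZero.iff_id_eq_zero _).2 ?_)
    exact (sq i).hom_ext (hBC.1.eq_of_src _ _) (hBC.2.eq_of_src _ _)
  pullback_deflation {A B C} f g hf := by
    have := fun i => ExactCategory.pullback_deflation (f.app i) (g.app i) ((deflation_iff _).1 hf i)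
    choose D h k sq hk using this
    refine ⟨⟨D, (B.bounded.union C.bounded).subset fun i hi => ?_⟩, ⟨h⟩, ⟨k⟩,
      isPullback_of_forall sq, (deflation_iff _).2 hk⟩
    by_contra hBC
    simp only [Set.mem_union, Set.mem_ofPred_eq, not_or, not_not] at hBC
    refine hi ((IsZero.iff_id_eq_zero _).2 ?_)
    exact (sq i).hom_ext (hBC.1.eq_of_tgt _ _) (hBC.2.eq_of_tgt _ _)

/-! #### The translation functor -/

/-- Shift of degrees by `n`: `(A_j) ↦ (A_{j+n})`. -/
@[simps] def shiftBy (n : ℤ) : GrB E ⥤ GrB E where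
  obj A := ⟨fun j => A.obj (j + n), A.bounded.preimage (add_left_injective n).injOn⟩
  map f := ⟨fun j => f.app (j + n)⟩

theorem eqToHom_app {A B : GrB E} (h : A = B) (j : ℤ) :
    Hom.app (eqToHom h) j = eqToHom (by rw [h]) := by
  subst h; rfl

theorem app_congr {A B : GrB E} (f : A ⟶ B) {i j : ℤ} (h : i = j) :
    f.app i = eqToHom (by rw [h]) ≫ f.app j ≫ eqToHom (by rw [h]) := by
  subst h; simp

theorem obj_ext {A B : GrB E} (h : A.obj = B.obj) : A = B := by
  cases A; cases B; cases h; rfl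

theorem shiftBy_comp {m n : ℤ} (h : m + n = 0) : shiftBy (E := E) m ⋙ shiftBy n = 𝟭 _ := by
  refine CategoryTheory.Functor.ext (fun A => obj_ext (funext fun j => ?_)) ?_
  · exact congrArg A.obj (by omega)
  · intro A B f
    ext j
    simp only [Functor.comp_map, shiftBy_map_app, Functor.id_map, comp_app, eqToHom_app]
    exact app_congr f (by omega)

theorem isExactFunctor_shiftBy (n : ℤ) : IsExactFunctor (shiftBy (E := E) n) where
  additive := { }
  map_conflation S h j := h (j + n)

/-- The canonical translation functor on `Gr^b(E)`: `T((A_i))_j = A_{j+1}`. -/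
def T : Translation (GrB E) where
  functor := shiftBy 1
  inverse := shiftBy (-1)
  functor_inverse := shiftBy_comp (by omega)
  inverse_functor := shiftBy_comp (by omega)
  exact_functor := isExactFunctor_shiftBy 1
  exact_inverse := isExactFunctor_shiftBy (-1)

/-! #### The embedding in degree `0` -/

/-- The family with `A` in degree `0` and zero objects in all other degrees. -/
def degZeroObj (A : E) : ℤ → E
  | .ofNat 0 => A
  | .ofNat (_ + 1) => 0
  | .negSucc _ => 0

/-- The family of morphisms with `f` in degree `0`. -/
def degZeroMap {A B : E} (f : A ⟶ B) : ∀ i : ℤ, degZeroObj A i ⟶ degZeroObj B i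
  | .ofNat 0 => f
  | .ofNat (_ + 1) => 𝟙 _
  | .negSucc _ => 𝟙 _

theorem isZero_degZeroObj (A : E) : ∀ i : ℤ, i ≠ 0 → IsZero (degZeroObj A i)
  | .ofNat 0, h => absurd rfl h
  | .ofNat (_ + 1), _ => isZero_zero E
  | .negSucc _, _ => isZero_zero E

/-- The embedding of `E` into `Gr^b(E)` as the objects concentrated in degree `0`. -/
def degZero : E ⥤ GrB E where
  obj A := ⟨degZeroObj A, (Set.finite_singleton (0 : ℤ)).subset fun i hi => by
    by_contra h
    exact hi (isZero_degZeroObj A i h)⟩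
  map f := ⟨degZeroMap f⟩
  map_id A := by
    ext i
    rcases i with (_ | _) | _ <;> rfl
  map_comp f g := by
    ext i
    rcases i with (_ | _) | _
    · rfl
    all_goals exact (isZero_zero E).eq_of_src _ _

instance : (degZero (E := E)).Additive where
  map_add {A B f g} := by
    ext i
    rcases i with (_ | _) | _
    · rfl
    all_goals exact (isZero_zero E).eq_of_src _ _

theorem isExactFunctor_degZero : IsExactFunctor (degZero (E := E)) where
  additive := inferInstance
  map_conflation S h i := by
    rcases i with (_ | _) | _
    · exact h
    all_goals exact conflation_of_isZero _ (isZero_zero E) (isZero_zero E) (isZero_zero E)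

/-! #### Even and odd parts -/

/-- A family with only finitely many nonzero members has a direct sum. -/
theorem hasBiproduct_of_finite {J : Type} (f : J → E) (hf : {j | ¬ IsZero (f j)}.Finite) :
    HasBiproduct f := by
  classical
  have : Finite {j // ¬ IsZero (f j)} := hf
  let K := {j // ¬ IsZero (f j)}
  let g : K → E := fun k => f k.1
  have hz : ∀ j, ¬ (¬ IsZero (f j)) → IsZero (f j) := fun j h => not_not.1 h
  refine HasBiproduct.mk ⟨⟨⨁ g, fun j => if h : ¬ IsZero (f j) then biproduct.π g ⟨j, h⟩ else 0,
    fun j => if h : ¬ IsZero (f j) then biproduct.ι g ⟨j, h⟩ else 0, ?_⟩, ⟨?_, ?_⟩⟩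
  · intro j j'
    by_cases hj : IsZero (f j)
    · exact hj.eq_of_src _ _
    by_cases hj' : IsZero (f j')
    · exact hj'.eq_of_tgt _ _
    rw [dif_pos hj, dif_pos hj', biproduct.ι_π]
    by_cases h : j = j'
    · subst h; simp [g]
    · rw [dif_neg h, dif_neg (fun h' => h (congrArg Subtype.val h'))]
  · refine Fan.IsLimit.mk _ (fun s => biproduct.lift fun k : K => s.proj k.1) ?_ ?_
    · intro s j
      by_cases hj : IsZero (f j)
      · exact hj.eq_of_tgt _ _
      · exact (congrArg (fun x => biproduct.lift (fun k : K => s.proj k.1) ≫ x)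
          (dif_pos hj)).trans (biproduct.lift_π _ _)
    · intro s m hm
      apply biproduct.hom_ext
      rintro ⟨j, hj⟩
      rw [biproduct.lift_π]
      exact (congrArg (fun x => m ≫ x) (dif_pos hj)).symm.trans (hm j)
  · refine Cofan.IsColimit.mk _ (fun s => biproduct.desc fun k : K => s.inj k.1) ?_ ?_
    · intro s j
      by_cases hj : IsZero (f j)
      · exact hj.eq_of_src _ _
      · exact (congrArg (fun x => x ≫ biproduct.desc (fun k : K => s.inj k.1))
          (dif_pos hj)).trans (biproduct.ι_desc _ _)
    · intro s m hm
      apply biproduct.hom_ext'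
      rintro ⟨j, hj⟩
      rw [biproduct.ι_desc]
      exact (congrArg (fun x => x ≫ m) (dif_pos hj)).symm.trans (hm j)

instance (s : Set ℤ) (A : GrB E) : HasBiproduct (fun i : s => A.obj i) :=
  hasBiproduct_of_finite _ (A.bounded.preimage Subtype.val_injective.injOn)

/-- The direct sum `⨁_{i ∈ s} A_i` of the components with degree in `s`. -/
@[simps] def sumOn (s : Set ℤ) : GrB E ⥤ E where
  obj A := ⨁ fun i : s => A.obj i
  map f := biproduct.map fun i : s => f.app i

instance (s : Set ℤ) : (sumOn (E := E) s).Additive where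
  map_add {A B f g} := by
    apply biproduct.hom_ext
    intro j
    change biproduct.map (fun i : s => (f + g).app i) ≫ _ =
      (biproduct.map (fun i : s => f.app i) + biproduct.map (fun i : s => g.app i)) ≫ _
    rw [Preadditive.add_comp]
    simp

theorem ι_π_inj {J K : Type} (f : J → E) [HasBiproduct f] (e : K → J)
    (he : Function.Injective e) [HasBiproduct fun k => f (e k)] (k k' : K) :
    biproduct.ι f (e k) ≫ biproduct.π f (e k') =
      biproduct.ι (fun k => f (e k)) k ≫ biproduct.π (fun k => f (e k)) k' := by
  by_cases h : k = k'
  · subst h; simp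
  · rw [biproduct.ι_π_ne _ h, biproduct.ι_π_ne _ (fun h' => h (he h'))]

/-- A direct sum does not change if zero summands are left out. -/
def restrictIso {J : Type} (f : J → E) [HasBiproduct f] (K : Finset J)
    (hK : ∀ j, j ∉ K → IsZero (f j)) : (⨁ fun k : K => f k.1) ≅ ⨁ f where
  hom := biproduct.desc fun k => biproduct.ι f k.1
  inv := biproduct.lift fun k => biproduct.π f k.1
  hom_inv_id := by
    classical
    apply biproduct.hom_ext'
    intro k
    apply biproduct.hom_ext
    intro k'
    simp [ι_π_inj f (fun k : K => k.1) Subtype.val_injective]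
  inv_hom_id := by
    classical
    apply biproduct.hom_ext'
    intro j
    by_cases hj : j ∈ K
    · have : biproduct.ι f j ≫ biproduct.lift (fun k : K => biproduct.π f k.1) =
          biproduct.ι (fun k : K => f k.1) ⟨j, hj⟩ := by
        apply biproduct.hom_ext
        intro k'
        simpa using ι_π_inj f (fun k : K => k.1) Subtype.val_injective ⟨j, hj⟩ k'
      rw [reassoc_of% this]
      simp
    · exact (hK j hj).eq_of_src _ _

theorem restrictIso_naturality {J : Type} {f g : J → E} [HasBiproduct f] [HasBiproduct g]
    (K : Finset J) (m : ∀ j, f j ⟶ g j) (hf : ∀ j, j ∉ K → IsZero (f j))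
    (hg : ∀ j, j ∉ K → IsZero (g j)) :
    (restrictIso f K hf).hom ≫ biproduct.map m =
      biproduct.map (fun k : K => m k.1) ≫ (restrictIso g K hg).hom := by
  apply biproduct.hom_ext'
  intro j
  simp [restrictIso]

/-- The direct sum of a family of short complexes. -/
def sumComplex {J : Type} (S : J → ShortComplex E) [HasBiproduct fun j => (S j).X₁]
    [HasBiproduct fun j => (S j).X₂] [HasBiproduct fun j => (S j).X₃] : ShortComplex E where
  X₁ := ⨁ fun j => (S j).X₁
  X₂ := ⨁ fun j => (S j).X₂
  X₃ := ⨁ fun j => (S j).X₃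
  f := biproduct.map fun j => (S j).f
  g := biproduct.map fun j => (S j).g
  zero := by
    apply biproduct.hom_ext
    intro j
    simp

theorem conflation_sum_finset {J : Type} (S : J → ShortComplex E) (h : ∀ j, Conflation (S j))
    (K : Finset J) : Conflation (sumComplex fun k : K => S k.1) := by
  classical
  induction K using Finset.induction_on with
  | empty =>
    apply conflation_of_isZero
    all_goals exact isZero_biproduct fun j => absurd j.2 (Finset.notMem_empty _)
  | insert a K ha ih =>
    have ne : ∀ k : K, (⟨k.1, Finset.mem_insert_of_mem k.2⟩ : (insert a K : Finset J)) ≠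
        ⟨a, Finset.mem_insert_self a K⟩ := by
      rintro k hk
      rw [Subtype.mk.injEq] at hk
      exact ha (hk ▸ k.2)
    refine conflation_of_sum (h a) ih
      { τ₁ := biproduct.ι (fun k : (insert a K : Finset J) => (S k.1).X₁)
          ⟨a, Finset.mem_insert_self a K⟩
        τ₂ := biproduct.ι (fun k : (insert a K : Finset J) => (S k.1).X₂)
          ⟨a, Finset.mem_insert_self a K⟩
        τ₃ := biproduct.ι (fun k : (insert a K : Finset J) => (S k.1).X₃)
          ⟨a, Finset.mem_insert_self a K⟩
        comm₁₂ := by simp [sumComplex]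
        comm₂₃ := by simp [sumComplex] }
      { τ₁ := biproduct.desc fun k : K => biproduct.ι (fun k : (insert a K : Finset J) =>
          (S k.1).X₁) ⟨k.1, Finset.mem_insert_of_mem k.2⟩
        τ₂ := biproduct.desc fun k : K => biproduct.ι (fun k : (insert a K : Finset J) =>
          (S k.1).X₂) ⟨k.1, Finset.mem_insert_of_mem k.2⟩
        τ₃ := biproduct.desc fun k : K => biproduct.ι (fun k : (insert a K : Finset J) =>
          (S k.1).X₃) ⟨k.1, Finset.mem_insert_of_mem k.2⟩
        comm₁₂ := by apply biproduct.hom_ext'; intro j; simp [sumComplex]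
        comm₂₃ := by apply biproduct.hom_ext'; intro j; simp [sumComplex] }
      { τ₁ := biproduct.π (fun k : (insert a K : Finset J) => (S k.1).X₁)
          ⟨a, Finset.mem_insert_self a K⟩
        τ₂ := biproduct.π (fun k : (insert a K : Finset J) => (S k.1).X₂)
          ⟨a, Finset.mem_insert_self a K⟩
        τ₃ := biproduct.π (fun k : (insert a K : Finset J) => (S k.1).X₃)
          ⟨a, Finset.mem_insert_self a K⟩
        comm₁₂ := by simp [sumComplex]
        comm₂₃ := by simp [sumComplex] }
      { τ₁ := biproduct.lift fun k : K => biproduct.π (fun k : (insert a K : Finset J) =>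
          (S k.1).X₁) ⟨k.1, Finset.mem_insert_of_mem k.2⟩
        τ₂ := biproduct.lift fun k : K => biproduct.π (fun k : (insert a K : Finset J) =>
          (S k.1).X₂) ⟨k.1, Finset.mem_insert_of_mem k.2⟩
        τ₃ := biproduct.lift fun k : K => biproduct.π (fun k : (insert a K : Finset J) =>
          (S k.1).X₃) ⟨k.1, Finset.mem_insert_of_mem k.2⟩
        comm₁₂ := by apply biproduct.hom_ext; intro j; simp [sumComplex]
        comm₂₃ := by apply biproduct.hom_ext; intro j; simp [sumComplex] }
      ?_ ?_ ?_ ?_ ?_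
    · have key : ∀ f : {j // j ∈ insert a K} → E,
          biproduct.ι f ⟨a, Finset.mem_insert_self a K⟩ ≫
            biproduct.π f ⟨a, Finset.mem_insert_self a K⟩ = 𝟙 _ := fun f => by simp
      exact ShortComplex.hom_ext _ _ (key fun k => (S k.1).X₁) (key fun k => (S k.1).X₂)
        (key fun k => (S k.1).X₃)
    · have key : ∀ f : {j // j ∈ insert a K} → E,
          biproduct.desc (fun k : K => biproduct.ι f ⟨k.1, Finset.mem_insert_of_mem k.2⟩) ≫
          biproduct.lift (fun k : K => biproduct.π f ⟨k.1, Finset.mem_insert_of_mem k.2⟩) =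
            𝟙 _ := fun f => by
        apply biproduct.hom_ext'; intro j
        apply biproduct.hom_ext; intro j'
        simp [ι_π_inj f (fun k : K => ⟨k.1, Finset.mem_insert_of_mem k.2⟩) (fun x y hxy =>
          Subtype.ext (congrArg (fun z => z.1) hxy))]
      exact ShortComplex.hom_ext _ _ (key fun k => (S k.1).X₁) (key fun k => (S k.1).X₂)
        (key fun k => (S k.1).X₃)
    · have key : ∀ f : {j // j ∈ insert a K} → E,
          biproduct.ι f ⟨a, Finset.mem_insert_self a K⟩ ≫
          biproduct.lift (fun k : K => biproduct.π f ⟨k.1, Finset.mem_insert_of_mem k.2⟩) =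
            0 := fun f => by
        apply biproduct.hom_ext; intro j'
        simp [biproduct.ι_π_ne _ (ne j').symm]
      exact ShortComplex.hom_ext _ _ (key fun k => (S k.1).X₁) (key fun k => (S k.1).X₂)
        (key fun k => (S k.1).X₃)
    · have key : ∀ f : {j // j ∈ insert a K} → E,
          biproduct.desc (fun k : K => biproduct.ι f ⟨k.1, Finset.mem_insert_of_mem k.2⟩) ≫
            biproduct.π f ⟨a, Finset.mem_insert_self a K⟩ = 0 := fun f => by
        apply biproduct.hom_ext'; intro j'
        simp [biproduct.ι_π_ne _ (ne j')]
      exact ShortComplex.hom_ext _ _ (key fun k => (S k.1).X₁) (key fun k => (S k.1).X₂)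
        (key fun k => (S k.1).X₃)
    · have key : ∀ f : {j // j ∈ insert a K} → E,
          biproduct.π f ⟨a, Finset.mem_insert_self a K⟩ ≫
            biproduct.ι f ⟨a, Finset.mem_insert_self a K⟩ +
          biproduct.lift (fun k : K => biproduct.π f ⟨k.1, Finset.mem_insert_of_mem k.2⟩) ≫
            biproduct.desc (fun k : K => biproduct.ι f ⟨k.1, Finset.mem_insert_of_mem k.2⟩) =
          𝟙 (⨁ f) := by
        intro f
        rw [biproduct.lift_desc, ← biproduct_total f,
          show (Finset.univ : Finset {j // j ∈ insert a K}) = _ from Finset.attach_insert _ _,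
          Finset.sum_insert, Finset.sum_image]
        · rfl
        · intro x _ y _ hxy
          exact Subtype.ext (congrArg (fun z => z.1) hxy)
        · simp [ha]
      exact ShortComplex.hom_ext _ _ (key fun k => (S k.1).X₁) (key fun k => (S k.1).X₂)
        (key fun k => (S k.1).X₃)

theorem isExactFunctor_sumOn (s : Set ℤ) : IsExactFunctor (sumOn (E := E) s) where
  additive := inferInstance
  map_conflation S h := by
    classical
    have fin : {j : s | ¬ IsZero (S.X₂.obj j.1)}.Finite :=
      S.X₂.bounded.preimage Subtype.val_injective.injOn
    let K := fin.toFinset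
    have h2 : ∀ j : s, j ∉ K → IsZero (S.X₂.obj j.1) := by
      intro j hj
      by_contra hz
      exact hj (fin.mem_toFinset.2 hz)
    refine ExactCategory.of_iso
      (conflation_sum_finset (fun j : s => S.map (eval j.1)) (fun j => h j.1) K)
      (ShortComplex.isoMk
        (restrictIso (fun j : s => S.X₁.obj j.1) K
          fun j hj => isZero_left_of_conflation (h j.1) (h2 j hj))
        (restrictIso (fun j : s => S.X₂.obj j.1) K h2)
        (restrictIso (fun j : s => S.X₃.obj j.1) K
          fun j hj => isZero_right_of_conflation (h j.1) (h2 j hj)) ?_ ?_)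
    · exact restrictIso_naturality K (fun j : s => S.f.app j.1) _ _
    · exact restrictIso_naturality K (fun j : s => S.g.app j.1) _ _

/-- The exact functor `A ↦ A^ev = ⨁_{i even} A_i`. -/
abbrev ev : GrB E ⥤ E := sumOn {i | Even i}

/-- The exact functor `A ↦ A^od = ⨁_{i odd} A_i`. -/
abbrev od : GrB E ⥤ E := sumOn {i | Odd i}

instance (s : Set ℤ) (A : GrB E) : HasBiproduct (fun i : s => A.obj (i.1 + 1)) :=
  inferInstanceAs (HasBiproduct (fun i : s => (T.functor.obj A).obj i))

/-- The canonical identification `(TA)^ev = A^od`. -/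
def evShift (A : GrB E) : ev.obj (T.functor.obj A) ≅ od.obj A :=
  biproduct.whiskerEquiv (f := fun i : ({i | Even i} : Set ℤ) => A.obj (i.1 + 1))
    (g := fun i : ({i | Odd i} : Set ℤ) => A.obj i.1)
    { toFun := fun i => ⟨i.1 + 1, Even.add_one i.2⟩
      invFun := fun i => ⟨i.1 - 1, Odd.sub_odd i.2 odd_one⟩
      left_inv := fun i => Subtype.ext (by simp)
      right_inv := fun i => Subtype.ext (by simp) }
    fun _ => Iso.refl _

/-- The canonical identification `(TA)^od = A^ev`. -/
def odShift (A : GrB E) : od.obj (T.functor.obj A) ≅ ev.obj A :=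
  biproduct.whiskerEquiv (f := fun i : ({i | Odd i} : Set ℤ) => A.obj (i.1 + 1))
    (g := fun i : ({i | Even i} : Set ℤ) => A.obj i.1)
    { toFun := fun i => ⟨i.1 + 1, Odd.add_one i.2⟩
      invFun := fun i => ⟨i.1 - 1, Even.sub_odd i.2 odd_one⟩
      left_inv := fun i => Subtype.ext (by simp)
      right_inv := fun i => Subtype.ext (by simp) }
    fun _ => Iso.refl _

end GrB
end Graded

/-! ### Picard categories -/

section Picard

/-- A (commutative) Picard category: a symmetric monoidal category in which all morphisms are
isomorphisms and all functors `X ↦ W ⊗ X` are equivalences. -/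
class PicardCategory (P : Type w) [Category.{v₁} P] [MonoidalCategory P] [SymmetricCategory P] :
    Prop extends IsGroupoid P where
  isEquivalence_tensorLeft : ∀ W : P, (tensorLeft W).IsEquivalence

attribute [instance] PicardCategory.isEquivalence_tensorLeft

variable {P : Type w} [Category.{v₁} P] [MonoidalCategory P] [SymmetricCategory P]

/-- A (reduced) unit structure on an object `U`: an isomorphism `U ≅ U ⊗ U`. -/
abbrev UnitStr (U : P) := U ≅ U ⊗ U

/-- `α : U ⟶ V` is a morphism of units `(U, δ) ⟶ (V, δ')`. -/
def IsUnitHom {U V : P} (δ : UnitStr U) (δ' : UnitStr V) (α : U ⟶ V) : Prop :=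
  δ.hom ≫ (α ⊗ₘ α) = α ≫ δ'.hom

/-- The isomorphism `(X₁ ⊗ X₂) ⊗ (Y₁ ⊗ Y₂) ≅ (X₁ ⊗ Y₁) ⊗ (X₂ ⊗ Y₂)` that exchanges the two middle
factors. -/
@[simps] def interchange (X₁ X₂ Y₁ Y₂ : P) : (X₁ ⊗ X₂) ⊗ (Y₁ ⊗ Y₂) ≅ (X₁ ⊗ Y₁) ⊗ (X₂ ⊗ Y₂) where
  hom := tensorμ X₁ X₂ Y₁ Y₂
  inv := tensorδ X₁ X₂ Y₁ Y₂
  hom_inv_id := tensorμ_tensorδ _ _ _ _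
  inv_hom_id := tensorδ_tensorμ _ _ _ _

/-- The product of two units. -/
def prodUnit {U V : P} (δ : UnitStr U) (δ' : UnitStr V) : UnitStr (U ⊗ V) :=
  (δ ⊗ᵢ δ') ≪≫ interchange U U V V

/-- The unit structure on `U` that is induced from a unit structure on `V` by `e : U ≅ V`. -/
def inducedUnit {U V : P} (δ : UnitStr V) (e : U ≅ V) : UnitStr U :=
  e ≪≫ δ ≪≫ (e ⊗ᵢ e).symm

variable [PicardCategory P]

/-- A right inverse `X^*` of every object `X`, i.e. an object `X^*` and a unit structure on
`X ⊗ X^*`. -/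
structure RightInverses (P : Type w) [Category.{v₁} P] [MonoidalCategory P] where
  star : P → P
  unit : ∀ X : P, X ⊗ star X ≅ (X ⊗ star X) ⊗ (X ⊗ star X)

/-- Every object has a right inverse. -/
theorem nonempty_rightInverses : Nonempty (RightInverses P) := by
  have h : ∀ X : P, ∃ (Y : P), Nonempty (X ⊗ Y ≅ 𝟙_ P) := fun X =>
    ⟨(tensorLeft X).objPreimage (𝟙_ P), ⟨(tensorLeft X).objObjPreimageIso (𝟙_ P)⟩⟩
  choose Y e using h
  exact ⟨Y, fun X => inducedUnit (λ_ (𝟙_ P)).symm (e X).some⟩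

theorem existsUnique_unitHom_one {U : P} (δ : UnitStr U) :
    ∃! ω : U ⟶ 𝟙_ P, IsUnitHom δ (λ_ (𝟙_ P)).symm ω := by
  have key : ∀ ω : U ⟶ 𝟙_ P, IsUnitHom δ (λ_ (𝟙_ P)).symm ω ↔
      U ◁ ω = δ.inv ≫ (ρ_ U).inv := by
    intro ω
    have e1 : ω ≫ (λ_ (𝟙_ P)).inv = (ρ_ U).inv ≫ (ω ▷ 𝟙_ P) := by
      rw [unitors_inv_equal, rightUnitor_inv_naturality]
    rw [IsUnitHom, Iso.symm_hom, e1, MonoidalCategory.tensorHom_def', ← Category.assoc,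
      cancel_mono, ← Iso.eq_inv_comp]
  refine ⟨(tensorLeft U).preimage (δ.inv ≫ (ρ_ U).inv), ?_, ?_⟩
  · exact (key _).2 ((tensorLeft U).map_preimage _)
  · intro ω hω
    apply (tensorLeft U).map_injective
    rw [(tensorLeft U).map_preimage]
    exact (key _).1 hω

theorem IsUnitHom.comp {U V W : P} {δ : UnitStr U} {δ' : UnitStr V} {δ'' : UnitStr W}
    {α : U ⟶ V} {β : V ⟶ W} (hα : IsUnitHom δ δ' α) (hβ : IsUnitHom δ' δ'' β) :
    IsUnitHom δ δ'' (α ≫ β) := by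
  unfold IsUnitHom at *
  rw [← tensorHom_comp_tensorHom, reassoc_of% hα, hβ, Category.assoc]

theorem IsUnitHom.inv {U V : P} {δ : UnitStr U} {δ' : UnitStr V}
    {α : U ⟶ V} (hα : IsUnitHom δ δ' α) : IsUnitHom δ' δ (inv α) := by
  unfold IsUnitHom at *
  rw [IsIso.eq_inv_comp, ← reassoc_of% hα, tensorHom_comp_tensorHom]
  simp

/-- Units are unique up to unique isomorphism. -/
theorem existsUnique_unitHom {U V : P} (δ : UnitStr U) (δ' : UnitStr V) :
    ∃! α : U ⟶ V, IsUnitHom δ δ' α := by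
  obtain ⟨ω, hω, hu⟩ := existsUnique_unitHom_one δ
  obtain ⟨ω', hω', -⟩ := existsUnique_unitHom_one δ'
  refine ⟨ω ≫ inv ω', hω.comp hω'.inv, fun α hα => ?_⟩
  rw [IsIso.eq_comp_inv]
  exact hu _ (hα.comp hω')

theorem existsUnique_dual {X Y A B : P} (α : X ⟶ Y) (δ : UnitStr (X ⊗ A)) (δ' : UnitStr (Y ⊗ B)) :
    ∃! β : A ⟶ B, IsUnitHom δ δ' (α ⊗ₘ β) := by
  obtain ⟨u, hu, huniq⟩ := existsUnique_unitHom δ δ'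
  have key : ∀ β : A ⟶ B, IsUnitHom δ δ' (α ⊗ₘ β) ↔ X ◁ β = u ≫ inv (α ▷ B) := by
    intro β
    rw [IsIso.eq_comp_inv, ← MonoidalCategory.tensorHom_def']
    exact ⟨fun h => huniq _ h, fun h => h ▸ hu⟩
  refine ⟨(tensorLeft X).preimage (u ≫ inv (α ▷ B)), ?_, ?_⟩
  · exact (key _).2 ((tensorLeft X).map_preimage _)
  · intro β hβ
    apply (tensorLeft X).map_injective
    rw [(tensorLeft X).map_preimage]
    exact (key _).1 hβ

namespace RightInverses

variable (D : RightInverses P)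

/-- `α^* : X^* ⟶ Y^*`, the unique morphism such that `α ⊗ α^*` is a morphism of units. -/
def starMap {X Y : P} (α : X ⟶ Y) : D.star X ⟶ D.star Y :=
  (existsUnique_dual α (D.unit X) (D.unit Y)).choose

theorem starMap_spec {X Y : P} (α : X ⟶ Y) :
    IsUnitHom (D.unit X) (D.unit Y) (α ⊗ₘ D.starMap α) :=
  (existsUnique_dual α (D.unit X) (D.unit Y)).choose_spec.1

theorem starMap_eq {X Y : P} {α : X ⟶ Y} {β : D.star X ⟶ D.star Y}
    (h : IsUnitHom (D.unit X) (D.unit Y) (α ⊗ₘ β)) : D.starMap α = β :=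
  ((existsUnique_dual α (D.unit X) (D.unit Y)).choose_spec.2 β h).symm

theorem starMap_id (X : P) : D.starMap (𝟙 X) = 𝟙 (D.star X) :=
  D.starMap_eq (by simp [IsUnitHom])

theorem starMap_comp {X Y Z : P} (f : X ⟶ Y) (g : Y ⟶ Z) :
    D.starMap (f ≫ g) = D.starMap f ≫ D.starMap g := D.starMap_eq (by
  rw [← tensorHom_comp_tensorHom]
  exact (D.starMap_spec f).comp (D.starMap_spec g))

/-- The canonical isomorphism `(X ⊗ Y)^* ≅ X^* ⊗ Y^*`: the unique `β` such that
`(X ⊗ Y) ⊗ (X ⊗ Y)^* ⟶ (X ⊗ Y) ⊗ (X^* ⊗ Y^*) ≅ (X ⊗ X^*) ⊗ (Y ⊗ Y^*)`, with first map `id ⊗ β`, is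
a morphism of units. -/
def starTensor (X Y : P) : D.star (X ⊗ Y) ⟶ D.star X ⊗ D.star Y :=
  (existsUnique_dual (𝟙 (X ⊗ Y)) (D.unit (X ⊗ Y))
    (inducedUnit (prodUnit (D.unit X) (D.unit Y)) (interchange X Y (D.star X) (D.star Y)))).choose

end RightInverses

/-- The action of an automorphism `α` of `W` on an arbitrary object `V`, by the canonical
isomorphism `Aut(W) ≅ Aut(V)`: this is the automorphism `θ` of `V` with `id_W ⊗ θ = α ⊗ id_V`. -/
def transportAut {W : P} (α : W ⟶ W) (V : P) : V ⟶ V :=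
  (tensorLeft W).preimage (α ▷ V)

/-- The action of `ε(X) = ψ_{X,X}` on an object `V`. -/
def epsilon (X V : P) : V ⟶ V := transportAut (β_ X X).hom V

end Picard

/-! ### Determinant functors -/

section Det

variable (E : Type u) [Category.{v} E] [Preadditive E] [ExactCategory E]
variable (P : Type w) [Category.{v₁} P] [MonoidalCategory P] [SymmetricCategory P]

/-- The data of a determinant functor `(f₁, f₂)` on an exact category, without the axioms: a functor
`f₁` on the category of isomorphisms of `E` and isomorphisms `f₂(Δ) : f₁(B) ≅ f₁(A) ⊗ f₁(C)` for all
short exact sequences `Δ : A ⟶ B ⟶ C`. -/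
structure DetData where
  F : Core E ⥤ P
  iso : ∀ S : ShortComplex E, Conflation S → (F.obj ⟨S.X₂⟩ ≅ F.obj ⟨S.X₁⟩ ⊗ F.obj ⟨S.X₃⟩)

/-- A determinant functor on an exact category `E` with values in `P`. -/
structure DetFunctor extends DetData E P where
  naturality : ∀ (S S' : ShortComplex E) (h : Conflation S) (h' : Conflation S')
    (a : S.X₁ ≅ S'.X₁) (b : S.X₂ ≅ S'.X₂) (c : S.X₃ ≅ S'.X₃),
    a.hom ≫ S'.f = S.f ≫ b.hom → b.hom ≫ S'.g = S.g ≫ c.hom →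
    F.map ⟨b⟩ ≫ (iso S' h').hom = (iso S h).hom ≫ (F.map ⟨a⟩ ⊗ₘ F.map ⟨c⟩)
  /-- the short exact sequences `A ⟶ B ⟶ C'`, `A ⟶ C ⟶ B'`, `B ⟶ C ⟶ A'`, `C' ⟶ B' ⟶ A'` are the
  two rows and the two columns of a commutative diagram -/
  associativity : ∀ {A B C A' B' C' : E}
    (f : A ⟶ B) (g : B ⟶ C') (k : A ⟶ C) (l : C ⟶ B') (m : B ⟶ C) (n : C ⟶ A')
    (p : C' ⟶ B') (q : B' ⟶ A')
    (w₁ : f ≫ g = 0) (w₂ : k ≫ l = 0) (w₃ : m ≫ n = 0) (w₄ : p ≫ q = 0)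
    (h₁ : Conflation (ShortComplex.mk f g w₁)) (h₂ : Conflation (ShortComplex.mk k l w₂))
    (v₁ : Conflation (ShortComplex.mk m n w₃)) (v₂ : Conflation (ShortComplex.mk p q w₄)),
    f ≫ m = k → g ≫ p = m ≫ l → l ≫ q = n →
    (iso _ h₂).hom ≫ (F.obj ⟨A⟩ ◁ (iso _ v₂).hom) ≫
        (α_ (F.obj ⟨A⟩) (F.obj ⟨C'⟩) (F.obj ⟨A'⟩)).inv =
      (iso _ v₁).hom ≫ ((iso _ h₁).hom ▷ F.obj ⟨A'⟩)
  commutativity : ∀ {A B : E} (b : BinaryBicone A B), Nonempty b.IsBilimit →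
    ∀ (h₁ : Conflation (ShortComplex.mk b.inl b.snd b.inl_snd))
      (h₂ : Conflation (ShortComplex.mk b.inr b.fst b.inr_fst)),
    (iso _ h₁).hom ≫ (β_ (F.obj ⟨A⟩) (F.obj ⟨B⟩)).hom = (iso _ h₂).hom

variable {E P}

/-- `λ : f₁ ≅ g₁` is compatible with `f₂` and `g₂`. -/
def DetData.IsHom (f g : DetData E P) (t : f.F ≅ g.F) : Prop :=
  ∀ (S : ShortComplex E) (h : Conflation S),
    (f.iso S h).hom ≫ (t.hom.app ⟨S.X₁⟩ ⊗ₘ t.hom.app ⟨S.X₃⟩) = t.hom.app ⟨S.X₂⟩ ≫ (g.iso S h).hom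

namespace DetFunctor

/-- A morphism of determinant functors. -/
@[ext] structure Hom (f g : DetFunctor E P) where
  iso : f.F ≅ g.F
  isHom : f.IsHom g.toDetData iso

/-- The category `det(E, P)`. -/
instance : Category (DetFunctor E P) where
  Hom := Hom
  id f := ⟨Iso.refl _, fun S h => by simp⟩
  comp {f g k} s t := ⟨s.iso ≪≫ t.iso, fun S h => by
    have h1 := s.isHom S h
    have h2 := t.isHom S h
    simp only [Iso.trans_hom, NatTrans.comp_app, ← tensorHom_comp_tensorHom]
    rw [reassoc_of% h1, h2, Category.assoc]⟩
  id_comp f := Hom.ext (Iso.refl_trans _)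
  comp_id f := Hom.ext (Iso.trans_refl _)
  assoc f g h := Hom.ext (Iso.trans_assoc _ _ _)

@[ext] theorem hom_ext {f g : DetFunctor E P} {s t : f ⟶ g}
    (h : ∀ A : E, s.iso.hom.app ⟨A⟩ = t.iso.hom.app ⟨A⟩) : s = t :=
  Hom.ext (Iso.ext (NatTrans.ext (funext fun A => h A.of)))

@[simp] theorem id_iso (f : DetFunctor E P) : Hom.iso (𝟙 f) = Iso.refl _ := rfl
@[simp] theorem comp_iso {f g h : DetFunctor E P} (s : f ⟶ g) (t : g ⟶ h) :
    (s ≫ t).iso = s.iso ≪≫ t.iso := rfl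

end DetFunctor

/-- Restriction of determinant functors along an exact functor. -/
def precomp {E₀ : Type u₂} [Category.{v₂} E₀] [Preadditive E₀] [ExactCategory E₀] (G : E₀ ⥤ E)
    (hG : IsExactFunctor G) : DetFunctor E P ⥤ DetFunctor E₀ P :=
  haveI := hG.additive
  { obj f :=
      { F := G.core ⋙ f.F
        iso := fun S h => f.iso (S.map G) (hG.map_conflation S h)
        naturality := fun S S' h h' a b c e₁ e₂ =>
          f.naturality (S.map G) (S'.map G) _ _ (G.mapIso a) (G.mapIso b) (G.mapIso c)
            ((G.map_comp _ _).symm.trans ((congrArg G.map e₁).trans (G.map_comp _ _)))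
            ((G.map_comp _ _).symm.trans ((congrArg G.map e₂).trans (G.map_comp _ _)))
        associativity := fun f' g k l m n p q w₁ w₂ w₃ w₄ h₁ h₂ v₁ v₂ e₁ e₂ e₃ =>
          f.associativity (G.map f') (G.map g) (G.map k) (G.map l) (G.map m) (G.map n) (G.map p)
            (G.map q) _ _ _ _ (hG.map_conflation _ h₁) (hG.map_conflation _ h₂)
            (hG.map_conflation _ v₁) (hG.map_conflation _ v₂)
            (by rw [← G.map_comp, e₁]) (by rw [← G.map_comp, e₂, G.map_comp])
            (by rw [← G.map_comp, e₃])
        commutativity := fun b hb h₁ h₂ =>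
          haveI := preservesBinaryBiproducts_of_preservesBiproducts G
          f.commutativity (G.mapBinaryBicone b) (hb.map (isBinaryBilimitOfPreserves G))
            (hG.map_conflation _ h₁) (hG.map_conflation _ h₂) }
    map t := ⟨Functor.isoWhiskerLeft G.core t.iso, fun S h => t.isHom _ (hG.map_conflation S h)⟩
    map_id _ := rfl
    map_comp _ _ := rfl }

instance (T : Translation E) : T.functor.Additive := T.exact_functor.additive

variable (P) in
/-- The data `(g₁, g₂, μ)` of a determinant functor on an exact category with translation, without
the axioms. -/
structure DetDataT (T : Translation E) extends DetData E P where
  μ : ∀ A : E, UnitStr (F.obj ⟨A⟩ ⊗ F.obj ⟨T.functor.obj A⟩)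

variable (P) in
/-- A determinant functor on an exact category with translation `(E, T)` with values in `P`. -/
structure DetFunctorT (T : Translation E) extends DetFunctor E P where
  /-- a unit structure on `g₁(A) ⊗ g₁(TA)` -/
  μ : ∀ A : E, UnitStr (F.obj ⟨A⟩ ⊗ F.obj ⟨T.functor.obj A⟩)
  isUnitHom_iso : ∀ {A B : E} (a : A ≅ B),
    IsUnitHom (μ A) (μ B) (F.map ⟨a⟩ ⊗ₘ F.map ⟨T.functor.mapIso a⟩)
  isUnitHom_conflation : ∀ (S : ShortComplex E) (h : Conflation S),
    IsUnitHom (μ S.X₂) (prodUnit (μ S.X₁) (μ S.X₃))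
      (((iso S h).hom ⊗ₘ (iso (S.map T.functor) (T.exact_functor.map_conflation S h)).hom) ≫
        (interchange (F.obj ⟨S.X₁⟩) (F.obj ⟨S.X₃⟩) (F.obj ⟨T.functor.obj S.X₁⟩)
          (F.obj ⟨T.functor.obj S.X₃⟩)).hom)

namespace DetFunctorT

variable {T : Translation E}

/-- The data underlying a determinant functor. -/
def data (g : DetFunctorT P T) : DetDataT P T where
  toDetData := g.toDetData
  μ := g.μ

/-- A morphism of determinant functors on `(E, T)`: a morphism of determinant functors on `E` that
is compatible with the unit structures. -/
@[ext] structure Hom (g g' : DetFunctorT P T) where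
  hom : g.toDetFunctor ⟶ g'.toDetFunctor
  isUnitHom : ∀ A : E, IsUnitHom (g.μ A) (g'.μ A)
    (hom.iso.hom.app ⟨A⟩ ⊗ₘ hom.iso.hom.app ⟨T.functor.obj A⟩)

/-- The category `det((E, T), P)`. -/
instance : Category (DetFunctorT P T) where
  Hom := Hom
  id g := ⟨𝟙 _, fun A => by simp [IsUnitHom]⟩
  comp s t := ⟨s.hom ≫ t.hom, fun A => by
    have h1 := s.isUnitHom A
    have h2 := t.isUnitHom A
    unfold IsUnitHom at *
    simp only [DetFunctor.comp_iso, Iso.trans_hom, NatTrans.comp_app, ← tensorHom_comp_tensorHom]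
    rw [reassoc_of% h1, h2]
    simp only [Category.assoc]⟩
  id_comp s := Hom.ext (Category.id_comp s.hom)
  comp_id s := Hom.ext (Category.comp_id s.hom)
  assoc s t r := Hom.ext (Category.assoc s.hom t.hom r.hom)

variable (P T) in
/-- The functor that forgets the unit structures. -/
@[simps] def forgetUnit : DetFunctorT P T ⥤ DetFunctor E P where
  obj g := g.toDetFunctor
  map s := s.hom

variable (P T) in
/-- The functor `(g₁, g₂, μ) ↦ g₁`. -/
@[simps] def forgetFunctor : DetFunctorT P T ⥤ (Core E ⥤ P) where
  obj g := g.F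
  map s := s.hom.iso.hom

end DetFunctorT

/-! ### Determinant functors on bounded graded objects -/

variable (E P) in
/-- The functor `W : det((Gr^b(E), T), P) ⥤ det(E, P)`, restriction to degree `0`. -/
def W : DetFunctorT P (GrB.T (E := E)) ⥤ DetFunctor E P :=
  DetFunctorT.forgetUnit P GrB.T ⋙ precomp GrB.degZero GrB.isExactFunctor_degZero

variable [PicardCategory P]

section Inverse

variable (D : RightInverses P) (f : DetFunctor E P)

/-- The functor `g₁ : A ↦ f₁(A^ev) ⊗ f₁(A^od)^*`, `a ↦ f₁(a^ev) ⊗ f₁(a^od)^*`. -/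
@[simps] def evOdF : Core (GrB E) ⥤ P where
  obj A := f.F.obj ⟨GrB.ev.obj A.of⟩ ⊗ D.star (f.F.obj ⟨GrB.od.obj A.of⟩)
  map a := f.F.map ⟨GrB.ev.mapIso a.iso⟩ ⊗ₘ D.starMap (f.F.map ⟨GrB.od.mapIso a.iso⟩)
  map_id A := by
    have h1 : f.F.map ⟨GrB.ev.mapIso (Iso.refl A.of)⟩ = 𝟙 _ := by
      rw [Functor.mapIso_refl]; exact f.F.map_id _
    have h2 : f.F.map ⟨GrB.od.mapIso (Iso.refl A.of)⟩ = 𝟙 _ := by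
      rw [Functor.mapIso_refl]; exact f.F.map_id _
    refine (congrArg₂ (fun x y => x ⊗ₘ D.starMap y) h1 h2).trans ?_
    exact (congrArg (fun x => _ ⊗ₘ x) (D.starMap_id _)).trans (id_tensorHom_id _ _)
  map_comp {A B C} a b := by
    have h1 : f.F.map ⟨GrB.ev.mapIso (a.iso ≪≫ b.iso)⟩ =
        f.F.map ⟨GrB.ev.mapIso a.iso⟩ ≫ f.F.map ⟨GrB.ev.mapIso b.iso⟩ := by
      rw [Functor.mapIso_trans]; exact f.F.map_comp _ _
    have h2 : f.F.map ⟨GrB.od.mapIso (a.iso ≪≫ b.iso)⟩ =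
        f.F.map ⟨GrB.od.mapIso a.iso⟩ ≫ f.F.map ⟨GrB.od.mapIso b.iso⟩ := by
      rw [Functor.mapIso_trans]; exact f.F.map_comp _ _
    refine (congrArg₂ (fun x y => x ⊗ₘ D.starMap y) h1 h2).trans ?_
    rw [tensorHom_comp_tensorHom, D.starMap_comp]

/-- The isomorphism `g₂(Δ)`: the composite of
`f₁(B^ev) ⊗ f₁(B^od)^* ⟶ (f₁(A^ev) ⊗ f₁(C^ev)) ⊗ (f₁(A^od) ⊗ f₁(C^od))^*`, given by
`f₂(Δ^ev) ⊗ f₂(Δ^od)^*`, with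
`(f₁(A^ev) ⊗ f₁(C^ev)) ⊗ (f₁(A^od) ⊗ f₁(C^od))^* ≅ (f₁(A^ev) ⊗ f₁(C^ev)) ⊗ (f₁(A^od)^* ⊗ f₁(C^od)^*)`
and with the exchange of the two middle factors. -/
def evOdIso (S : ShortComplex (GrB E)) (h : Conflation S) :
    (evOdF D f).obj ⟨S.X₂⟩ ⟶ (evOdF D f).obj ⟨S.X₁⟩ ⊗ (evOdF D f).obj ⟨S.X₃⟩ :=
  ((f.iso (S.map GrB.ev) ((GrB.isExactFunctor_sumOn _).map_conflation S h)).hom ⊗ₘ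
      D.starMap (f.iso (S.map GrB.od) ((GrB.isExactFunctor_sumOn _).map_conflation S h)).hom) ≫
    (_ ◁ D.starTensor (f.F.obj ⟨GrB.od.obj S.X₁⟩) (f.F.obj ⟨GrB.od.obj S.X₃⟩)) ≫
    (interchange _ _ _ _).hom

/-- The isomorphism from
`g₁(A) ⊗ g₁(TA) = (f₁(A^ev) ⊗ f₁(A^od)^*) ⊗ (f₁((TA)^ev) ⊗ f₁((TA)^od)^*)` to
`(f₁(A^ev) ⊗ f₁(A^ev)^*) ⊗ (f₁(A^od) ⊗ f₁(A^od)^*)` given by the identifications `(TA)^ev = A^od` and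
`(TA)^od = A^ev`, by permuting the factors, and by the action of `ε(f₁(A^od))`. -/
def evOdTwist (A : GrB E) :
    (evOdF D f).obj ⟨A⟩ ⊗ (evOdF D f).obj ⟨GrB.T.functor.obj A⟩ ⟶
      (f.F.obj ⟨GrB.ev.obj A⟩ ⊗ D.star (f.F.obj ⟨GrB.ev.obj A⟩)) ⊗
        (f.F.obj ⟨GrB.od.obj A⟩ ⊗ D.star (f.F.obj ⟨GrB.od.obj A⟩)) :=
  (_ ◁ (f.F.map ⟨GrB.evShift A⟩ ⊗ₘ D.starMap (f.F.map ⟨GrB.odShift A⟩))) ≫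
    (_ ◁ (β_ (f.F.obj ⟨GrB.od.obj A⟩) (D.star (f.F.obj ⟨GrB.ev.obj A⟩))).hom) ≫
    (interchange (f.F.obj ⟨GrB.ev.obj A⟩) (D.star (f.F.obj ⟨GrB.od.obj A⟩))
      (D.star (f.F.obj ⟨GrB.ev.obj A⟩)) (f.F.obj ⟨GrB.od.obj A⟩)).hom ≫
    (_ ◁ (β_ (D.star (f.F.obj ⟨GrB.od.obj A⟩)) (f.F.obj ⟨GrB.od.obj A⟩)).hom) ≫
    epsilon (f.F.obj ⟨GrB.od.obj A⟩) _

/-- The data `(g₁, g₂, μ)` on `(Gr^b(E), T)` associated to `f = (f₁, f₂)` on `E`. -/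
def evOdData : DetDataT P (GrB.T (E := E)) where
  F := evOdF D f
  iso S h := asIso (evOdIso D f S h)
  μ A := inducedUnit
    (prodUnit (D.unit (f.F.obj ⟨GrB.ev.obj A⟩)) (D.unit (f.F.obj ⟨GrB.od.obj A⟩)))
    (asIso (evOdTwist D f A))

variable (E) in
/-- The functor that sends `f` to `A ↦ f₁(A^ev) ⊗ f₁(A^od)^*`, and a morphism `t` to
`A ↦ t_{A^ev} ⊗ (t_{A^od})^*`. -/
@[simps] def evOdFunctor : DetFunctor E P ⥤ (Core (GrB E) ⥤ P) where
  obj f := evOdF D f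
  map t :=
    { app := fun A => t.iso.hom.app ⟨GrB.ev.obj A.of⟩ ⊗ₘ D.starMap (t.iso.hom.app ⟨GrB.od.obj A.of⟩)
      naturality := fun A B a => by
        have h1 := t.iso.hom.naturality (X := ⟨GrB.ev.obj A.of⟩) ⟨GrB.ev.mapIso a.iso⟩
        have h2 := t.iso.hom.naturality (X := ⟨GrB.od.obj A.of⟩) ⟨GrB.od.mapIso a.iso⟩
        refine (tensorHom_comp_tensorHom _ _ _ _).trans (Eq.trans ?_
          (tensorHom_comp_tensorHom _ _ _ _).symm)
        rw [← D.starMap_comp, ← D.starMap_comp]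
        exact congrArg₂ (fun x y => x ⊗ₘ D.starMap y) h1 h2 }
  map_id f := NatTrans.ext (funext fun A =>
    (congrArg (fun x => _ ⊗ₘ x) (D.starMap_id _)).trans (id_tensorHom_id _ _))
  map_comp s t := NatTrans.ext (funext fun A =>
    (congrArg (fun x => _ ⊗ₘ x) (D.starMap_comp _ _)).trans
      (tensorHom_comp_tensorHom _ _ _ _).symm)

end Inverse

end Det

end DetFunctors

end

/-!
The functor `W` is fully faithful, and the formula for `R` defines a functor with `R ⋙ W ≅ 𝟭`, so
that `W` is also essentially surjective. The isomorphism `W ⋙ R ≅ 𝟭` is then formal.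

*Units.* In a Picard category every unit structure `δ` on `U` comes from a unique isomorphism
`toUnit δ : U ⟶ 𝟙_ P`, and `α` is a morphism of units if and only if it commutes with these
(`isUnitHom_iff`). So all statements about unit structures are identities between maps to `𝟙_ P`; a
right inverse `X^*` is described by a pairing `X ⊗ X^* ⟶ 𝟙_ P`, and maps into `X^*` are determined
by their pairings (`eq_of_pairing`).

*Full faithfulness.* The unit structures `μ_A` make a morphism on `TA` the dual of the morphism on
`A`. Hence a morphism between the restrictions to degree `0` determines, by duality in both
directions, a morphism on the objects concentrated in degree `k` for every `k`
(`HomOn.exists_isDual_left`, `HomOn.exists_isDual_right`). Naturality and compatibility with short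
exact sequences are inherited, because either factor of a tensor product of isomorphisms can be
cancelled. A graded object is an iterated split extension of objects concentrated in one degree, so
there is at most one common extension of these morphisms to all graded objects (`HomOn.app_eq`). It
exists since it can be defined by means of the split sequences of truncations: it is compatible with
short exact sequences by the `3 × 3` lemma for direct sums of short exact sequences
(`DetFunctor.iso_sum`), which follows from the associativity and commutativity axioms. That it is
compatible with `μ` is checked by dévissage (`IsUnitHom.of_conflation`).

*The functor `R`.* `A ↦ f₁(A^ev) ⊗ f₁(A^od)^*` is the product of a determinant functor and of the
inverse of one; products and inverses of determinant functors are determinant functors by the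
coherence of the exchange map `tensorμ` (`DetFunctor.tensor`, `DetFunctor.dual`). Under `toUnit` the
unit structure `μ_A` becomes the pairing `RightInverses.twist`; it is multiplicative
(`RightInverses.split_twist`), because a permutation of tensor factors is a monoidal transformation
(`tensorμ_tensorμ`) and `ε(X ⊗ Y) = ε(X) ε(Y)` (`eps_tensor`). On objects `X` in degree `0`, the odd
part is a zero object `Z`, so that `f₁(Z)^*` is canonically isomorphic to `𝟙_ P`; this gives
`f₁(X^ev) ⊗ f₁(X^od)^* ≅ f₁(X)` and hence `R ⋙ W ≅ 𝟭` (`counitIso`).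
-/

noncomputable section

namespace DetFunctors

/-! ### Coherence in symmetric monoidal categories -/

section Coherence

variable {P : Type w} [Category.{v₁} P] [MonoidalCategory P] [SymmetricCategory P]

/-- The tensor product `P × P ⥤ P` is a braided functor. -/
theorem tensorμ_comp_braiding (X₁ X₂ Y₁ Y₂ : P) :
    tensorμ X₁ X₂ Y₁ Y₂ ≫ ((β_ X₁ Y₁).hom ⊗ₘ (β_ X₂ Y₂).hom) =
      (β_ (X₁ ⊗ X₂) (Y₁ ⊗ Y₂)).hom ≫ tensorμ Y₁ Y₂ X₁ X₂ := by
  simp [tensorμ, SymmetricCategory.braiding_swap_eq_inv_braiding Y₁ X₂,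
    SymmetricCategory.braiding_swap_eq_inv_braiding X₁ Y₂, MonoidalCategory.tensorHom_def]

/-- The braiding is a monoidal natural transformation. -/
theorem braiding_comp_tensorμ (X₁ X₂ Y₁ Y₂ : P) :
    ((β_ X₁ X₂).hom ⊗ₘ (β_ Y₁ Y₂).hom) ≫ tensorμ X₂ X₁ Y₂ Y₁ =
      tensorμ X₁ X₂ Y₁ Y₂ ≫ (β_ (X₁ ⊗ Y₁) (X₂ ⊗ Y₂)).hom := by
  simp [tensorμ, SymmetricCategory.braiding_swap_eq_inv_braiding Y₁ X₂,
    MonoidalCategory.tensorHom_def]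

/-- The componentwise braiding on `P × P`. -/
abbrev prodBraided (P : Type w) [Category.{v₁} P] [MonoidalCategory P] [SymmetricCategory P] :
    BraidedCategory (P × P) where
  braiding X Y := Iso.prod (β_ X.1 Y.1) (β_ X.2 Y.2)
  braiding_naturality_right X Y Z f := by ext <;> simp
  braiding_naturality_left f Z := by ext <;> simp
  hexagon_forward X Y Z := by ext <;> simp
  hexagon_reverse X Y Z := by ext <;> simp

/-- The exchange of the middle factors is compatible with itself: this is the compatibility of the
braided functor `P × P ⥤ P` with the exchange maps of `P × P` and of `P`. -/
theorem tensorμ_tensorμ (W₁ W₂ X₁ X₂ Y₁ Y₂ Z₁ Z₂ : P) :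
    tensorμ (W₁ ⊗ W₂) (X₁ ⊗ X₂) (Y₁ ⊗ Y₂) (Z₁ ⊗ Z₂) ≫
        (tensorμ W₁ W₂ Y₁ Y₂ ⊗ₘ tensorμ X₁ X₂ Z₁ Z₂) ≫
        tensorμ (W₁ ⊗ Y₁) (W₂ ⊗ Y₂) (X₁ ⊗ Z₁) (X₂ ⊗ Z₂) =
      (tensorμ W₁ W₂ X₁ X₂ ⊗ₘ tensorμ Y₁ Y₂ Z₁ Z₂) ≫
        tensorμ (W₁ ⊗ X₁) (W₂ ⊗ X₂) (Y₁ ⊗ Z₁) (Y₂ ⊗ Z₂) ≫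
        (tensorμ W₁ X₁ Y₁ Z₁ ⊗ₘ tensorμ W₂ X₂ Y₂ Z₂) := by
  let _ := prodBraided P
  let _ : (tensor P).LaxBraided :=
    { braided := fun X Y => tensorμ_comp_braiding X.1 X.2 Y.1 Y.2 }
  exact tensorμ_comp_μ_tensorHom_μ_comp_μ (tensor P) (W₁, W₂) (X₁, X₂) (Y₁, Y₂) (Z₁, Z₂)

theorem tensorμ_unit : tensorμ (𝟙_ P) (𝟙_ P) (𝟙_ P) (𝟙_ P) ≫ ((λ_ (𝟙_ P)).hom ⊗ₘ (λ_ (𝟙_ P)).hom) =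
    ((λ_ (𝟙_ P)).hom ⊗ₘ (λ_ (𝟙_ P)).hom) := by
  have h : (λ_ (𝟙_ P ⊗ 𝟙_ P)).hom = 𝟙_ P ◁ (λ_ (𝟙_ P)).hom := by
    rw [← cancel_mono (λ_ (𝟙_ P)).hom, leftUnitor_naturality]
  have h' := tensor_left_unitality (𝟙_ P) (𝟙_ P)
  rw [← cancel_epi ((λ_ (𝟙_ P)).inv ▷ (𝟙_ P ⊗ 𝟙_ P)), ← h', h, MonoidalCategory.tensorHom_def,
    inv_hom_whiskerRight_assoc]

theorem associator_inv_monoidal (X₁ X₂ X₃ Y₁ Y₂ Y₃ : P) :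
    ((α_ X₁ X₂ X₃).inv ⊗ₘ (α_ Y₁ Y₂ Y₃).inv) ≫ tensorμ (X₁ ⊗ X₂) X₃ (Y₁ ⊗ Y₂) Y₃ ≫
        (tensorμ X₁ X₂ Y₁ Y₂ ▷ (X₃ ⊗ Y₃)) =
      tensorμ X₁ (X₂ ⊗ X₃) Y₁ (Y₂ ⊗ Y₃) ≫ ((X₁ ⊗ Y₁) ◁ tensorμ X₂ X₃ Y₂ Y₃) ≫
        (α_ (X₁ ⊗ Y₁) (X₂ ⊗ Y₂) (X₃ ⊗ Y₃)).inv := by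
  rw [← cancel_mono (α_ _ _ _).hom, ← cancel_epi ((α_ X₁ X₂ X₃).hom ⊗ₘ (α_ Y₁ Y₂ Y₃).hom)]
  simpa using associator_monoidal X₁ X₂ X₃ Y₁ Y₂ Y₃

theorem associator_tensorμ (A B C D : P) :
    (α_ (A ⊗ B) C D).hom ≫ tensorμ A B C D =
      ((α_ A B C).hom ≫ A ◁ (β_ B C).hom ≫ (α_ A C B).inv) ▷ D ≫ (α_ (A ⊗ C) B D).hom := by
  simp only [tensorμ]
  monoidal

/-- Tensor products of maps that satisfy the associativity axiom of determinant functors satisfy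
it, too. -/
theorem tensor_associativity_of_associativity {X₁ X₂ A₁ A₂ B₁ B₂ C₁ C₂ U₁ U₂ V₁ V₂ : P}
    {u₁ : X₁ ⟶ A₁ ⊗ U₁} {v₁ : U₁ ⟶ B₁ ⊗ C₁} {s₁ : X₁ ⟶ V₁ ⊗ C₁} {t₁ : V₁ ⟶ A₁ ⊗ B₁}
    {u₂ : X₂ ⟶ A₂ ⊗ U₂} {v₂ : U₂ ⟶ B₂ ⊗ C₂} {s₂ : X₂ ⟶ V₂ ⊗ C₂} {t₂ : V₂ ⟶ A₂ ⊗ B₂}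
    (h₁ : u₁ ≫ A₁ ◁ v₁ ≫ (α_ A₁ B₁ C₁).inv = s₁ ≫ t₁ ▷ C₁)
    (h₂ : u₂ ≫ A₂ ◁ v₂ ≫ (α_ A₂ B₂ C₂).inv = s₂ ≫ t₂ ▷ C₂) :
    ((u₁ ⊗ₘ u₂) ≫ tensorμ A₁ U₁ A₂ U₂) ≫ (A₁ ⊗ A₂) ◁ ((v₁ ⊗ₘ v₂) ≫ tensorμ B₁ C₁ B₂ C₂) ≫
        (α_ (A₁ ⊗ A₂) (B₁ ⊗ B₂) (C₁ ⊗ C₂)).inv =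
      ((s₁ ⊗ₘ s₂) ≫ tensorμ V₁ C₁ V₂ C₂) ≫ ((t₁ ⊗ₘ t₂) ≫ tensorμ A₁ B₁ A₂ B₂) ▷ (C₁ ⊗ C₂) := by
  have e₁ := tensorμ_natural (𝟙 A₁) v₁ (𝟙 A₂) v₂
  have e₂ := tensorμ_natural t₁ (𝟙 C₁) t₂ (𝟙 C₂)
  simp only [id_tensorHom, tensorHom_id, id_whiskerRight] at e₁ e₂
  rw [MonoidalCategory.whiskerLeft_comp_assoc, Category.assoc, ← reassoc_of% e₁,
    ← associator_inv_monoidal, tensorHom_comp_tensorHom_assoc, tensorHom_comp_tensorHom_assoc,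
    Category.assoc, Category.assoc, h₁, h₂, comp_whiskerRight, Category.assoc, ← reassoc_of% e₂,
    tensorHom_comp_tensorHom_assoc]

end Coherence

/-! ### Picard categories -/

section Picard

variable {P : Type w} [Category.{v₁} P] [MonoidalCategory P] [SymmetricCategory P]

/-- The action of an automorphism of the unit object on an object `V`. -/
def scalar (s : 𝟙_ P ⟶ 𝟙_ P) (V : P) : V ⟶ V := (ρ_ V).inv ≫ V ◁ s ≫ (ρ_ V).hom

theorem scalar_naturality (s : 𝟙_ P ⟶ 𝟙_ P) {V V' : P} (f : V ⟶ V') :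
    f ≫ scalar s V' = scalar s V ≫ f := by
  simp only [scalar, Category.assoc, ← rightUnitor_naturality]
  rw [whisker_exchange_assoc, rightUnitor_inv_naturality_assoc]

theorem scalar_comp (s t : 𝟙_ P ⟶ 𝟙_ P) (V : P) : scalar s V ≫ scalar t V = scalar (s ≫ t) V := by
  simp [scalar]

theorem scalar_unit (s : 𝟙_ P ⟶ 𝟙_ P) : scalar s (𝟙_ P) = s := by
  simp [scalar, ← unitors_equal, ← unitors_inv_equal]

theorem whiskerLeft_scalar (s : 𝟙_ P ⟶ 𝟙_ P) (U V : P) : U ◁ scalar s V = scalar s (U ⊗ V) := by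
  simp [scalar]

theorem scalar_whiskerRight (s : 𝟙_ P ⟶ 𝟙_ P) (U V : P) : scalar s U ▷ V = scalar s (U ⊗ V) := by
  rw [← cancel_mono (β_ U V).hom, BraidedCategory.braiding_naturality_left,
    whiskerLeft_scalar, scalar_naturality]

theorem scalar_tensor (s t : 𝟙_ P ⟶ 𝟙_ P) (U V : P) :
    scalar s U ⊗ₘ scalar t V = scalar (s ≫ t) (U ⊗ V) := by
  rw [MonoidalCategory.tensorHom_def, scalar_whiskerRight, whiskerLeft_scalar, scalar_comp]

variable [PicardCategory P]

theorem whiskerLeft_injective (X : P) {Y Z : P} {f g : Y ⟶ Z} (h : X ◁ f = X ◁ g) : f = g :=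
  (tensorLeft X).map_injective h

theorem scalar_injective {s t : 𝟙_ P ⟶ 𝟙_ P} (V : P) (h : scalar s V = scalar t V) : s = t := by
  apply whiskerLeft_injective V
  simpa [scalar] using h

theorem whiskerLeft_transportAut {W : P} (α : W ⟶ W) (V : P) :
    W ◁ transportAut α V = α ▷ V :=
  (tensorLeft W).map_preimage _

/-- Every automorphism is the action of an automorphism of the unit object. -/
theorem eq_scalar {W : P} (α : W ⟶ W) : α = scalar (transportAut α (𝟙_ P)) W := by
  simp [scalar, whiskerLeft_transportAut]

theorem transportAut_eq_scalar {W : P} (α : W ⟶ W) (V : P) :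
    transportAut α V = scalar (transportAut α (𝟙_ P)) V := by
  apply whiskerLeft_injective W
  rw [whiskerLeft_transportAut, whiskerLeft_scalar, ← scalar_whiskerRight, ← eq_scalar]

/-- `ε(X)` as an automorphism of the unit object. -/
abbrev eps (X : P) : 𝟙_ P ⟶ 𝟙_ P := epsilon X (𝟙_ P)

theorem epsilon_eq_scalar (X V : P) : epsilon X V = scalar (eps X) V :=
  transportAut_eq_scalar _ V

theorem braiding_eq_scalar (X : P) : (β_ X X).hom = scalar (eps X) (X ⊗ X) := eq_scalar _

theorem eps_tensor (X Y : P) : eps (X ⊗ Y) = eps X ≫ eps Y := by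
  apply scalar_injective ((X ⊗ Y) ⊗ (X ⊗ Y))
  rw [← braiding_eq_scalar, ← cancel_epi (tensorμ X X Y Y), SymmetricCategory.tensorμ_braid_swap,
    braiding_eq_scalar X, braiding_eq_scalar Y, scalar_tensor, scalar_naturality]

theorem eps_congr {X Y : P} (f : X ⟶ Y) : eps X = eps Y := by
  apply scalar_injective (X ⊗ X)
  rw [← braiding_eq_scalar, ← cancel_mono (f ⊗ₘ f), ← BraidedCategory.braiding_naturality,
    braiding_eq_scalar Y, scalar_naturality]

/-- The morphism of units from `(U, δ)` to the unit object. -/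
def toUnit {U : P} (δ : UnitStr U) : U ⟶ 𝟙_ P := (existsUnique_unitHom_one δ).choose

theorem isUnitHom_toUnit {U : P} (δ : UnitStr U) :
    IsUnitHom δ (λ_ (𝟙_ P)).symm (toUnit δ) := (existsUnique_unitHom_one δ).choose_spec.1

theorem toUnit_eq {U : P} {δ : UnitStr U} {ω : U ⟶ 𝟙_ P}
    (h : IsUnitHom δ (λ_ (𝟙_ P)).symm ω) : toUnit δ = ω :=
  ((existsUnique_unitHom_one δ).choose_spec.2 ω h).symm

theorem isUnitHom_iff {U V : P} (δ : UnitStr U) (δ' : UnitStr V) (α : U ⟶ V) :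
    IsUnitHom δ δ' α ↔ α ≫ toUnit δ' = toUnit δ := by
  constructor
  · exact fun h => (toUnit_eq (h.comp (isUnitHom_toUnit δ'))).symm
  · intro h
    rw [← IsIso.eq_comp_inv] at h
    rw [h]
    exact (isUnitHom_toUnit δ).comp (isUnitHom_toUnit δ').inv

theorem toUnit_prodUnit {U V : P} (δ : UnitStr U) (δ' : UnitStr V) :
    toUnit (prodUnit δ δ') = (toUnit δ ⊗ₘ toUnit δ') ≫ (λ_ (𝟙_ P)).hom := by
  apply toUnit_eq
  have h := isUnitHom_toUnit δ
  have h' := isUnitHom_toUnit δ'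
  simp only [IsUnitHom, Iso.symm_hom] at h h' ⊢
  simp only [prodUnit, Iso.trans_hom, interchange_hom, tensorIso_hom, Category.assoc,
    Iso.hom_inv_id, Category.comp_id]
  rw [← tensorHom_comp_tensorHom, ← tensorμ_natural_assoc, tensorHom_comp_tensorHom_assoc, h, h',
    tensorμ_unit, tensorHom_comp_tensorHom]
  simp

theorem toUnit_inducedUnit {U V : P} (δ : UnitStr V) (e : U ≅ V) :
    toUnit (inducedUnit δ e) = e.hom ≫ toUnit δ :=
  ((isUnitHom_iff _ _ _).1 (by simp [IsUnitHom, inducedUnit])).symm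

theorem hom_comp_toUnit_tensor {U : P} (δ : UnitStr U) :
    δ.hom ≫ (toUnit δ ⊗ₘ toUnit δ) ≫ (λ_ (𝟙_ P)).hom = toUnit δ := by
  have h := isUnitHom_toUnit δ
  rw [IsUnitHom, Iso.symm_hom] at h
  rw [reassoc_of% h, Iso.inv_hom_id, Category.comp_id]

/-- Two morphisms into the second factor of an invertible pairing agree if they pair alike. -/
theorem eq_of_pairing {X X' A B : P} {f g : A ⟶ B} (α : X' ⟶ X) (e : X ⊗ B ⟶ 𝟙_ P)
    (h : (α ⊗ₘ f) ≫ e = (α ⊗ₘ g) ≫ e) : f = g := by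
  rw [cancel_mono, MonoidalCategory.tensorHom_def, MonoidalCategory.tensorHom_def,
    cancel_epi] at h
  exact whiskerLeft_injective X h

namespace RightInverses

variable (D : RightInverses P)

/-- The pairing `X ⊗ X^* ⟶ 1`, the morphism of units from `X ⊗ X^*` to the unit object. -/
def pairing (X : P) : X ⊗ D.star X ⟶ 𝟙_ P := toUnit (D.unit X)

theorem starMap_pairing {X Y : P} (α : X ⟶ Y) :
    (α ⊗ₘ D.starMap α) ≫ D.pairing Y = D.pairing X :=
  (isUnitHom_iff _ _ _).1 (D.starMap_spec α)

/-- The pairing of a tensor product in terms of the pairings of the factors. -/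
theorem starTensor_pairing (X Y : P) :
    (X ⊗ Y) ◁ D.starTensor X Y ≫ tensorμ X Y (D.star X) (D.star Y) ≫
      (D.pairing X ⊗ₘ D.pairing Y) ≫ (λ_ (𝟙_ P)).hom = D.pairing (X ⊗ Y) := by
  have h := (existsUnique_dual (𝟙 (X ⊗ Y)) (D.unit (X ⊗ Y)) (inducedUnit
    (prodUnit (D.unit X) (D.unit Y)) (interchange X Y (D.star X) (D.star Y)))).choose_spec.1
  beta_reduce at h
  rw [isUnitHom_iff, toUnit_inducedUnit, toUnit_prodUnit, id_tensorHom] at h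
  exact h

theorem starTensor_naturality {X X' Y Y' : P} (α : X ⟶ X') (β : Y ⟶ Y') :
    D.starMap (α ⊗ₘ β) ≫ D.starTensor X' Y' =
      D.starTensor X Y ≫ (D.starMap α ⊗ₘ D.starMap β) := by
  apply eq_of_pairing (α ⊗ₘ β) (tensorμ X' Y' (D.star X') (D.star Y') ≫
    (D.pairing X' ⊗ₘ D.pairing Y') ≫ (λ_ (𝟙_ P)).hom)
  trans D.pairing (X ⊗ Y)
  · rw [← D.starMap_pairing (α ⊗ₘ β), ← D.starTensor_pairing X' Y', ← id_tensorHom,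
      tensorHom_comp_tensorHom_assoc, Category.comp_id]
  · rw [← Category.id_comp (α ⊗ₘ β), ← tensorHom_comp_tensorHom_assoc, tensorμ_natural_assoc,
      tensorHom_comp_tensorHom_assoc, D.starMap_pairing, D.starMap_pairing, id_tensorHom,
      D.starTensor_pairing]

theorem starTensor_associativity (X Y Z : P) :
    D.starTensor X (Y ⊗ Z) ≫ D.star X ◁ D.starTensor Y Z ≫
        (α_ (D.star X) (D.star Y) (D.star Z)).inv =
      D.starMap (α_ X Y Z).inv ≫ D.starTensor (X ⊗ Y) Z ≫ D.starTensor X Y ▷ D.star Z := by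
  apply eq_of_pairing (α_ X Y Z).inv (tensorμ (X ⊗ Y) Z (D.star X ⊗ D.star Y) (D.star Z) ≫
    (tensorμ X Y (D.star X) (D.star Y) ▷ (Z ⊗ D.star Z)) ≫
    (((D.pairing X ⊗ₘ D.pairing Y) ≫ (λ_ (𝟙_ P)).hom) ⊗ₘ D.pairing Z) ≫ (λ_ (𝟙_ P)).hom)
  trans D.pairing (X ⊗ Y ⊗ Z)
  · have h2 : (α_ (X ⊗ D.star X) (Y ⊗ D.star Y) (Z ⊗ D.star Z)).inv ≫
        (((D.pairing X ⊗ₘ D.pairing Y) ≫ (λ_ (𝟙_ P)).hom) ⊗ₘ D.pairing Z) ≫ (λ_ (𝟙_ P)).hom =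
        (D.pairing X ⊗ₘ ((D.pairing Y ⊗ₘ D.pairing Z) ≫ (λ_ (𝟙_ P)).hom)) ≫
          (λ_ (𝟙_ P)).hom := by
      have h3 : (α_ (𝟙_ P) (𝟙_ P) (𝟙_ P)).inv ≫ ((λ_ (𝟙_ P)).hom ⊗ₘ 𝟙 (𝟙_ P)) ≫
          (λ_ (𝟙_ P)).hom = (𝟙 (𝟙_ P) ⊗ₘ (λ_ (𝟙_ P)).hom) ≫ (λ_ (𝟙_ P)).hom := by
        monoidal
      rw [← Category.comp_id (D.pairing Z), ← tensorHom_comp_tensorHom_assoc,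
        ← associator_inv_naturality_assoc, h3, tensorHom_comp_tensorHom_assoc, Category.comp_id,
        Category.comp_id]
    rw [← Category.assoc (D.starTensor _ _), ← Category.id_comp (α_ X Y Z).inv,
      ← tensorHom_comp_tensorHom_assoc, reassoc_of% associator_inv_monoidal, h2, id_tensorHom,
      MonoidalCategory.whiskerLeft_comp_assoc, ← id_tensorHom (D.star X),
      tensorμ_natural_right_assoc, MonoidalCategory.whiskerLeft_id, id_tensorHom,
      ← MonoidalCategory.whiskerLeft_comp_assoc, ← id_tensorHom (X ⊗ D.star X),
      tensorHom_comp_tensorHom_assoc,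
      Category.id_comp, Category.assoc, D.starTensor_pairing, D.starTensor_pairing]
  · rw [← D.starMap_pairing (α_ X Y Z).inv, ← D.starTensor_pairing (X ⊗ Y) Z,
      ← Category.comp_id (α_ X Y Z).inv, ← tensorHom_comp_tensorHom_assoc,
      Category.comp_id, id_tensorHom, MonoidalCategory.whiskerLeft_comp_assoc,
      ← tensorHom_id (D.starTensor X Y), tensorμ_natural_right_assoc,
      MonoidalCategory.whiskerLeft_id, tensorHom_id,
      ← comp_whiskerRight_assoc, ← tensorHom_id, tensorHom_comp_tensorHom_assoc,
      Category.id_comp, Category.assoc, D.starTensor_pairing, D.starTensor_pairing X,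
      D.starTensor_pairing]

theorem starTensor_braiding (X Y : P) :
    D.starTensor X Y ≫ (β_ (D.star X) (D.star Y)).hom =
      D.starMap (β_ X Y).hom ≫ D.starTensor Y X := by
  apply eq_of_pairing (β_ X Y).hom (tensorμ Y X (D.star Y) (D.star X) ≫
    (D.pairing Y ⊗ₘ D.pairing X) ≫ (λ_ (𝟙_ P)).hom)
  trans D.pairing (X ⊗ Y)
  · rw [← Category.id_comp (β_ X Y).hom, ← tensorHom_comp_tensorHom_assoc,
      reassoc_of% braiding_comp_tensorμ, ← BraidedCategory.braiding_naturality_assoc, id_tensorHom,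
      braiding_leftUnitor, ← unitors_equal, D.starTensor_pairing]
  · rw [← D.starMap_pairing (β_ X Y).hom, ← D.starTensor_pairing Y X, ← id_tensorHom,
      tensorHom_comp_tensorHom_assoc, Category.comp_id]

end RightInverses
end Picard

/-! ### Direct sums in exact categories -/

section ExactCategories

variable {E : Type u} [Category.{v} E] [Preadditive E] [ExactCategory E]

/-- A split sequence is short exact. -/
theorem conflation_of_split {X B Y : E} (i : X ⟶ B) (j : Y ⟶ B) (p : B ⟶ X) (q : B ⟶ Y)
    (ip : i ≫ p = 𝟙 X) (jq : j ≫ q = 𝟙 Y) (iq : i ≫ q = 0) (jp : j ≫ p = 0)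
    (tot : p ≫ i + q ≫ j = 𝟙 B) : Conflation (ShortComplex.mk i q iq) := by
  refine conflation_of_sum (conflation_id_left X (isZero_zero E))
    (conflation_id_right Y (isZero_zero E))
    { τ₁ := 𝟙 X, τ₂ := i, τ₃ := 0 } { τ₁ := 0, τ₂ := j, τ₃ := 𝟙 Y }
    { τ₁ := 𝟙 X, τ₂ := p, τ₃ := 0 } { τ₁ := 0, τ₂ := q, τ₃ := 𝟙 Y } ?_ ?_ ?_ ?_ ?_
  all_goals ext <;> simp [ip, jq, iq, jp, tot]

end ExactCategories

/-! ### Operations on determinant functors and the `3 × 3` lemma -/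

section Det

variable {E : Type u} [Category.{v} E] [Preadditive E] [ExactCategory E]
variable {P : Type w} [Category.{v₁} P] [MonoidalCategory P] [SymmetricCategory P]

namespace DetFunctor

variable (f : DetFunctor E P)

/-- The `3 × 3` lemma for a direct sum of two short exact sequences. It holds by associativity for
`S₁.X₂ ⊞ S₂.X₁`, as an intermediate object between `S.X₁` and `S.X₂` and between `S₁.X₂` and `S.X₂`,
and commutativity for `S₁.X₃ ⊞ S₂.X₁`. -/
theorem iso_sum {S₁ S₂ S : ShortComplex E} (h₁ : Conflation S₁) (h₂ : Conflation S₂)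
    (h : Conflation S) (i₁ : S₁ ⟶ S) (i₂ : S₂ ⟶ S) (p₁ : S ⟶ S₁) (p₂ : S ⟶ S₂)
    (h11 : i₁ ≫ p₁ = 𝟙 _) (h22 : i₂ ≫ p₂ = 𝟙 _) (h12 : i₁ ≫ p₂ = 0) (h21 : i₂ ≫ p₁ = 0)
    (tot : p₁ ≫ i₁ + p₂ ≫ i₂ = 𝟙 S)
    (w₁ : i₁.τ₁ ≫ p₂.τ₁ = 0) (w₂ : i₁.τ₂ ≫ p₂.τ₂ = 0) (w₃ : i₁.τ₃ ≫ p₂.τ₃ = 0)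
    (c₁ : Conflation (ShortComplex.mk i₁.τ₁ p₂.τ₁ w₁))
    (c₂ : Conflation (ShortComplex.mk i₁.τ₂ p₂.τ₂ w₂))
    (c₃ : Conflation (ShortComplex.mk i₁.τ₃ p₂.τ₃ w₃)) :
    (f.iso S h).hom ≫ ((f.iso _ c₁).hom ⊗ₘ (f.iso _ c₃).hom) =
      (f.iso _ c₂).hom ≫ ((f.iso S₁ h₁).hom ⊗ₘ (f.iso S₂ h₂).hom) ≫ tensorμ _ _ _ _ := by
  have t1 := congrArg ShortComplex.Hom.τ₁ tot
  have t2 := congrArg ShortComplex.Hom.τ₂ tot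
  have t3 := congrArg ShortComplex.Hom.τ₃ tot
  have a11 := congrArg ShortComplex.Hom.τ₁ h11
  have a22 := congrArg ShortComplex.Hom.τ₁ h22
  have a21 := congrArg ShortComplex.Hom.τ₁ h21
  have b11 := congrArg ShortComplex.Hom.τ₂ h11
  have b22 := congrArg ShortComplex.Hom.τ₂ h22
  have b21 := congrArg ShortComplex.Hom.τ₂ h21
  simp only [ShortComplex.add_τ₁, ShortComplex.add_τ₂, ShortComplex.add_τ₃, ShortComplex.comp_τ₁,
    ShortComplex.comp_τ₂, ShortComplex.comp_τ₃, ShortComplex.id_τ₁, ShortComplex.id_τ₂,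
    ShortComplex.id_τ₃, ShortComplex.zero_τ₁, ShortComplex.zero_τ₂] at *
  let m : S₁.X₂ ⊞ S₂.X₁ ⟶ S.X₂ := biprod.desc i₁.τ₂ (S₂.f ≫ i₂.τ₂)
  let u : S.X₁ ⟶ S₁.X₂ ⊞ S₂.X₁ := biprod.lift (p₁.τ₁ ≫ S₁.f) p₂.τ₁
  have hum : u ≫ m = S.f := by
    have : S.f = (p₁.τ₁ ≫ i₁.τ₁ + p₂.τ₁ ≫ i₂.τ₁) ≫ S.f := by rw [t1, Category.id_comp]
    rw [this]
    simp [u, m, i₁.comm₁₂, i₂.comm₁₂]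
  have hu : i₁.τ₁ ≫ u = S₁.f ≫ biprod.inl := by
    apply biprod.hom_ext
    · simp [u, reassoc_of% a11]
    · simp [u, w₁]
  have wa : m ≫ p₂.τ₂ ≫ S₂.g = 0 := by
    apply biprod.hom_ext'
    · simp [m, reassoc_of% w₂]
    · simp [m, reassoc_of% b22]
  have wc : u ≫ biprod.fst ≫ S₁.g = 0 := by simp [u]
  have wd : (S₁.f ≫ biprod.inl) ≫ biprod.map S₁.g (𝟙 S₂.X₁) = 0 := by simp
  have ca : Conflation (ShortComplex.mk m (p₂.τ₂ ≫ S₂.g) wa) := by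
    refine conflation_of_sum (conflation_id_left S₁.X₂ (isZero_zero E)) h₂
      { τ₁ := biprod.inl, τ₂ := i₁.τ₂, τ₃ := 0, comm₁₂ := ?_, comm₂₃ := ?_ }
      { τ₁ := biprod.inr, τ₂ := i₂.τ₂, τ₃ := 𝟙 _, comm₁₂ := ?_, comm₂₃ := ?_ }
      { τ₁ := biprod.fst, τ₂ := p₁.τ₂, τ₃ := 0, comm₁₂ := ?_, comm₂₃ := ?_ }
      { τ₁ := biprod.snd, τ₂ := p₂.τ₂, τ₃ := 𝟙 _, comm₁₂ := ?_, comm₂₃ := ?_ } ?_ ?_ ?_ ?_ ?_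
    all_goals try apply ShortComplex.hom_ext
    all_goals try apply biprod.hom_ext'
    all_goals simp [m, b11, b22, w₂, b21, t2, reassoc_of% w₂, reassoc_of% b22]
  have cb : Conflation
      (ShortComplex.mk (biprod.inl : S₁.X₂ ⟶ S₁.X₂ ⊞ S₂.X₁) biprod.snd (by simp)) :=
    conflation_of_split _ biprod.inr biprod.fst _ (by simp) (by simp) _ (by simp) (by simp)
  have cc : Conflation (ShortComplex.mk u (biprod.fst ≫ S₁.g) wc) := by
    refine conflation_of_sum h₁ (conflation_id_left S₂.X₁ (isZero_zero E))
      { τ₁ := i₁.τ₁, τ₂ := biprod.inl, τ₃ := 𝟙 _, comm₁₂ := ?_, comm₂₃ := ?_ }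
      { τ₁ := i₂.τ₁, τ₂ := biprod.inr, τ₃ := 0, comm₁₂ := ?_, comm₂₃ := ?_ }
      { τ₁ := p₁.τ₁, τ₂ := biprod.fst, τ₃ := 𝟙 _, comm₁₂ := ?_, comm₂₃ := ?_ }
      { τ₁ := p₂.τ₁, τ₂ := biprod.snd, τ₃ := 0, comm₁₂ := ?_, comm₂₃ := ?_ } ?_ ?_ ?_ ?_ ?_
    all_goals try apply ShortComplex.hom_ext
    all_goals try apply biprod.hom_ext
    all_goals simp [u, a11, a22, w₁, a21, t1, reassoc_of% a11, reassoc_of% a21]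
  have cd : Conflation (ShortComplex.mk (S₁.f ≫ biprod.inl) (biprod.map S₁.g (𝟙 S₂.X₁)) wd) := by
    refine conflation_of_sum h₁ (conflation_id_right S₂.X₁ (isZero_zero E))
      { τ₁ := 𝟙 _, τ₂ := biprod.inl, τ₃ := biprod.inl, comm₁₂ := ?_, comm₂₃ := ?_ }
      { τ₁ := 0, τ₂ := biprod.inr, τ₃ := biprod.inr, comm₁₂ := ?_, comm₂₃ := ?_ }
      { τ₁ := 𝟙 _, τ₂ := biprod.fst, τ₃ := biprod.fst, comm₁₂ := ?_, comm₂₃ := ?_ }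
      { τ₁ := 0, τ₂ := biprod.snd, τ₃ := biprod.snd, comm₁₂ := ?_, comm₂₃ := ?_ } ?_ ?_ ?_ ?_ ?_
    all_goals try apply ShortComplex.hom_ext
    all_goals simp
  have ce : Conflation
      (ShortComplex.mk (biprod.inl : S₁.X₃ ⟶ S₁.X₃ ⊞ S₂.X₁) biprod.snd (by simp)) :=
    conflation_of_split _ biprod.inr biprod.fst _ (by simp) (by simp) _ (by simp) (by simp)
  have ce' : Conflation
      (ShortComplex.mk (biprod.inr : S₂.X₁ ⟶ S₁.X₃ ⊞ S₂.X₁) biprod.fst (by simp)) :=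
    conflation_of_split _ biprod.inl biprod.snd _ (by simp) (by simp) _ (by simp)
      (by rw [add_comm]; simp)
  -- Each `Aᵢ` with `i ≤ 4` is associativity for a chain of two inflations: these are
  -- `S₁.X₂ ⟶ S₁.X₂ ⊞ S₂.X₁ ⟶ S.X₂` and `S.X₁ ⟶ S₁.X₂ ⊞ S₂.X₁ ⟶ S.X₂` for `A1` and `A2`, and
  -- `S₁.X₁ ⟶ S₁.X₂ ⟶ S₁.X₂ ⊞ S₂.X₁` and `S₁.X₁ ⟶ S.X₁ ⟶ S₁.X₂ ⊞ S₂.X₁` for `A3` and `A4`.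
  have A1 := f.associativity biprod.inl biprod.snd i₁.τ₂ p₂.τ₂ m (p₂.τ₂ ≫ S₂.g) S₂.f S₂.g
    _ _ _ _ cb c₂ ca h₂ (by simp [m]) (by apply biprod.hom_ext' <;> simp [m, w₂, b22]) rfl
  have A2 := f.associativity u (biprod.fst ≫ S₁.g) S.f S.g m (p₂.τ₂ ≫ S₂.g) i₁.τ₃ p₂.τ₃
    _ _ _ _ cc h ca c₃ hum (by
      apply biprod.hom_ext'
      · simp [m, i₁.comm₂₃]
      · simp [m, i₂.comm₂₃]) p₂.comm₂₃.symm
  have A3 := f.associativity S₁.f S₁.g (S₁.f ≫ biprod.inl) (biprod.map S₁.g (𝟙 S₂.X₁)) biprod.inl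
    biprod.snd biprod.inl biprod.snd _ _ _ _ h₁ cd cb ce rfl (by simp) (by simp)
  have A4 := f.associativity i₁.τ₁ p₂.τ₁ (S₁.f ≫ biprod.inl) (biprod.map S₁.g (𝟙 S₂.X₁)) u
    (biprod.fst ≫ S₁.g) biprod.inr biprod.fst _ _ _ _ c₁ cd cc ce' hu
    (by apply biprod.hom_ext <;> simp [u]) (by simp)
  have A5 := f.commutativity (BinaryBiproduct.bicone S₁.X₃ S₂.X₁)
    ⟨BinaryBiproduct.isBilimit S₁.X₃ S₂.X₁⟩ ce ce'
  calc
    _ = ((f.iso _ h).hom ≫ _ ◁ (f.iso _ c₃).hom ≫ (α_ _ _ _).inv) ≫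
        ((f.iso _ c₁).hom ▷ _) ▷ _ ≫ (α_ _ _ _).hom := by
      simp [MonoidalCategory.tensorHom_def']
    _ = (f.iso _ ca).hom ≫ ((f.iso _ cc).hom ≫ (f.iso _ c₁).hom ▷ _) ▷ _ ≫ (α_ _ _ _).hom := by
      rw [A2]; simp
    _ = (f.iso _ ca).hom ≫ ((f.iso _ cd).hom ≫ _ ◁ (f.iso _ ce).hom ≫ (α_ _ _ _).inv) ▷ _ ≫
        ((α_ _ _ _).hom ≫ _ ◁ (β_ _ _).hom ≫ (α_ _ _ _).inv) ▷ _ ≫ (α_ _ _ _).hom := by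
      rw [← A4, ← A5]; simp
    _ = ((f.iso _ ca).hom ≫ (f.iso _ cb).hom ▷ _) ≫ ((f.iso _ h₁).hom ▷ _) ▷ _ ≫
        (α_ _ _ _).hom ≫ tensorμ _ _ _ _ := by
      rw [A3, associator_tensorμ]; simp
    _ = _ := by
      rw [← A1]; simp [MonoidalCategory.tensorHom_def']

section Zero

variable [PicardCategory P]

theorem conflation_zero {Z : E} (hZ : IsZero Z) :
    Conflation (ShortComplex.mk (0 : Z ⟶ Z) (0 : Z ⟶ Z) zero_comp) :=
  conflation_of_isZero _ hZ hZ hZ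

/-- The unit structure on `f₁(Z)` for a zero object `Z`. -/
def zeroUnit {Z : E} (hZ : IsZero Z) : UnitStr (f.F.obj ⟨Z⟩) := f.iso _ (conflation_zero hZ)

theorem map_toUnit_zeroUnit {Z Z' : E} (hZ : IsZero Z) (hZ' : IsZero Z') (a : Z ≅ Z') :
    f.F.map ⟨a⟩ ≫ toUnit (f.zeroUnit hZ') = toUnit (f.zeroUnit hZ) := by
  rw [← isUnitHom_iff]
  exact (f.naturality _ _ (conflation_zero hZ) (conflation_zero hZ') a a a (by simp)
    (by simp)).symm

theorem iso_toUnit_zeroUnit (S : ShortComplex E) (h : Conflation S) (h₁ : IsZero S.X₁)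
    (h₂ : IsZero S.X₂) (h₃ : IsZero S.X₃) :
    (f.iso S h).hom ≫ (toUnit (f.zeroUnit h₁) ⊗ₘ toUnit (f.zeroUnit h₃)) ≫ (λ_ (𝟙_ P)).hom =
      toUnit (f.zeroUnit h₂) := by
  have e := f.naturality _ _ h (conflation_zero h₂) (h₁.iso h₂) (Iso.refl _) (h₃.iso h₂)
    (h₁.eq_of_src _ _) (h₂.eq_of_src _ _)
  rw [← f.map_toUnit_zeroUnit h₁ h₂ (h₁.iso h₂), ← f.map_toUnit_zeroUnit h₃ h₂ (h₃.iso h₂),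
    ← tensorHom_comp_tensorHom_assoc, ← reassoc_of% e]
  exact (congrArg (_ ≫ ·) (hom_comp_toUnit_tensor (f.zeroUnit h₂))).trans
    (f.map_toUnit_zeroUnit h₂ h₂ (Iso.refl _))

end Zero

/-- The determinant functor `f` with its data replaced by equal data `d`, so that `d` is the
underlying data by definition. -/
def copy (d : DetData E P) (h : d = f.toDetData) : DetFunctor E P where
  toDetData := d
  naturality := h ▸ f.naturality
  associativity := h ▸ f.associativity
  commutativity := h ▸ f.commutativity

/-- The product of two determinant functors. -/
def tensor (f f' : DetFunctor E P) : DetFunctor E P where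
  F :=
    { obj := fun A => f.F.obj A ⊗ f'.F.obj A
      map := fun a => f.F.map a ⊗ₘ f'.F.map a
      map_id := fun A => by simp
      map_comp := fun a b => by simp }
  iso S h := (f.iso S h ⊗ᵢ f'.iso S h) ≪≫ interchange _ _ _ _
  naturality S S' h h' a b c e₁ e₂ := by
    simp only [Iso.trans_hom, tensorIso_hom, interchange_hom, Category.assoc]
    rw [← tensorμ_natural, tensorHom_comp_tensorHom_assoc, tensorHom_comp_tensorHom_assoc,
      f.naturality S S' h h' a b c e₁ e₂, f'.naturality S S' h h' a b c e₁ e₂]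
  associativity f₁ g k l m n p q w₁ w₂ w₃ w₄ h₁ h₂ v₁ v₂ e₁ e₂ e₃ := by
    exact tensor_associativity_of_associativity
      (f.associativity f₁ g k l m n p q w₁ w₂ w₃ w₄ h₁ h₂ v₁ v₂ e₁ e₂ e₃)
      (f'.associativity f₁ g k l m n p q w₁ w₂ w₃ w₄ h₁ h₂ v₁ v₂ e₁ e₂ e₃)
  commutativity b hb h₁ h₂ := by
    simp only [Iso.trans_hom, tensorIso_hom, interchange_hom, Category.assoc]
    rw [← braiding_comp_tensorμ, tensorHom_comp_tensorHom_assoc, f.commutativity b hb h₁ h₂,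
      f'.commutativity b hb h₁ h₂]

/-- The inverse of a determinant functor. -/
def dual [PicardCategory P] (D : RightInverses P) (f : DetFunctor E P) : DetFunctor E P where
  F :=
    { obj := fun A => D.star (f.F.obj A)
      map := fun a => D.starMap (f.F.map a)
      map_id := fun A => by rw [f.F.map_id, D.starMap_id]
      map_comp := fun a b => by rw [f.F.map_comp, D.starMap_comp] }
  iso S h := asIso (D.starMap (f.iso S h).hom ≫ D.starTensor _ _)
  naturality S S' h h' a b c e₁ e₂ := by
    simp only [asIso_hom, Category.assoc]
    rw [← D.starTensor_naturality, ← Category.assoc, ← Category.assoc, ← D.starMap_comp,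
      ← D.starMap_comp, f.naturality S S' h h' a b c e₁ e₂]
  associativity {A B C A' B' C'} f₁ g k l m n p q w₁ w₂ w₃ w₄ h₁ h₂ v₁ v₂ e₁ e₂ e₃ := by
    have h := f.associativity f₁ g k l m n p q w₁ w₂ w₃ w₄ h₁ h₂ v₁ v₂ e₁ e₂ e₃
    simp only [asIso_hom, Category.assoc]
    have e₁ := D.starTensor_naturality (𝟙 (f.F.obj ⟨A⟩)) (f.iso _ v₂).hom
    have e₂ := D.starTensor_naturality (f.iso _ h₁).hom (𝟙 (f.F.obj ⟨A'⟩))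
    simp only [id_tensorHom, tensorHom_id, D.starMap_id] at e₁ e₂
    rw [MonoidalCategory.whiskerLeft_comp_assoc, comp_whiskerRight, ← reassoc_of% e₁,
      ← reassoc_of% e₂, D.starTensor_associativity]
    have h' := congrArg D.starMap h
    simp only [D.starMap_comp] at h'
    rw [reassoc_of% h']
  commutativity b hb h₁ h₂ := by
    simp only [asIso_hom, Category.assoc]
    rw [D.starTensor_braiding, ← f.commutativity b hb h₁ h₂, D.starMap_comp, Category.assoc]

end DetFunctor
end Det

/-! ### Truncations of graded objects -/

namespace GrB

variable {E : Type u} [Category.{v} E] [Preadditive E] [ExactCategory E]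

/-- All components of `A` with degree outside `K` are zero objects. -/
def SuppIn (K : Set ℤ) (A : GrB E) : Prop := ∀ j, j ∉ K → IsZero (A.obj j)

theorem SuppIn.mono {K K' : Set ℤ} {A : GrB E} (h : SuppIn K A) (hK : K ⊆ K') : SuppIn K' A :=
  fun j hj => h j fun hj' => hj (hK hj')

theorem SuppIn.isZero {A : GrB E} {K K' : Set ℤ} (h : SuppIn K A) (h' : SuppIn K' A)
    (hK : Disjoint K K') : IsZero A :=
  isZero_of_forall fun j => by
    by_cases hj : j ∈ K
    · exact h' j (Set.disjoint_left.1 hK hj)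
    · exact h j hj

theorem SuppIn.left {K : Set ℤ} {S : ShortComplex (GrB E)} (h : SuppIn K S.X₂)
    (hS : Conflation S) : SuppIn K S.X₁ :=
  fun j hj => isZero_left_of_conflation (hS j) (h j hj)

theorem SuppIn.right {K : Set ℤ} {S : ShortComplex (GrB E)} (h : SuppIn K S.X₂)
    (hS : Conflation S) : SuppIn K S.X₃ :=
  fun j hj => isZero_right_of_conflation (hS j) (h j hj)

section PropBiproduct

variable (p : Prop) {X Y : E} (f : X ⟶ Y)

theorem map_desc_of_prop :
    biproduct.map (fun _ : PLift p => f) ≫ biproduct.desc (fun _ => 𝟙 Y) =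
      biproduct.desc (fun _ => 𝟙 X) ≫ f := by
  apply biproduct.hom_ext'
  intro h
  simp

theorem lift_map_of_prop :
    f ≫ biproduct.lift (fun _ : PLift p => 𝟙 Y) =
      biproduct.lift (fun _ => 𝟙 X) ≫ biproduct.map (fun _ => f) := by
  apply biproduct.hom_ext
  intro h
  simp

theorem desc_lift_of_prop (X : E) :
    biproduct.desc (fun _ : PLift p => 𝟙 X) ≫ biproduct.lift (fun _ => 𝟙 X) = 𝟙 _ := by
  apply biproduct.hom_ext'
  intro h
  apply biproduct.hom_ext
  intro h'
  obtain rfl : h = h' := Subsingleton.elim _ _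
  simp

theorem lift_desc_of_prop (hp : p) (X : E) :
    biproduct.lift (fun _ : PLift p => 𝟙 X) ≫ biproduct.desc (fun _ => 𝟙 X) = 𝟙 X := by
  have : Unique (PLift p) := ⟨⟨⟨hp⟩⟩, fun _ => rfl⟩
  rw [biproduct.lift_desc]
  simp

theorem map_add_of_prop (f g : X ⟶ Y) :
    biproduct.map (fun _ : PLift p => f + g) =
      biproduct.map (fun _ => f) + biproduct.map (fun _ => g) := by
  apply biproduct.hom_ext
  intro h
  simp

end PropBiproduct

/-- The functor that replaces the components with degree outside `K` by zero objects. The direct sum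
over the proofs of `j ∈ K` is `A.obj j` or a zero object, according as `j ∈ K` or not. -/
@[simps] def trunc (K : Set ℤ) : GrB E ⥤ GrB E where
  obj A := ⟨fun j => ⨁ fun _ : PLift (j ∈ K) => A.obj j, A.bounded.subset fun j hj hA =>
    hj (isZero_biproduct fun _ => hA)⟩
  map f := ⟨fun j => biproduct.map fun _ : PLift (j ∈ K) => f.app j⟩

theorem suppIn_trunc (K : Set ℤ) (A : GrB E) : SuppIn K ((trunc K).obj A) :=
  fun _ hj => isZero_biproduct fun h => absurd h.down hj

theorem SuppIn.trunc {K : Set ℤ} {A : GrB E} (h : SuppIn K A) (L : Set ℤ) :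
    SuppIn K ((trunc L).obj A) :=
  fun j hj => isZero_biproduct fun _ => h j hj

/-- The inclusion of the truncation. -/
@[simps] def truncι (K : Set ℤ) (A : GrB E) : (trunc K).obj A ⟶ A :=
  ⟨fun j => biproduct.desc fun _ : PLift (j ∈ K) => 𝟙 (A.obj j)⟩

/-- The projection to the truncation. -/
@[simps] def truncπ (K : Set ℤ) (A : GrB E) : A ⟶ (trunc K).obj A :=
  ⟨fun j => biproduct.lift fun _ : PLift (j ∈ K) => 𝟙 (A.obj j)⟩

theorem truncι_naturality (K : Set ℤ) {A B : GrB E} (f : A ⟶ B) :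
    (trunc K).map f ≫ truncι K B = truncι K A ≫ f := by
  ext j
  exact map_desc_of_prop (j ∈ K) (f.app j)

theorem truncπ_naturality (K : Set ℤ) {A B : GrB E} (f : A ⟶ B) :
    f ≫ truncπ K B = truncπ K A ≫ (trunc K).map f := by
  ext j
  exact lift_map_of_prop (j ∈ K) (f.app j)

theorem truncι_truncπ (K : Set ℤ) (A : GrB E) : truncι K A ≫ truncπ K A = 𝟙 _ := by
  ext j
  exact desc_lift_of_prop (j ∈ K) (A.obj j)

theorem truncπ_truncι_app_of_mem {K : Set ℤ} (A : GrB E) {j : ℤ} (hj : j ∈ K) :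
    (truncπ K A).app j ≫ (truncι K A).app j = 𝟙 _ := by
  exact lift_desc_of_prop _ hj _

theorem truncι_truncπ_of_disjoint {K L : Set ℤ} (h : Disjoint K L) (A : GrB E) :
    truncι K A ≫ truncπ L A = 0 := by
  ext j
  by_cases hj : j ∈ K
  · exact (suppIn_trunc L A j (Set.disjoint_left.1 h hj)).eq_of_tgt _ _
  · exact (suppIn_trunc K A j hj).eq_of_src _ _

theorem truncπ_truncι_add {K L : Set ℤ} (h : Disjoint K L) {A : GrB E} (hA : SuppIn (K ∪ L) A) :
    truncπ K A ≫ truncι K A + truncπ L A ≫ truncι L A = 𝟙 A := by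
  ext j
  by_cases hK : j ∈ K
  · have hL : IsZero (((trunc L).obj A).obj j) :=
      suppIn_trunc L A j (Set.disjoint_left.1 h hK)
    rw [add_app, comp_app, comp_app, truncπ_truncι_app_of_mem A hK,
      hL.eq_zero_of_tgt ((truncπ L A).app j), zero_comp, add_zero, id_app]
  · by_cases hL : j ∈ L
    · have hK' : IsZero (((trunc K).obj A).obj j) := suppIn_trunc K A j hK
      rw [add_app, comp_app, comp_app, truncπ_truncι_app_of_mem A hL,
        hK'.eq_zero_of_tgt ((truncπ K A).app j), zero_comp, zero_add, id_app]
    · exact (hA j (by simp [hK, hL])).eq_of_src _ _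

instance (K : Set ℤ) : (trunc (E := E) K).Additive where
  map_add {_ _ f g} := by
    ext j
    exact map_add_of_prop (j ∈ K) (f.app j) (g.app j)

theorem isExactFunctor_trunc (K : Set ℤ) : IsExactFunctor (trunc (E := E) K) where
  additive := inferInstance
  map_conflation S h j := by
    by_cases hj : j ∈ K
    · have e : ∀ A : GrB E, (truncι K A).app j ≫ (truncπ K A).app j = 𝟙 _ := fun A =>
        congrArg (fun f => f.app j) (truncι_truncπ K A)
      let i : ∀ A : GrB E, A.obj j ≅ ((trunc K).obj A).obj j := fun A =>
        ⟨(truncπ K A).app j, (truncι K A).app j, truncπ_truncι_app_of_mem A hj, e A⟩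
      exact ExactCategory.of_iso (h j) (ShortComplex.isoMk (i S.X₁) (i S.X₂) (i S.X₃)
        (congrArg (fun f => f.app j) (truncπ_naturality K S.f)).symm
        (congrArg (fun f => f.app j) (truncπ_naturality K S.g)).symm)
    · exact conflation_of_isZero _ (suppIn_trunc K _ j hj) (suppIn_trunc K _ j hj)
        (suppIn_trunc K _ j hj)

theorem conflation_trunc {K L : Set ℤ} (h : Disjoint K L) {A : GrB E} (hA : SuppIn (K ∪ L) A) :
    Conflation (ShortComplex.mk (truncι K A) (truncπ L A) (truncι_truncπ_of_disjoint h A)) :=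
  conflation_of_split _ (truncι L A) (truncπ K A) _ (truncι_truncπ K A) (truncι_truncπ L A) _
    (truncι_truncπ_of_disjoint h.symm A) (truncπ_truncι_add h hA)

/-- The inclusion of the truncation of a short complex. -/
@[simps] def truncιComplex (K : Set ℤ) (S : ShortComplex (GrB E)) : S.map (trunc K) ⟶ S where
  τ₁ := truncι K S.X₁
  τ₂ := truncι K S.X₂
  τ₃ := truncι K S.X₃
  comm₁₂ := (truncι_naturality K S.f).symm
  comm₂₃ := (truncι_naturality K S.g).symm

/-- The projection to the truncation of a short complex. -/
@[simps] def truncπComplex (K : Set ℤ) (S : ShortComplex (GrB E)) : S ⟶ S.map (trunc K) where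
  τ₁ := truncπ K S.X₁
  τ₂ := truncπ K S.X₂
  τ₃ := truncπ K S.X₃
  comm₁₂ := (truncπ_naturality K S.f).symm
  comm₂₃ := (truncπ_naturality K S.g).symm

/-- Dévissage: a property of graded objects that is stable under extensions holds for all objects
with support in a finite set, if it holds for the objects concentrated in one degree of this set. -/
theorem induction_suppIn {motive : GrB E → Prop} (zero : ∀ A, IsZero A → motive A)
    (ext : ∀ S : ShortComplex (GrB E), Conflation S → motive S.X₁ → motive S.X₃ → motive S.X₂)
    (K : Finset ℤ) (conc : ∀ k ∈ K, ∀ A, SuppIn {k} A → motive A) (A : GrB E)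
    (hA : SuppIn K A) : motive A := by
  classical
  induction K using Finset.induction_on generalizing A with
  | empty => exact zero A (isZero_of_forall fun j => hA j (by simp))
  | insert k K hk ih =>
    have hd : Disjoint (K : Set ℤ) {k} := by simpa using hk
    refine ext _ (conflation_trunc hd (hA.mono fun j => ?_)) ?_ ?_
    · simp
    · exact ih (fun k' hk' => conc k' (Finset.mem_insert_of_mem hk')) _ (suppIn_trunc _ _)
    · exact conc k (Finset.mem_insert_self _ _) _ (suppIn_trunc _ _)

/-- The finite set of degrees of the nonzero components. -/
def supp (A : GrB E) : Finset ℤ := A.bounded.toFinset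

theorem suppIn_supp (A : GrB E) : SuppIn (A.supp : Set ℤ) A := fun j hj => by
  by_contra h
  exact hj (A.bounded.mem_toFinset.2 h)

/-- An object concentrated in degree `0` comes from `E`. -/
def degZeroIso {A : GrB E} (hA : SuppIn {0} A) : A ≅ degZero.obj (A.obj 0) :=
  isoMk fun
    | .ofNat 0 => Iso.refl _
    | .ofNat (n + 1) => (hA _ (by simp; omega)).iso (isZero_zero E)
    | .negSucc n => (hA _ (by simp)).iso (isZero_zero E)

theorem degZeroIso_naturality {A B : GrB E} (hA : SuppIn {0} A) (hB : SuppIn {0} B) (f : A ⟶ B) :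
    f ≫ (degZeroIso hB).hom = (degZeroIso hA).hom ≫ degZero.map (f.app 0) := by
  ext j
  rcases j with (_ | n) | n
  · exact (Category.comp_id _).trans (Category.id_comp _).symm
  all_goals exact (isZero_zero E).eq_of_tgt _ _

theorem suppIn_degZero (X : E) : SuppIn {0} (degZero.obj X) := fun j hj => isZero_degZeroObj X j hj

/-- `T(T⁻¹A) ≅ A`. -/
def shiftUnshiftIso (A : GrB E) : T.functor.obj ((shiftBy (-1)).obj A) ≅ A :=
  isoMk fun j => eqToIso (congrArg A.obj (by omega))

/-- `T⁻¹(TA) ≅ A`. -/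
def unshiftShiftIso (A : GrB E) : (shiftBy (-1)).obj (T.functor.obj A) ≅ A :=
  isoMk fun j => eqToIso (congrArg A.obj (by omega))

theorem shiftUnshiftIso_naturality {A B : GrB E} (f : A ⟶ B) :
    T.functor.map ((shiftBy (-1)).map f) ≫ (shiftUnshiftIso B).hom =
      (shiftUnshiftIso A).hom ≫ f := by
  ext j
  have h : j + 1 + -1 = j := by omega
  change f.app (j + 1 + -1) ≫ eqToHom (congrArg B.obj h) = eqToHom (congrArg A.obj h) ≫ f.app j
  rw [app_congr f h]
  simp

theorem SuppIn.shift {k : ℤ} {A : GrB E} (h : SuppIn {k + 1} A) : SuppIn {k} (T.functor.obj A) :=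
  fun j hj => h (j + 1) (by simpa using hj)

theorem SuppIn.unshift {k : ℤ} {A : GrB E} (h : SuppIn {k} A) :
    SuppIn {k + 1} ((shiftBy (-1)).obj A) :=
  fun j hj => h (j + -1) fun hj' => hj (by
    simp only [Set.mem_singleton_iff] at hj' ⊢
    omega)

end GrB

/-! ### Morphisms on objects with restricted support -/

section Det

variable {E : Type u} [Category.{v} E] [Preadditive E] [ExactCategory E]
variable {P : Type w} [Category.{v₁} P] [MonoidalCategory P] [SymmetricCategory P]

/-- Naturality of a map that is glued from natural maps by means of natural decompositions. -/
theorem comp_conj_tensor {X X' Y Y' A A' B B' C C' D D' : P} {a : X ⟶ X'} {i : X ⟶ A ⊗ B}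
    {i' : X' ⟶ A' ⊗ B'} {p : A ⟶ A'} {q : B ⟶ B'} (h : a ≫ i' = i ≫ (p ⊗ₘ q))
    {b : Y ⟶ Y'} {j : Y ≅ C ⊗ D} {j' : Y' ≅ C' ⊗ D'} {r : C ⟶ C'} {s : D ⟶ D'}
    (h' : b ≫ j'.hom = j.hom ≫ (r ⊗ₘ s)) {α : A ⟶ C} {α' : A' ⟶ C'} {β : B ⟶ D} {β' : B' ⟶ D'}
    (hα : p ≫ α' = α ≫ r) (hβ : q ≫ β' = β ≫ s) :
    a ≫ i' ≫ (α' ⊗ₘ β') ≫ j'.inv = (i ≫ (α ⊗ₘ β) ≫ j.inv) ≫ b := by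
  have e : j.inv ≫ b = (r ⊗ₘ s) ≫ j'.inv := by
    rw [Iso.inv_comp_eq, ← Category.assoc, ← h', Category.assoc, Iso.hom_inv_id,
      Category.comp_id]
  rw [reassoc_of% h, tensorHom_comp_tensorHom_assoc, hα, hβ, Category.assoc, Category.assoc, e,
    tensorHom_comp_tensorHom_assoc]

/-- If the decompositions `t`, `s` satisfy the `3 × 3` lemma, then the maps that are glued from maps
`α`, `β` by means of `t` and `s` are compatible with `x` and `y`, if `α` and `β` are compatible with
`a`, `c` and with `b`, `d`. -/
theorem comp_tensor_conj_tensor {X₁ X₂ X₃ A₁ A₂ A₃ B₁ B₂ B₃ Y₁ Y₂ Y₃ C₁ C₂ C₃ D₁ D₂ D₃ : P}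
    {x : X₂ ⟶ X₁ ⊗ X₃} {t₁ : X₁ ⟶ A₁ ⊗ B₁} {t₂ : X₂ ⟶ A₂ ⊗ B₂} {t₃ : X₃ ⟶ A₃ ⊗ B₃}
    {a : A₂ ⟶ A₁ ⊗ A₃} {b : B₂ ⟶ B₁ ⊗ B₃}
    (h : x ≫ (t₁ ⊗ₘ t₃) = t₂ ≫ (a ⊗ₘ b) ≫ tensorμ A₁ A₃ B₁ B₃)
    {y : Y₂ ⟶ Y₁ ⊗ Y₃} {s₁ : Y₁ ≅ C₁ ⊗ D₁} {s₂ : Y₂ ≅ C₂ ⊗ D₂} {s₃ : Y₃ ≅ C₃ ⊗ D₃}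
    {c : C₂ ⟶ C₁ ⊗ C₃} {d : D₂ ⟶ D₁ ⊗ D₃}
    (h' : y ≫ (s₁.hom ⊗ₘ s₃.hom) = s₂.hom ≫ (c ⊗ₘ d) ≫ tensorμ C₁ C₃ D₁ D₃)
    {α₁ : A₁ ⟶ C₁} {α₂ : A₂ ⟶ C₂} {α₃ : A₃ ⟶ C₃} (hα : a ≫ (α₁ ⊗ₘ α₃) = α₂ ≫ c)
    {β₁ : B₁ ⟶ D₁} {β₂ : B₂ ⟶ D₂} {β₃ : B₃ ⟶ D₃} (hβ : b ≫ (β₁ ⊗ₘ β₃) = β₂ ≫ d) :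
    x ≫ ((t₁ ≫ (α₁ ⊗ₘ β₁) ≫ s₁.inv) ⊗ₘ (t₃ ≫ (α₃ ⊗ₘ β₃) ≫ s₃.inv)) =
      (t₂ ≫ (α₂ ⊗ₘ β₂) ≫ s₂.inv) ≫ y := by
  rw [← cancel_mono (s₁.hom ⊗ₘ s₃.hom)]
  simp only [Category.assoc, tensorHom_comp_tensorHom, Iso.inv_hom_id, Category.comp_id, h',
    Iso.inv_hom_id_assoc]
  rw [← tensorHom_comp_tensorHom, reassoc_of% h, ← tensorμ_natural, tensorHom_comp_tensorHom_assoc,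
    tensorHom_comp_tensorHom_assoc, hα, hβ]

open GrB

/-- A morphism between the restrictions of two determinant functors to the graded objects with
support in `K`. -/
structure HomOn (g g' : DetFunctor (GrB E) P) (K : Set ℤ) where
  app : ∀ A : GrB E, SuppIn K A → (g.F.obj ⟨A⟩ ⟶ g'.F.obj ⟨A⟩)
  naturality : ∀ {A B : GrB E} (hA : SuppIn K A) (hB : SuppIn K B) (a : A ≅ B),
    g.F.map ⟨a⟩ ≫ app B hB = app A hA ≫ g'.F.map ⟨a⟩
  isHom : ∀ (S : ShortComplex (GrB E)) (h : Conflation S) (h₁ : SuppIn K S.X₁)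
    (h₂ : SuppIn K S.X₂) (h₃ : SuppIn K S.X₃),
    (g.iso S h).hom ≫ (app S.X₁ h₁ ⊗ₘ app S.X₃ h₃) = app S.X₂ h₂ ≫ (g'.iso S h).hom

namespace HomOn

variable {g g' : DetFunctor (GrB E) P} {K K' : Set ℤ}

/-- Restriction to a smaller support. -/
@[simps] def restrict (φ : HomOn g g' K) (h : K' ⊆ K) : HomOn g g' K' where
  app A hA := φ.app A (hA.mono h)
  naturality hA hB a := φ.naturality (hA.mono h) (hB.mono h) a
  isHom S hS h₁ h₂ h₃ := φ.isHom S hS (h₁.mono h) (h₂.mono h) (h₃.mono h)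

variable [PicardCategory P]

theorem app_comp_toUnit (φ : HomOn g g' K) {A : GrB E} (hA : SuppIn K A) (hZ : IsZero A) :
    φ.app A hA ≫ toUnit (g'.zeroUnit hZ) = toUnit (g.zeroUnit hZ) := by
  rw [← isUnitHom_iff]
  exact φ.isHom _ (DetFunctor.conflation_zero hZ) hA hA hA

theorem app_eq_of_isZero (φ : HomOn g g' K) (φ' : HomOn g g' K') {A : GrB E} (hA : SuppIn K A)
    (hA' : SuppIn K' A) (hZ : IsZero A) : φ.app A hA = φ'.app A hA' := by
  rw [← cancel_mono (toUnit (g'.zeroUnit hZ)), app_comp_toUnit, app_comp_toUnit]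

/-- A morphism is determined by its values on the objects that are concentrated in one degree. -/
theorem app_eq (φ : HomOn g g' K) (φ' : HomOn g g' K') (L : Finset ℤ)
    (H : ∀ k ∈ L, ∀ A, SuppIn {k} A → ∀ (h : SuppIn K A) (h' : SuppIn K' A),
      φ.app A h = φ'.app A h') (A : GrB E) (hA : SuppIn L A) (h : SuppIn K A)
    (h' : SuppIn K' A) : φ.app A h = φ'.app A h' := by
  refine induction_suppIn
    (motive := fun A => ∀ (h : SuppIn K A) (h' : SuppIn K' A), φ.app A h = φ'.app A h')
    (fun A hZ h h' => app_eq_of_isZero φ φ' h h' hZ) ?_ L H A hA h h'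
  intro S hS H₁ H₃ h h'
  rw [← cancel_mono (g'.iso S hS).hom, ← φ.isHom S hS (h.left hS) h (h.right hS),
    ← φ'.isHom S hS (h'.left hS) h' (h'.right hS), H₁ (h.left hS) (h'.left hS),
    H₃ (h.right hS) (h'.right hS)]

section Union

variable (φ : HomOn g g' K) (φ' : HomOn g g' K') (hd : Disjoint K K')

/-- The value of the common extension of two morphisms on `A`, determined by the split short exact
sequence of the two truncations of `A`. -/
def unionApp {A : GrB E} (hA : SuppIn (K ∪ K') A) : g.F.obj ⟨A⟩ ⟶ g'.F.obj ⟨A⟩ :=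
  (g.iso _ (conflation_trunc hd hA)).hom ≫
    (φ.app _ (suppIn_trunc K A) ⊗ₘ φ'.app _ (suppIn_trunc K' A)) ≫
    (g'.iso _ (conflation_trunc hd hA)).inv

/-- The common extension of two morphisms to graded objects with support in the disjoint union. -/
def union : HomOn g g' (K ∪ K') where
  app A hA := unionApp φ φ' hd hA
  naturality {A B} hA hB a := by
    exact comp_conj_tensor
      (g.naturality _ _ (conflation_trunc hd hA) (conflation_trunc hd hB)
        ((trunc K).mapIso a) a ((trunc K').mapIso a) (truncι_naturality K a.hom)
        (truncπ_naturality K' a.hom))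
      (g'.naturality _ _ (conflation_trunc hd hA) (conflation_trunc hd hB)
        ((trunc K).mapIso a) a ((trunc K').mapIso a) (truncι_naturality K a.hom)
        (truncπ_naturality K' a.hom))
      (φ.naturality (suppIn_trunc K A) (suppIn_trunc K B) _)
      (φ'.naturality (suppIn_trunc K' A) (suppIn_trunc K' B) _)
  isHom S hS h₁ h₂ h₃ := by
    have e := fun k : DetFunctor (GrB E) P => k.iso_sum
      ((isExactFunctor_trunc K).map_conflation S hS) ((isExactFunctor_trunc K').map_conflation S hS)
      hS (truncιComplex K S) (truncιComplex K' S) (truncπComplex K S) (truncπComplex K' S)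
      (ShortComplex.hom_ext _ _ (truncι_truncπ K _) (truncι_truncπ K _) (truncι_truncπ K _))
      (ShortComplex.hom_ext _ _ (truncι_truncπ K' _) (truncι_truncπ K' _) (truncι_truncπ K' _))
      (ShortComplex.hom_ext _ _ (truncι_truncπ_of_disjoint hd _)
        (truncι_truncπ_of_disjoint hd _) (truncι_truncπ_of_disjoint hd _))
      (ShortComplex.hom_ext _ _ (truncι_truncπ_of_disjoint hd.symm _)
        (truncι_truncπ_of_disjoint hd.symm _) (truncι_truncπ_of_disjoint hd.symm _))
      (ShortComplex.hom_ext _ _ (truncπ_truncι_add hd h₁) (truncπ_truncι_add hd h₂)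
        (truncπ_truncι_add hd h₃)) _ _ _ (conflation_trunc hd h₁) (conflation_trunc hd h₂)
        (conflation_trunc hd h₃)
    exact comp_tensor_conj_tensor (e g) (e g')
      (φ.isHom _ ((isExactFunctor_trunc K).map_conflation S hS) (suppIn_trunc K _)
        (suppIn_trunc K _) (suppIn_trunc K _))
      (φ'.isHom _ ((isExactFunctor_trunc K').map_conflation S hS) (suppIn_trunc K' _)
        (suppIn_trunc K' _) (suppIn_trunc K' _))

theorem union_app_left {A : GrB E} (h : SuppIn K A) (h' : SuppIn (K ∪ K') A) :
    (φ.union φ' hd).app A h' = φ.app A h := by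
  have hZ : IsZero ((trunc K').obj A) := (h.trunc K').isZero (suppIn_trunc K' A) hd
  have e := φ.isHom _ (conflation_trunc hd h') (h.trunc K) h (h.trunc K')
  refine Eq.trans ?_ ((Iso.eq_comp_inv _).2 e.symm).symm
  rw [← app_eq_of_isZero φ' φ (suppIn_trunc K' A) (h.trunc K') hZ, Category.assoc]
  rfl

theorem union_app_right {A : GrB E} (h : SuppIn K' A) (h' : SuppIn (K ∪ K') A) :
    (φ.union φ' hd).app A h' = φ'.app A h := by
  have hZ : IsZero ((trunc K).obj A) := (suppIn_trunc K A).isZero (h.trunc K) hd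
  have e := φ'.isHom _ (conflation_trunc hd h') (h.trunc K) h (h.trunc K')
  refine Eq.trans ?_ ((Iso.eq_comp_inv _).2 e.symm).symm
  rw [← app_eq_of_isZero φ φ' (suppIn_trunc K A) (h.trunc K) hZ, Category.assoc]
  rfl

end Union

/-- Morphisms on the objects concentrated in one degree extend to all objects with support in a
finite set. -/
theorem exists_extension (ℓ : ∀ k : ℤ, HomOn g g' {k}) (K : Finset ℤ) :
    ∃ φ : HomOn g g' (K : Set ℤ), ∀ k ∈ K, ∀ (A : GrB E) (h : SuppIn {k} A)
      (h' : SuppIn (K : Set ℤ) A), φ.app A h' = (ℓ k).app A h := by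
  classical
  induction K using Finset.induction_on with
  | empty => exact ⟨((ℓ 0).restrict (by simp)), by simp⟩
  | insert k K hk ih =>
    obtain ⟨φ, hφ⟩ := ih
    have hd : Disjoint (K : Set ℤ) {k} := by simpa using hk
    have hK : ((insert k K : Finset ℤ) : Set ℤ) ⊆ (K : Set ℤ) ∪ {k} := by simp
    refine ⟨(φ.union (ℓ k) hd).restrict hK, fun k' hk' A h h' => ?_⟩
    rcases Finset.mem_insert.1 hk' with rfl | hk'
    · exact union_app_right φ (ℓ k') hd h (h'.mono hK)
    · have hA : SuppIn (K : Set ℤ) A := h.mono (by simpa using hk')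
      exact (union_app_left φ (ℓ k) hd hA (h'.mono hK)).trans (hφ k' hk' A h hA)

/-- Morphisms on the objects concentrated in one degree extend to a morphism of determinant
functors. -/
theorem exists_hom (ℓ : ∀ k : ℤ, HomOn g g' {k}) :
    ∃ t : g ⟶ g', ∀ (k : ℤ) (A : GrB E) (h : SuppIn {k} A),
      t.iso.hom.app ⟨A⟩ = (ℓ k).app A h := by
  choose Φ hΦ using exists_extension ℓ
  have key : ∀ (K : Finset ℤ) (A : GrB E) (h : SuppIn (K : Set ℤ) A),
      (Φ A.supp).app A A.suppIn_supp = (Φ K).app A h := by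
    intro K A h
    refine app_eq _ _ (A.supp ∩ K) (fun k hk A' hA' h₁ h₂ => ?_) A (fun j hj => ?_) _ _
    · rw [Finset.mem_inter] at hk
      rw [hΦ _ k hk.1 A' hA', hΦ _ k hk.2 A' hA']
    · by_cases hj' : j ∈ K
      · exact A.suppIn_supp j (by simp_all)
      · exact h j (by simpa using hj')
  refine ⟨⟨NatIso.ofComponents (fun A => asIso ((Φ A.of.supp).app A.of A.of.suppIn_supp))
    fun {A B} a => ?_, fun S hS => ?_⟩, fun k A h => ?_⟩
  · have hA : SuppIn ((A.of.supp ∪ B.of.supp : Finset ℤ) : Set ℤ) A.of :=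
      A.of.suppIn_supp.mono (by simp)
    have hB : SuppIn ((A.of.supp ∪ B.of.supp : Finset ℤ) : Set ℤ) B.of :=
      B.of.suppIn_supp.mono (by simp)
    have e := (Φ (A.of.supp ∪ B.of.supp)).naturality hA hB a.iso
    rw [← key _ _ hA, ← key _ _ hB] at e
    exact e
  · have h₂ := S.X₂.suppIn_supp
    have e := (Φ S.X₂.supp).isHom S hS (h₂.left hS) h₂ (h₂.right hS)
    rw [← key _ _ (h₂.left hS), ← key _ _ (h₂.right hS)] at e
    exact e
  · have h' : SuppIn (({k} : Finset ℤ) : Set ℤ) A := by simpa using h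
    exact (key {k} A h').trans (hΦ {k} k (by simp) A h h')

end HomOn
end Det

/-! ### Full faithfulness of the restriction to degree `0` -/

section Picard

variable {P : Type w} [Category.{v₁} P] [MonoidalCategory P] [SymmetricCategory P]
variable [PicardCategory P]

theorem tensorHom_left_cancel {X X' Y Y' : P} {a : X ⟶ X'} {b b' : Y ⟶ Y'}
    (h : a ⊗ₘ b = a ⊗ₘ b') : b = b' := by
  rw [MonoidalCategory.tensorHom_def, MonoidalCategory.tensorHom_def, cancel_epi] at h
  exact whiskerLeft_injective X' h

theorem tensorHom_right_cancel {X X' Y Y' : P} {a a' : X ⟶ X'} {b : Y ⟶ Y'}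
    (h : a ⊗ₘ b = a' ⊗ₘ b) : a = a' := by
  refine tensorHom_left_cancel (a := b) ?_
  rw [← cancel_epi (β_ X Y).hom, ← BraidedCategory.braiding_naturality, h,
    BraidedCategory.braiding_naturality]

theorem isUnitHom_unique {U V : P} {δ : UnitStr U} {δ' : UnitStr V} {α β : U ⟶ V}
    (hα : IsUnitHom δ δ' α) (hβ : IsUnitHom δ δ' β) : α = β :=
  (existsUnique_unitHom δ δ').unique hα hβ

/-- The mirror image of `existsUnique_dual`: the first factor of a morphism of units can be
chosen to match the second one. -/
theorem exists_unitHom_left {X Y A B : P} (β : A ⟶ B) (δ : UnitStr (X ⊗ A))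
    (δ' : UnitStr (Y ⊗ B)) : ∃ α : X ⟶ Y, IsUnitHom δ δ' (α ⊗ₘ β) := by
  obtain ⟨α, hα, -⟩ := existsUnique_dual β (inducedUnit δ (β_ A X)) (inducedUnit δ' (β_ B Y))
  refine ⟨α, ?_⟩
  rw [isUnitHom_iff, toUnit_inducedUnit, toUnit_inducedUnit,
    BraidedCategory.braiding_naturality_assoc, cancel_epi] at hα
  exact (isUnitHom_iff _ _ _).2 hα

theorem IsUnitHom.tensor {U U' V V' : P} {δ : UnitStr U} {δ' : UnitStr U'} {η : UnitStr V}
    {η' : UnitStr V'} {α : U ⟶ U'} {β : V ⟶ V'} (hα : IsUnitHom δ δ' α) (hβ : IsUnitHom η η' β) :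
    IsUnitHom (prodUnit δ η) (prodUnit δ' η') (α ⊗ₘ β) := by
  rw [isUnitHom_iff] at *
  rw [toUnit_prodUnit, toUnit_prodUnit, tensorHom_comp_tensorHom_assoc, hα, hβ]

theorem IsUnitHom.of_comp {U V W : P} {δ : UnitStr U} {δ' : UnitStr V} {δ'' : UnitStr W}
    {α : U ⟶ V} {β : V ⟶ W} (h : IsUnitHom δ δ'' (α ≫ β)) (hβ : IsUnitHom δ' δ'' β) :
    IsUnitHom δ δ' α := by
  rw [isUnitHom_iff] at *
  rw [← hβ, ← Category.assoc, h]

/-- If the pairs of maps `αᵢ`, `βᵢ` are dual to each other, then the compatibility of the `αᵢ` with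
the decompositions `x`, `y` is equivalent to the compatibility of the `βᵢ` with the dual
decompositions `x'`, `y'`, since either factor of the tensor product can be cancelled. -/
theorem tensorHom_eq_of_dual {X₁ X₂ X₃ X₁' X₂' X₃' Y₁ Y₂ Y₃ Y₁' Y₂' Y₃' : P}
    {δ₁ : UnitStr (X₁ ⊗ X₁')} {δ₂ : UnitStr (X₂ ⊗ X₂')} {δ₃ : UnitStr (X₃ ⊗ X₃')}
    {η₁ : UnitStr (Y₁ ⊗ Y₁')} {η₂ : UnitStr (Y₂ ⊗ Y₂')} {η₃ : UnitStr (Y₃ ⊗ Y₃')}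
    {x : X₂ ⟶ X₁ ⊗ X₃} {x' : X₂' ⟶ X₁' ⊗ X₃'} {y : Y₂ ⟶ Y₁ ⊗ Y₃} {y' : Y₂' ⟶ Y₁' ⊗ Y₃'}
    (hx : IsUnitHom δ₂ (prodUnit δ₁ δ₃) ((x ⊗ₘ x') ≫ (interchange X₁ X₃ X₁' X₃').hom))
    (hy : IsUnitHom η₂ (prodUnit η₁ η₃) ((y ⊗ₘ y') ≫ (interchange Y₁ Y₃ Y₁' Y₃').hom))
    {α₁ : X₁ ⟶ Y₁} {α₂ : X₂ ⟶ Y₂} {α₃ : X₃ ⟶ Y₃} {β₁ : X₁' ⟶ Y₁'} {β₂ : X₂' ⟶ Y₂'}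
    {β₃ : X₃' ⟶ Y₃'} (h₁ : IsUnitHom δ₁ η₁ (α₁ ⊗ₘ β₁)) (h₂ : IsUnitHom δ₂ η₂ (α₂ ⊗ₘ β₂))
    (h₃ : IsUnitHom δ₃ η₃ (α₃ ⊗ₘ β₃)) :
    (x ≫ (α₁ ⊗ₘ α₃)) ⊗ₘ (x' ≫ (β₁ ⊗ₘ β₃)) = (α₂ ≫ y) ⊗ₘ (β₂ ≫ y') := by
  have e := isUnitHom_unique (hx.comp (h₁.tensor h₃)) (h₂.comp hy)
  rw [interchange_hom, interchange_hom, Category.assoc, ← tensorμ_natural, ← Category.assoc,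
    ← Category.assoc, cancel_mono, tensorHom_comp_tensorHom, tensorHom_comp_tensorHom] at e
  exact e

/-- Duality of pairs of maps is stable under extensions. -/
theorem IsUnitHom.of_conflation {X₁ X₂ X₃ X₁' X₂' X₃' Y₁ Y₂ Y₃ Y₁' Y₂' Y₃' : P}
    {δ₁ : UnitStr (X₁ ⊗ X₁')} {δ₂ : UnitStr (X₂ ⊗ X₂')} {δ₃ : UnitStr (X₃ ⊗ X₃')}
    {η₁ : UnitStr (Y₁ ⊗ Y₁')} {η₂ : UnitStr (Y₂ ⊗ Y₂')} {η₃ : UnitStr (Y₃ ⊗ Y₃')}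
    {x : X₂ ⟶ X₁ ⊗ X₃} {x' : X₂' ⟶ X₁' ⊗ X₃'} {y : Y₂ ⟶ Y₁ ⊗ Y₃} {y' : Y₂' ⟶ Y₁' ⊗ Y₃'}
    (hx : IsUnitHom δ₂ (prodUnit δ₁ δ₃) ((x ⊗ₘ x') ≫ (interchange X₁ X₃ X₁' X₃').hom))
    (hy : IsUnitHom η₂ (prodUnit η₁ η₃) ((y ⊗ₘ y') ≫ (interchange Y₁ Y₃ Y₁' Y₃').hom))
    {α₁ : X₁ ⟶ Y₁} {α₂ : X₂ ⟶ Y₂} {α₃ : X₃ ⟶ Y₃} {β₁ : X₁' ⟶ Y₁'} {β₂ : X₂' ⟶ Y₂'}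
    {β₃ : X₃' ⟶ Y₃'} (h₁ : IsUnitHom δ₁ η₁ (α₁ ⊗ₘ β₁)) (h₃ : IsUnitHom δ₃ η₃ (α₃ ⊗ₘ β₃))
    (e : x ≫ (α₁ ⊗ₘ α₃) = α₂ ≫ y) (e' : x' ≫ (β₁ ⊗ₘ β₃) = β₂ ≫ y') :
    IsUnitHom δ₂ η₂ (α₂ ⊗ₘ β₂) := by
  refine IsUnitHom.of_comp ?_ hy
  have h := hx.comp (h₁.tensor h₃)
  rw [interchange_hom, Category.assoc, ← tensorμ_natural, tensorHom_comp_tensorHom_assoc, e,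
    e'] at h
  rwa [interchange_hom, tensorHom_comp_tensorHom_assoc]

end Picard

/-- A sequence on `ℤ` can be defined by recursion in both directions. -/
theorem exists_int_seq {α : ℤ → Type*} (R : ∀ k, α (k + 1) → α k → Prop)
    (up : ∀ k (a : α k), ∃ b, R k b a) (down : ∀ k (b : α (k + 1)), ∃ a, R k b a) (a : α 0) :
    ∃ s : ∀ k, α k, s 0 = a ∧ ∀ k, R k (s (k + 1)) (s k) := by
  choose u hu using up
  choose d hd using down
  let p : ∀ n : ℕ, α (Int.ofNat n) := fun n => Nat.rec a (fun n b => u (Int.ofNat n) b) n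
  let q : ∀ n : ℕ, α (Int.negSucc n) := fun n =>
    Nat.rec (d (Int.negSucc 0) a) (fun n b => d (Int.negSucc (n + 1)) b) n
  let s : ∀ k, α k
    | .ofNat n => p n
    | .negSucc n => q n
  refine ⟨s, rfl, ?_⟩
  rintro (n | _ | n)
  · exact hu (Int.ofNat n) (p n)
  · exact hd (Int.negSucc 0) a
  · exact hd (Int.negSucc (n + 1)) (q n)

section Det

variable {E : Type u} [Category.{v} E] [Preadditive E] [ExactCategory E]
variable {P : Type w} [Category.{v₁} P] [MonoidalCategory P] [SymmetricCategory P]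

open GrB

theorem map_comp_eq {C : Type*} [Category* C] (F : Core C ⥤ P) {A B B' D : C} {a : A ≅ B}
    {b : B ≅ D} {c : A ≅ B'} {d : B' ≅ D} (h : a.hom ≫ b.hom = c.hom ≫ d.hom) :
    F.map (X := ⟨A⟩) (Y := ⟨B⟩) ⟨a⟩ ≫ F.map (Y := ⟨D⟩) ⟨b⟩ =
      F.map (X := ⟨A⟩) (Y := ⟨B'⟩) ⟨c⟩ ≫ F.map (Y := ⟨D⟩) ⟨d⟩ := by
  rw [← F.map_comp, ← F.map_comp]
  congr 1
  exact Core.hom_ext h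

theorem map_symm_comp {C : Type*} [Category* C] (F : Core C ⥤ P) {A B : C} (a : A ≅ B) :
    F.map (X := ⟨B⟩) (Y := ⟨A⟩) ⟨a.symm⟩ ≫ F.map (Y := ⟨B⟩) ⟨a⟩ = 𝟙 _ := by
  rw [← F.map_comp, ← F.map_id]
  congr 1
  exact Core.hom_ext a.inv_hom_id

/-- The conjugate of a morphism by an isomorphism `A ≅ A'`. -/
def conjMap {C : Type*} [Category* C] (F G : Core C ⥤ P) {A A' : C} (z : A ≅ A')
    (t : F.obj ⟨A'⟩ ⟶ G.obj ⟨A'⟩) : F.obj ⟨A⟩ ⟶ G.obj ⟨A⟩ :=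
  F.map ⟨z⟩ ≫ t ≫ G.map ⟨z.symm⟩

theorem conjMap_naturality {C : Type*} [Category* C] (F G : Core C ⥤ P) {A A' B B' : C}
    {z : A ≅ A'} {y : B ≅ B'} {a : A ≅ B} {a' : A' ≅ B'} (h : a.hom ≫ y.hom = z.hom ≫ a'.hom)
    {t : F.obj ⟨A'⟩ ⟶ G.obj ⟨A'⟩} {t' : F.obj ⟨B'⟩ ⟶ G.obj ⟨B'⟩}
    (ht : F.map ⟨a'⟩ ≫ t' = t ≫ G.map ⟨a'⟩) :
    F.map ⟨a⟩ ≫ conjMap F G y t' = conjMap F G z t ≫ G.map ⟨a⟩ := by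
  have e := map_comp_eq F h
  have e' := map_comp_eq G (a := a') (b := y.symm) (c := z.symm) (d := a) (by
    rw [Iso.symm_hom, Iso.comp_inv_eq, Category.assoc, h, Iso.symm_hom, Iso.inv_hom_id_assoc])
  rw [conjMap, conjMap, reassoc_of% e, reassoc_of% ht, e', Category.assoc, Category.assoc]

theorem conjMap_isHom {C : Type*} [Category* C] [Preadditive C] [ExactCategory C]
    (g g' : DetFunctor C P) {S S' : ShortComplex C} (h : Conflation S) (h' : Conflation S')
    {z₁ : S.X₁ ≅ S'.X₁} {z₂ : S.X₂ ≅ S'.X₂} {z₃ : S.X₃ ≅ S'.X₃}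
    (e₁ : z₁.hom ≫ S'.f = S.f ≫ z₂.hom) (e₂ : z₂.hom ≫ S'.g = S.g ≫ z₃.hom)
    {t₁ : g.F.obj ⟨S'.X₁⟩ ⟶ g'.F.obj ⟨S'.X₁⟩} {t₂ : g.F.obj ⟨S'.X₂⟩ ⟶ g'.F.obj ⟨S'.X₂⟩}
    {t₃ : g.F.obj ⟨S'.X₃⟩ ⟶ g'.F.obj ⟨S'.X₃⟩}
    (ht : (g.iso S' h').hom ≫ (t₁ ⊗ₘ t₃) = t₂ ≫ (g'.iso S' h').hom) :
    (g.iso S h).hom ≫ (conjMap g.F g'.F z₁ t₁ ⊗ₘ conjMap g.F g'.F z₃ t₃) =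
      conjMap g.F g'.F z₂ t₂ ≫ (g'.iso S h).hom := by
  have n := g.naturality S S' h h' z₁ z₂ z₃ e₁ e₂
  have n' := g'.naturality S' S h' h z₁.symm z₂.symm z₃.symm
    (by rw [Iso.symm_hom, Iso.inv_comp_eq, ← Category.assoc, e₁]; simp)
    (by rw [Iso.symm_hom, Iso.inv_comp_eq, ← Category.assoc, e₂]; simp)
  rw [conjMap, conjMap, conjMap, Category.assoc, Category.assoc, n', ← reassoc_of% ht,
    reassoc_of% n, tensorHom_comp_tensorHom, tensorHom_comp_tensorHom]

/-- A morphism between the restrictions to degree `0`, as a morphism on the graded objects that are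
concentrated in degree `0`. -/
def HomOn.ofDegZero {g g' : DetFunctorT P (GrB.T (E := E))} (t : (W E P).obj g ⟶ (W E P).obj g') :
    HomOn g.toDetFunctor g'.toDetFunctor {0} where
  app A hA := conjMap g.F g'.F (degZeroIso hA) (t.iso.hom.app ⟨A.obj 0⟩)
  naturality {A B} hA hB a :=
    conjMap_naturality g.F g'.F (a' := degZero.mapIso ((eval 0).mapIso a))
      (degZeroIso_naturality hA hB a.hom)
      (t.iso.hom.naturality (X := ⟨A.obj 0⟩) (Y := ⟨B.obj 0⟩) ⟨(eval 0).mapIso a⟩)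
  isHom S hS h₁ h₂ h₃ :=
    conjMap_isHom g.toDetFunctor g'.toDetFunctor (S' := (S.map (eval 0)).map degZero) hS
      (isExactFunctor_degZero.map_conflation _ (hS 0)) (degZeroIso_naturality h₁ h₂ S.f).symm
      (degZeroIso_naturality h₂ h₃ S.g).symm (t.isHom (S.map (eval 0)) (hS 0))

variable [PicardCategory P]

/-- `ψ` on `TA` is dual to `φ` on `A`. -/
def HomOn.IsDual {g g' : DetFunctorT P (GrB.T (E := E))} {k : ℤ}
    (φ : HomOn g.toDetFunctor g'.toDetFunctor {k + 1})
    (ψ : HomOn g.toDetFunctor g'.toDetFunctor {k}) : Prop :=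
  ∀ (A : GrB E) (hA : SuppIn {k + 1} A),
    IsUnitHom (g.μ A) (g'.μ A) (φ.app A hA ⊗ₘ ψ.app (T.functor.obj A) hA.shift)

variable {g g' : DetFunctorT P (GrB.T (E := E))}

/-- Naturality of a family of maps on `A` is equivalent to naturality of the dual family on `TA`. -/
theorem DetFunctorT.naturality_of_dual {A B : GrB E} {α : g.F.obj ⟨A⟩ ⟶ g'.F.obj ⟨A⟩}
    {α' : g.F.obj ⟨B⟩ ⟶ g'.F.obj ⟨B⟩}
    {β : g.F.obj ⟨T.functor.obj A⟩ ⟶ g'.F.obj ⟨T.functor.obj A⟩}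
    {β' : g.F.obj ⟨T.functor.obj B⟩ ⟶ g'.F.obj ⟨T.functor.obj B⟩}
    (h : IsUnitHom (g.μ A) (g'.μ A) (α ⊗ₘ β)) (h' : IsUnitHom (g.μ B) (g'.μ B) (α' ⊗ₘ β'))
    (a : A ≅ B) :
    (g.F.map ⟨a⟩ ≫ α') ⊗ₘ (g.F.map ⟨T.functor.mapIso a⟩ ≫ β') =
      (α ≫ g'.F.map ⟨a⟩) ⊗ₘ (β ≫ g'.F.map ⟨T.functor.mapIso a⟩) := by
  rw [← tensorHom_comp_tensorHom, ← tensorHom_comp_tensorHom]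
  exact isUnitHom_unique ((g.isUnitHom_iso a).comp h') (h.comp (g'.isUnitHom_iso a))

/-- A morphism in degree `k` extends by duality to degree `k + 1`. -/
theorem HomOn.exists_isDual_left {k : ℤ} (ψ : HomOn g.toDetFunctor g'.toDetFunctor {k}) :
    ∃ φ : HomOn g.toDetFunctor g'.toDetFunctor {k + 1}, φ.IsDual ψ := by
  choose φ hφ using fun (A : GrB E) (hA : SuppIn {k + 1} A) =>
    exists_unitHom_left (ψ.app (T.functor.obj A) hA.shift) (g.μ A) (g'.μ A)
  refine ⟨⟨φ, fun {A B} hA hB a => ?_, fun S h h₁ h₂ h₃ => ?_⟩, hφ⟩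
  · have e := DetFunctorT.naturality_of_dual (hφ A hA) (hφ B hB) a
    rw [ψ.naturality hA.shift hB.shift] at e
    exact tensorHom_right_cancel e
  · have e := tensorHom_eq_of_dual (g.isUnitHom_conflation S h) (g'.isUnitHom_conflation S h)
      (hφ _ h₁) (hφ _ h₂) (hφ _ h₃)
    have e' := ψ.isHom (S.map T.functor) (T.exact_functor.map_conflation S h) h₁.shift h₂.shift
      h₃.shift
    exact tensorHom_right_cancel (e.trans (congrArg _ e'.symm))

/-- A morphism in degree `k + 1` extends by duality to degree `k`. -/
theorem HomOn.exists_isDual_right {k : ℤ} (φ : HomOn g.toDetFunctor g'.toDetFunctor {k + 1}) :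
    ∃ ψ : HomOn g.toDetFunctor g'.toDetFunctor {k}, φ.IsDual ψ := by
  choose ψ hψ using fun (A : GrB E) (hA : SuppIn {k + 1} A) =>
    (existsUnique_dual (φ.app A hA) (g.μ A) (g'.μ A)).exists
  have nat : ∀ {A B : GrB E} (hA : SuppIn {k + 1} A) (hB : SuppIn {k + 1} B) (a : A ≅ B),
      g.F.map ⟨T.functor.mapIso a⟩ ≫ ψ B hB = ψ A hA ≫ g'.F.map ⟨T.functor.mapIso a⟩ := by
    intro A B hA hB a
    have e := DetFunctorT.naturality_of_dual (hψ A hA) (hψ B hB) a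
    rw [φ.naturality hA hB] at e
    exact tensorHom_left_cancel e
  -- an object `B` in degree `k` is identified with `T(T⁻¹B)`
  have nat' : ∀ {A B : GrB E} (a : A ⟶ B), a ≫ (shiftUnshiftIso B).symm.hom =
      (shiftUnshiftIso A).symm.hom ≫ T.functor.map ((shiftBy (-1)).map a) := by
    intro A B a
    rw [Iso.symm_hom, Iso.symm_hom, Iso.comp_inv_eq, Category.assoc, shiftUnshiftIso_naturality,
      Iso.inv_hom_id_assoc]
  refine ⟨⟨fun B hB => conjMap g.F g'.F (shiftUnshiftIso B).symm (ψ _ hB.unshift),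
    fun {A B} hA hB a => ?_, fun S h h₁ h₂ h₃ => ?_⟩, fun A hA => ?_⟩
  · exact conjMap_naturality g.F g'.F (nat' a.hom)
      (nat hA.unshift hB.unshift ((shiftBy (-1)).mapIso a))
  · have := (isExactFunctor_shiftBy (E := E) (-1)).additive
    have hS : Conflation (S.map (shiftBy (-1))) :=
      (isExactFunctor_shiftBy (-1)).map_conflation S h
    have e := tensorHom_eq_of_dual (g.isUnitHom_conflation _ hS) (g'.isUnitHom_conflation _ hS)
      (hψ _ h₁.unshift) (hψ _ h₂.unshift) (hψ _ h₃.unshift)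
    have e' := φ.isHom _ hS h₁.unshift h₂.unshift h₃.unshift
    exact conjMap_isHom g.toDetFunctor g'.toDetFunctor h (T.exact_functor.map_conflation _ hS)
      (nat' S.f).symm (nat' S.g).symm
      (tensorHom_left_cancel ((congrArg (· ⊗ₘ _) e'.symm).trans e))
  · have hA' : SuppIn {k + 1} ((shiftBy (-1)).obj (T.functor.obj A)) := hA.shift.unshift
    have e := ((g.isUnitHom_iso (unshiftShiftIso A).symm).comp (hψ _ hA')).comp
      (g'.isUnitHom_iso (unshiftShiftIso A))
    have e' := φ.naturality hA hA' (unshiftShiftIso A).symm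
    rw [tensorHom_comp_tensorHom, tensorHom_comp_tensorHom, e', Category.assoc, map_symm_comp,
      Category.comp_id, Category.assoc] at e
    exact e

/-- Every morphism between the restrictions to degree `0` extends. -/
theorem W_full : (W E P).Full where
  map_surjective {g g'} t := by
    obtain ⟨ℓ, h0, hℓ⟩ := exists_int_seq
      (α := fun k => HomOn g.toDetFunctor g'.toDetFunctor {k}) (fun k φ ψ => φ.IsDual ψ)
      (fun k ψ => ψ.exists_isDual_left) (fun k φ => φ.exists_isDual_right) (HomOn.ofDegZero t)
    obtain ⟨s, hs⟩ := HomOn.exists_hom ℓ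
    refine ⟨⟨s, fun A => ?_⟩, ?_⟩
    · have conc : ∀ (k : ℤ) (A : GrB E), SuppIn {k + 1} A → IsUnitHom (g.μ A) (g'.μ A)
          (s.iso.hom.app ⟨A⟩ ⊗ₘ s.iso.hom.app ⟨T.functor.obj A⟩) := by
        intro k A hA
        rw [hs _ A hA, hs _ _ hA.shift]
        exact hℓ k A hA
      refine induction_suppIn (motive := fun A => IsUnitHom (g.μ A) (g'.μ A)
        (s.iso.hom.app ⟨A⟩ ⊗ₘ s.iso.hom.app ⟨T.functor.obj A⟩)) ?_ ?_ A.supp ?_ A A.suppIn_supp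
      · exact fun A hA => conc 0 A fun j _ => (eval j).map_isZero hA
      · intro S hS h₁ h₃
        exact IsUnitHom.of_conflation (g.isUnitHom_conflation S hS) (g'.isUnitHom_conflation S hS)
          h₁ h₃ (s.isHom S hS) (s.isHom (S.map T.functor) (T.exact_functor.map_conflation S hS))
      · intro k _ A hA
        exact conc (k - 1) A (by rwa [sub_add_cancel])
    · apply DetFunctor.hom_ext
      intro X
      have hz : degZeroIso (suppIn_degZero X) = Iso.refl _ := by
        ext j
        rcases j with (_ | n) | n
        · rfl
        all_goals exact (isZero_zero E).eq_of_tgt _ _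
      refine (hs 0 _ (suppIn_degZero X)).trans ?_
      rw [h0]
      change g.F.map ⟨_⟩ ≫ _ ≫ g'.F.map ⟨_⟩ = _
      rw [hz]
      exact (congrArg₂ (fun a b => a ≫ _ ≫ b) (g.F.map_id _) (g'.F.map_id _)).trans
        ((Category.id_comp _).trans (Category.comp_id _))

/-- The morphism on all graded objects that is defined by a morphism of determinant functors. -/
@[simps] def HomOn.ofHom {g g' : DetFunctor (GrB E) P} (t : g ⟶ g') : HomOn g g' Set.univ where
  app A _ := t.iso.hom.app ⟨A⟩
  naturality _ _ a := t.iso.hom.naturality _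
  isHom S hS _ _ _ := t.isHom S hS

/-- Morphisms with the same restriction to degree `0` agree. -/
theorem W_faithful : (W E P).Faithful where
  map_injective {g g'} s t h := by
    have h0 : ∀ A : GrB E, SuppIn {0} A →
        s.hom.iso.hom.app ⟨A⟩ = t.hom.iso.hom.app ⟨A⟩ := by
      intro A hA
      have e := congrArg (fun x : (W E P).obj g ⟶ (W E P).obj g' => x.iso.hom.app ⟨A.obj 0⟩) h
      have n := s.hom.iso.hom.naturality (X := ⟨A⟩) (Y := ⟨degZero.obj (A.obj 0)⟩) ⟨degZeroIso hA⟩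
      have n' := t.hom.iso.hom.naturality (X := ⟨A⟩) (Y := ⟨degZero.obj (A.obj 0)⟩) ⟨degZeroIso hA⟩
      rw [← cancel_mono (g'.F.map ⟨degZeroIso hA⟩)]
      exact n.symm.trans ((congrArg (_ ≫ ·) e).trans n')
    have conc : ∀ (k : ℤ) (A : GrB E), SuppIn {k} A →
        s.hom.iso.hom.app ⟨A⟩ = t.hom.iso.hom.app ⟨A⟩ := by
      intro k
      induction k using Int.induction_on with
      | zero => exact h0
      | succ k ih =>
        intro A hA
        have e := isUnitHom_unique (s.isUnitHom A) (t.isUnitHom A)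
        rw [ih _ hA.shift] at e
        exact tensorHom_right_cancel e
      | pred k ih =>
        intro B hB
        have hA := hB.unshift
        rw [sub_add_cancel] at hA
        have e := isUnitHom_unique (s.isUnitHom _) (t.isUnitHom ((shiftBy (-1)).obj B))
        rw [ih _ hA] at e
        have n := s.hom.iso.hom.naturality (X := ⟨T.functor.obj _⟩) (Y := ⟨B⟩) ⟨shiftUnshiftIso B⟩
        have n' := t.hom.iso.hom.naturality (X := ⟨T.functor.obj _⟩) (Y := ⟨B⟩) ⟨shiftUnshiftIso B⟩
        rw [← cancel_epi (g.F.map ⟨shiftUnshiftIso B⟩)]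
        exact n.trans ((congrArg (· ≫ _) (tensorHom_left_cancel e)).trans n'.symm)
    refine DetFunctorT.Hom.ext (DetFunctor.hom_ext fun A => ?_)
    exact (HomOn.ofHom s.hom).app_eq (HomOn.ofHom t.hom) A.supp
      (fun k _ A' hA' _ _ => conc k A' hA') A A.suppIn_supp (fun _ h => absurd trivial h)
      (fun _ h => absurd trivial h)

end Det

/-! ### The pairing of `A` with its translate -/

section Coherence

variable {P : Type w} [Category.{v₁} P] [MonoidalCategory P] [SymmetricCategory P]

/-- The permutation of the factors `(X ⊗ Y') ⊗ (Y ⊗ X') ⟶ (X ⊗ X') ⊗ (Y ⊗ Y')`. -/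
def regroup (X X' Y Y' : P) : (X ⊗ Y') ⊗ (Y ⊗ X') ⟶ (X ⊗ X') ⊗ (Y ⊗ Y') :=
  (X ⊗ Y') ◁ (β_ Y X').hom ≫ tensorμ X Y' X' Y ≫ (X ⊗ X') ◁ (β_ Y' Y).hom

theorem regroup_naturality {X₁ X₂ X₁' X₂' Y₁ Y₂ Y₁' Y₂' : P} (x : X₁ ⟶ X₂) (x' : X₁' ⟶ X₂')
    (y : Y₁ ⟶ Y₂) (y' : Y₁' ⟶ Y₂') :
    ((x ⊗ₘ y') ⊗ₘ (y ⊗ₘ x')) ≫ regroup X₂ X₂' Y₂ Y₂' =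
      regroup X₁ X₁' Y₁ Y₁' ≫ ((x ⊗ₘ x') ⊗ₘ (y ⊗ₘ y')) := by
  simp only [regroup, ← id_tensorHom, Category.assoc]
  rw [tensorHom_comp_tensorHom_assoc, BraidedCategory.braiding_naturality, Category.comp_id,
    ← Category.id_comp (x ⊗ₘ y'), ← tensorHom_comp_tensorHom_assoc, tensorμ_natural_assoc,
    tensorHom_comp_tensorHom, tensorHom_comp_tensorHom, BraidedCategory.braiding_naturality]
  simp

theorem regroup_tensor (X₁ X₂ X₁' X₂' Y₁ Y₂ Y₁' Y₂' : P) :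
    (tensorμ X₁ X₂ Y₁' Y₂' ⊗ₘ tensorμ Y₁ Y₂ X₁' X₂') ≫
        tensorμ (X₁ ⊗ Y₁') (X₂ ⊗ Y₂') (Y₁ ⊗ X₁') (Y₂ ⊗ X₂') ≫
        (regroup X₁ X₁' Y₁ Y₁' ⊗ₘ regroup X₂ X₂' Y₂ Y₂') =
      regroup (X₁ ⊗ X₂) (X₁' ⊗ X₂') (Y₁ ⊗ Y₂) (Y₁' ⊗ Y₂') ≫
        (tensorμ X₁ X₂ X₁' X₂' ⊗ₘ tensorμ Y₁ Y₂ Y₁' Y₂') ≫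
        tensorμ (X₁ ⊗ X₁') (X₂ ⊗ X₂') (Y₁ ⊗ Y₁') (Y₂ ⊗ Y₂') := by
  simp only [regroup, ← tensorHom_comp_tensorHom, Category.assoc]
  rw [← tensorμ_natural_right_assoc, ← id_tensorHom, tensorHom_comp_tensorHom_assoc,
    Category.comp_id, tensorμ_comp_braiding,
    ← Category.id_comp (tensorμ X₁ X₂ Y₁' Y₂'), ← tensorHom_comp_tensorHom_assoc,
    ← reassoc_of% tensorμ_tensorμ, ← tensorμ_natural_right, ← id_tensorHom,
    tensorHom_comp_tensorHom_assoc, tensorμ_comp_braiding, Category.comp_id,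
    ← id_tensorHom ((X₁ ⊗ X₂) ⊗ X₁' ⊗ X₂'), tensorHom_comp_tensorHom_assoc, Category.id_comp,
    id_tensorHom]

/-- Endomorphisms of the unit object are multiplied by the tensor product. -/
theorem tensorHom_comp_leftUnitor (s t : 𝟙_ P ⟶ 𝟙_ P) :
    (s ⊗ₘ t) ≫ (λ_ (𝟙_ P)).hom = (λ_ (𝟙_ P)).hom ≫ s ≫ t := by
  rw [MonoidalCategory.tensorHom_def, Category.assoc, leftUnitor_naturality, unitors_equal,
    rightUnitor_naturality_assoc]

end Coherence

section Picard

variable {P : Type w} [Category.{v₁} P] [MonoidalCategory P] [SymmetricCategory P]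
variable [PicardCategory P]

namespace RightInverses

variable (D : RightInverses P)

/-- The pairing of `X ⊗ Y^*` with `Y ⊗ X^*`, twisted by `ε(Y)`. For `X = f₁(A^ev)` and
`Y = f₁(A^od)`, this is the morphism to the unit object that describes the unit structure `μ_A`. -/
def twist (X Y : P) : (X ⊗ D.star Y) ⊗ (Y ⊗ D.star X) ⟶ 𝟙_ P :=
  regroup X (D.star X) Y (D.star Y) ≫ (D.pairing X ⊗ₘ D.pairing Y) ≫ (λ_ (𝟙_ P)).hom ≫ eps Y

theorem twist_naturality {X Y X' Y' : P} (x : X ⟶ X') (y : Y ⟶ Y') :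
    ((x ⊗ₘ D.starMap y) ⊗ₘ (y ⊗ₘ D.starMap x)) ≫ D.twist X' Y' = D.twist X Y := by
  rw [twist, reassoc_of% regroup_naturality, tensorHom_comp_tensorHom_assoc, D.starMap_pairing,
    D.starMap_pairing, ← eps_congr y, twist]

/-- The canonical map `(X₁ ⊗ X₂) ⊗ (Y₁ ⊗ Y₂)^* ⟶ (X₁ ⊗ Y₁^*) ⊗ (X₂ ⊗ Y₂^*)`. -/
def split (X₁ X₂ Y₁ Y₂ : P) :
    (X₁ ⊗ X₂) ⊗ D.star (Y₁ ⊗ Y₂) ⟶ (X₁ ⊗ D.star Y₁) ⊗ (X₂ ⊗ D.star Y₂) :=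
  (X₁ ⊗ X₂) ◁ D.starTensor Y₁ Y₂ ≫ tensorμ X₁ X₂ (D.star Y₁) (D.star Y₂)

theorem split_naturality {X₁ X₂ Y₁ Y₂ X₁' X₂' Y₁' Y₂' : P} (x₁ : X₁ ⟶ X₁') (x₂ : X₂ ⟶ X₂')
    (y₁ : Y₁ ⟶ Y₁') (y₂ : Y₂ ⟶ Y₂') :
    ((x₁ ⊗ₘ x₂) ⊗ₘ D.starMap (y₁ ⊗ₘ y₂)) ≫ D.split X₁' X₂' Y₁' Y₂' =
      D.split X₁ X₂ Y₁ Y₂ ≫ ((x₁ ⊗ₘ D.starMap y₁) ⊗ₘ (x₂ ⊗ₘ D.starMap y₂)) := by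
  rw [split, split, Category.assoc, ← tensorμ_natural, ← id_tensorHom, ← id_tensorHom,
    tensorHom_comp_tensorHom_assoc, tensorHom_comp_tensorHom_assoc, D.starTensor_naturality,
    Category.comp_id, Category.id_comp]

theorem split_of_comm {X X₁ X₂ Y Y₁ Y₂ X' X₁' X₂' Y' Y₁' Y₂' : P} {x : X ⟶ X₁ ⊗ X₂}
    {y : Y ⟶ Y₁ ⊗ Y₂} {x' : X' ⟶ X₁' ⊗ X₂'} {y' : Y' ⟶ Y₁' ⊗ Y₂'} {s : X ⟶ X'} {s₁ : X₁ ⟶ X₁'}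
    {s₂ : X₂ ⟶ X₂'} {t : Y ⟶ Y'} {t₁ : Y₁ ⟶ Y₁'} {t₂ : Y₂ ⟶ Y₂'}
    (hs : x ≫ (s₁ ⊗ₘ s₂) = s ≫ x') (ht : y ≫ (t₁ ⊗ₘ t₂) = t ≫ y') :
    ((x ⊗ₘ D.starMap y) ≫ D.split X₁ X₂ Y₁ Y₂) ≫
        ((s₁ ⊗ₘ D.starMap t₁) ⊗ₘ (s₂ ⊗ₘ D.starMap t₂)) =
      (s ⊗ₘ D.starMap t) ≫ (x' ⊗ₘ D.starMap y') ≫ D.split X₁' X₂' Y₁' Y₂' := by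
  rw [Category.assoc, ← D.split_naturality, tensorHom_comp_tensorHom_assoc,
    tensorHom_comp_tensorHom_assoc, hs, ← D.starMap_comp, ht, D.starMap_comp]

/-- The twisted pairing is multiplicative, because `regroup` is monoidal and `ε` is
multiplicative. -/
theorem split_twist (X₁ X₂ Y₁ Y₂ : P) :
    (D.split X₁ X₂ Y₁ Y₂ ⊗ₘ D.split Y₁ Y₂ X₁ X₂) ≫ tensorμ _ _ _ _ ≫
        (D.twist X₁ Y₁ ⊗ₘ D.twist X₂ Y₂) ≫ (λ_ (𝟙_ P)).hom =
      D.twist (X₁ ⊗ X₂) (Y₁ ⊗ Y₂) := by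
  have e := regroup_naturality (𝟙 (X₁ ⊗ X₂)) (D.starTensor X₁ X₂) (𝟙 (Y₁ ⊗ Y₂))
    (D.starTensor Y₁ Y₂)
  simp only [id_tensorHom] at e
  simp only [split, twist, ← tensorHom_comp_tensorHom, Category.assoc]
  rw [reassoc_of% regroup_tensor, reassoc_of% e, ← tensorμ_natural_assoc, tensorHom_comp_leftUnitor,
    reassoc_of% tensorμ_unit, ← eps_tensor, tensorHom_comp_tensorHom_assoc,
    tensorHom_comp_tensorHom_assoc, tensorHom_comp_tensorHom_assoc]
  simp only [Category.assoc]
  rw [D.starTensor_pairing, D.starTensor_pairing]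

theorem split_twist_of_comm {X X₁ X₂ Y Y₁ Y₂ X' X₁' X₂' Y' Y₁' Y₂' : P} {x : X ⟶ X₁ ⊗ X₂}
    {y : Y ⟶ Y₁ ⊗ Y₂} {x' : X' ⟶ X₁' ⊗ X₂'} {y' : Y' ⟶ Y₁' ⊗ Y₂'} {s : X' ⟶ Y} {s₁ : X₁' ⟶ Y₁}
    {s₂ : X₂' ⟶ Y₂} {t : Y' ⟶ X} {t₁ : Y₁' ⟶ X₁} {t₂ : Y₂' ⟶ X₂}
    (hs : s ≫ y = x' ≫ (s₁ ⊗ₘ s₂)) (ht : t ≫ x = y' ≫ (t₁ ⊗ₘ t₂)) :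
    (((x ⊗ₘ D.starMap y) ≫ D.split X₁ X₂ Y₁ Y₂) ⊗ₘ
          ((x' ⊗ₘ D.starMap y') ≫ D.split X₁' X₂' Y₁' Y₂')) ≫ tensorμ _ _ _ _ ≫
        ((_ ◁ (s₁ ⊗ₘ D.starMap t₁) ≫ D.twist X₁ Y₁) ⊗ₘ
          (_ ◁ (s₂ ⊗ₘ D.starMap t₂) ≫ D.twist X₂ Y₂)) ≫ (λ_ (𝟙_ P)).hom =
      _ ◁ (s ⊗ₘ D.starMap t) ≫ D.twist X Y := by
  rw [← tensorHom_comp_tensorHom (_ ◁ _), Category.assoc, ← tensorμ_natural_right_assoc,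
    ← id_tensorHom, tensorHom_comp_tensorHom_assoc, Category.comp_id, Category.assoc,
    ← D.split_naturality, tensorHom_comp_tensorHom_assoc, ← hs, ← D.starMap_comp, ← ht,
    D.starMap_comp, ← tensorHom_comp_tensorHom s, Category.assoc,
    ← Category.id_comp ((x ⊗ₘ D.starMap y) ≫ _), ← tensorHom_comp_tensorHom_assoc,
    ← tensorHom_comp_tensorHom_assoc (x ⊗ₘ D.starMap y), D.split_twist, D.twist_naturality,
    id_tensorHom]

theorem twist_of_comm {X₁ Y₁ X₁' Y₁' X₂ Y₂ X₂' Y₂' : P} {x : X₁ ⟶ X₂} {y : Y₁ ⟶ Y₂}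
    {x' : X₁' ⟶ X₂'} {y' : Y₁' ⟶ Y₂'} {s₁ : X₁' ⟶ Y₁} {s₂ : X₂' ⟶ Y₂} {t₁ : Y₁' ⟶ X₁}
    {t₂ : Y₂' ⟶ X₂} (hs : x' ≫ s₂ = s₁ ≫ y) (ht : y' ≫ t₂ = t₁ ≫ x) :
    ((x ⊗ₘ D.starMap y) ⊗ₘ (x' ⊗ₘ D.starMap y')) ≫ _ ◁ (s₂ ⊗ₘ D.starMap t₂) ≫ D.twist X₂ Y₂ =
      _ ◁ (s₁ ⊗ₘ D.starMap t₁) ≫ D.twist X₁ Y₁ := by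
  rw [← D.twist_naturality x y, ← id_tensorHom, ← id_tensorHom, tensorHom_comp_tensorHom_assoc,
    tensorHom_comp_tensorHom_assoc, tensorHom_comp_tensorHom, tensorHom_comp_tensorHom, hs,
    ← D.starMap_comp, ht, D.starMap_comp, Category.comp_id, Category.id_comp]

theorem comp_epsilon_pairing (X Y : P) {W : P} (m : W ⟶ Y ⊗ D.star X) :
    ((X ⊗ D.star Y) ◁ m ≫ (X ⊗ D.star Y) ◁ (β_ Y (D.star X)).hom ≫
        (interchange X (D.star Y) (D.star X) Y).hom ≫ (X ⊗ D.star X) ◁ (β_ (D.star Y) Y).hom ≫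
        epsilon Y _) ≫ (toUnit (D.unit X) ⊗ₘ toUnit (D.unit Y)) ≫ (λ_ (𝟙_ P)).hom =
      (X ⊗ D.star Y) ◁ m ≫ D.twist X Y := by
  simp only [Category.assoc]
  rw [epsilon_eq_scalar, ← reassoc_of% scalar_naturality, ← scalar_naturality, scalar_unit,
    twist, regroup, interchange_hom]
  simp only [Category.assoc]
  rfl

end RightInverses
end Picard

/-! ### The functor `R` -/

section Det

variable {E : Type u} [Category.{v} E] [Preadditive E] [ExactCategory E]
variable {P : Type w} [Category.{v₁} P] [MonoidalCategory P] [SymmetricCategory P]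

theorem biproduct_whiskerEquiv_naturality {J K : Type} {g g' : K → E} (e : J ≃ K) [HasBiproduct g]
    [HasBiproduct g'] [HasBiproduct fun j => g (e j)] [HasBiproduct fun j => g' (e j)]
    (b : ∀ k, g k ⟶ g' k) :
    biproduct.map (fun j => b (e j)) ≫
        (biproduct.whiskerEquiv (g := g') e fun _ => Iso.refl _).hom =
      (biproduct.whiskerEquiv (g := g) e fun _ => Iso.refl _).hom ≫ biproduct.map b := by
  apply biproduct.hom_ext'
  intro j
  simp

theorem comp_whiskerLeft_tensorHom {X X' Y Y' Y'' : P} (x : X ⟶ X') (y : Y ⟶ Y') (s : Y' ⟶ Y'') :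
    (x ⊗ₘ y) ≫ X' ◁ s = x ⊗ₘ (y ≫ s) := by
  rw [← id_tensorHom, tensorHom_comp_tensorHom, Category.comp_id]

open GrB

/-- The bijection `i ↦ i + 1` from the even to the odd numbers. -/
def evenSucc : ({i | Even i} : Set ℤ) ≃ ({i | Odd i} : Set ℤ) where
  toFun i := ⟨i.1 + 1, Even.add_one i.2⟩
  invFun i := ⟨i.1 - 1, Odd.sub_odd i.2 odd_one⟩
  left_inv i := Subtype.ext (by simp)
  right_inv i := Subtype.ext (by simp)

/-- The bijection `i ↦ i + 1` from the odd to the even numbers. -/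
def oddSucc : ({i | Odd i} : Set ℤ) ≃ ({i | Even i} : Set ℤ) where
  toFun i := ⟨i.1 + 1, Odd.add_one i.2⟩
  invFun i := ⟨i.1 - 1, Even.sub_odd i.2 odd_one⟩
  left_inv i := Subtype.ext (by simp)
  right_inv i := Subtype.ext (by simp)

theorem GrB.evShift_naturality {A B : GrB E} (a : A ⟶ B) :
    ev.map (T.functor.map a) ≫ (evShift B).hom = (evShift A).hom ≫ od.map a :=
  have (C : GrB E) : HasBiproduct fun i => C.obj (evenSucc i).1 :=
    inferInstanceAs (HasBiproduct fun i : ({i | Even i} : Set ℤ) => C.obj (i.1 + 1))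
  biproduct_whiskerEquiv_naturality evenSucc fun k => a.app k.1

theorem GrB.odShift_naturality {A B : GrB E} (a : A ⟶ B) :
    od.map (T.functor.map a) ≫ (odShift B).hom = (odShift A).hom ≫ ev.map a :=
  have (C : GrB E) : HasBiproduct fun i => C.obj (oddSucc i).1 :=
    inferInstanceAs (HasBiproduct fun i : ({i | Odd i} : Set ℤ) => C.obj (i.1 + 1))
  biproduct_whiskerEquiv_naturality oddSucc fun k => a.app k.1

variable [PicardCategory P] (D : RightInverses P)

theorem evOdData_toDetData (f : DetFunctor E P) : (evOdData D f).toDetData =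
    (((precomp ev (isExactFunctor_sumOn _)).obj f).tensor
      (DetFunctor.dual D ((precomp od (isExactFunctor_sumOn _)).obj f))).toDetData := by
  refine congrArg (DetData.mk (evOdF D f)) (funext fun S => funext fun h => Iso.ext ?_)
  exact (Category.assoc _ _ _).symm.trans
    (congrArg (· ≫ _) (comp_whiskerLeft_tensorHom _ _ _))

/-- The determinant functor `A ↦ f₁(A^ev) ⊗ f₁(A^od)^*`: the product of `f(A^ev)` and of the inverse
of `f(A^od)`. -/
def evOd (f : DetFunctor E P) : DetFunctor (GrB E) P :=
  (((precomp ev (isExactFunctor_sumOn _)).obj f).tensor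
    (DetFunctor.dual D ((precomp od (isExactFunctor_sumOn _)).obj f))).copy
    (evOdData D f).toDetData (evOdData_toDetData D f)

theorem toUnit_evOdData (f : DetFunctor E P) (A : GrB E) :
    toUnit ((evOdData D f).μ A) =
      _ ◁ (f.F.map ⟨evShift A⟩ ⊗ₘ D.starMap (f.F.map ⟨odShift A⟩)) ≫
        D.twist (f.F.obj ⟨ev.obj A⟩) (f.F.obj ⟨od.obj A⟩) := by
  refine (toUnit_inducedUnit _ _).trans ?_
  rw [toUnit_prodUnit]
  exact D.comp_epsilon_pairing _ _ _

theorem isUnitHom_evOdData_iso (f : DetFunctor E P) {A B : GrB E} (a : A ≅ B) :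
    IsUnitHom ((evOdData D f).μ A) ((evOdData D f).μ B)
      ((evOdF D f).map ⟨a⟩ ⊗ₘ (evOdF D f).map ⟨T.functor.mapIso a⟩) := by
  rw [isUnitHom_iff, toUnit_evOdData, toUnit_evOdData]
  exact D.twist_of_comm
    (map_comp_eq f.F (a := ev.mapIso (T.functor.mapIso a)) (b := evShift B) (c := evShift A)
      (d := od.mapIso a) (evShift_naturality a.hom))
    (map_comp_eq f.F (a := od.mapIso (T.functor.mapIso a)) (b := odShift B) (c := odShift A)
      (d := ev.mapIso a) (odShift_naturality a.hom))

theorem isUnitHom_evOdData_conflation (f : DetFunctor E P) (S : ShortComplex (GrB E))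
    (h : Conflation S) :
    IsUnitHom ((evOdData D f).μ S.X₂) (prodUnit ((evOdData D f).μ S.X₁) ((evOdData D f).μ S.X₃))
      ((((evOdData D f).iso S h).hom ⊗ₘ ((evOdData D f).iso (S.map T.functor)
          (T.exact_functor.map_conflation S h)).hom) ≫ (interchange _ _ _ _).hom) := by
  rw [isUnitHom_iff, toUnit_prodUnit, toUnit_evOdData, toUnit_evOdData, toUnit_evOdData]
  refine (Category.assoc _ _ _).trans ?_
  exact D.split_twist_of_comm
    (f.naturality ((S.map T.functor).map ev) (S.map od)
      ((isExactFunctor_sumOn _).map_conflation _ (T.exact_functor.map_conflation S h))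
      ((isExactFunctor_sumOn _).map_conflation _ h)
      (evShift S.X₁) (evShift S.X₂) (evShift S.X₃)
      (evShift_naturality S.f).symm (evShift_naturality S.g).symm)
    (f.naturality ((S.map T.functor).map od) (S.map ev)
      ((isExactFunctor_sumOn _).map_conflation _ (T.exact_functor.map_conflation S h))
      ((isExactFunctor_sumOn _).map_conflation _ h)
      (odShift S.X₁) (odShift S.X₂) (odShift S.X₃)
      (odShift_naturality S.f).symm (odShift_naturality S.g).symm)

/-- The determinant functor `(g₁, g₂, μ)` on `(Gr^b(E), T)` that is associated to `f`. -/
def evOdT (f : DetFunctor E P) : DetFunctorT P (T (E := E)) where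
  toDetFunctor := evOd D f
  μ := (evOdData D f).μ
  isUnitHom_iso := isUnitHom_evOdData_iso D f
  isUnitHom_conflation := isUnitHom_evOdData_conflation D f

instance isIso_evOdFunctor_map {f f' : DetFunctor E P} (t : f ⟶ f') :
    IsIso ((evOdFunctor E D).map t) :=
  NatIso.isIso_of_isIso_app _

/-- The isomorphism of functors `A ↦ t_{A^ev} ⊗ (t_{A^od})^*`. -/
def evOdFIso {f f' : DetFunctor E P} (t : f ⟶ f') : evOdF D f ≅ evOdF D f' :=
  (asIso ((evOdFunctor E D).map t) : (evOdFunctor E D).obj f ≅ (evOdFunctor E D).obj f')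

theorem isHom_evOdFIso {f f' : DetFunctor E P} (t : f ⟶ f') :
    (evOd D f).IsHom (evOd D f').toDetData (evOdFIso D t) :=
  fun S h => D.split_of_comm
    (t.isHom (S.map ev) ((isExactFunctor_sumOn _).map_conflation S h))
    (t.isHom (S.map od) ((isExactFunctor_sumOn _).map_conflation S h))

theorem isUnitHom_evOdFunctor_map {f f' : DetFunctor E P} (t : f ⟶ f') (A : GrB E) :
    IsUnitHom ((evOdData D f).μ A) ((evOdData D f').μ A)
      (((evOdFunctor E D).map t).app ⟨A⟩ ⊗ₘ ((evOdFunctor E D).map t).app ⟨T.functor.obj A⟩) := by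
  rw [isUnitHom_iff, toUnit_evOdData, toUnit_evOdData]
  exact D.twist_of_comm (t.iso.hom.naturality ⟨evShift A⟩).symm
    (t.iso.hom.naturality ⟨odShift A⟩).symm

/-- The functor `R : det(E, P) ⥤ det((Gr^b(E), T), P)`. -/
def R : DetFunctor E P ⥤ DetFunctorT P (T (E := E)) where
  obj f := evOdT D f
  map t := ⟨⟨evOdFIso D t, isHom_evOdFIso D t⟩,
    isUnitHom_evOdFunctor_map D t⟩
  map_id f := DetFunctorT.Hom.ext (DetFunctor.Hom.ext (Iso.ext ((evOdFunctor E D).map_id f)))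
  map_comp s t :=
    DetFunctorT.Hom.ext (DetFunctor.Hom.ext (Iso.ext ((evOdFunctor E D).map_comp s t)))

theorem R_comp_forgetFunctor :
    R (E := E) D ⋙ DetFunctorT.forgetFunctor P T = evOdFunctor E D := rfl

theorem R_obj_data (f : DetFunctor E P) : ((R D).obj f).data = evOdData D f := rfl

end Det

/-! ### The isomorphism `R ⋙ W ≅ 𝟭` -/

section Picard

variable {P : Type w} [Category.{v₁} P] [MonoidalCategory P] [SymmetricCategory P]
variable [PicardCategory P]

theorem toUnit_leftUnitor_symm : toUnit (λ_ (𝟙_ P)).symm = 𝟙 (𝟙_ P) :=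
  toUnit_eq (by simp [IsUnitHom])

namespace RightInverses

variable (D : RightInverses P)

theorem exists_starUnit {Z : P} (δ : UnitStr Z) :
    ∃ ζ : D.star Z ⟶ 𝟙_ P, (toUnit δ ⊗ₘ ζ) ≫ (λ_ (𝟙_ P)).hom = D.pairing Z := by
  obtain ⟨ζ, h, -⟩ := existsUnique_dual (toUnit δ) (D.unit Z)
    (inducedUnit (λ_ (𝟙_ P)).symm (λ_ (𝟙_ P)))
  refine ⟨ζ, ?_⟩
  rwa [isUnitHom_iff, toUnit_inducedUnit, toUnit_leftUnitor_symm, Category.comp_id] at h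

/-- The dual of the morphism `toUnit δ : Z ⟶ 1`. -/
def starUnit {Z : P} (δ : UnitStr Z) : D.star Z ⟶ 𝟙_ P := (D.exists_starUnit δ).choose

theorem starUnit_pairing {Z : P} (δ : UnitStr Z) :
    (toUnit δ ⊗ₘ D.starUnit δ) ≫ (λ_ (𝟙_ P)).hom = D.pairing Z :=
  (D.exists_starUnit δ).choose_spec

theorem starMap_starUnit {Z Z' : P} {δ : UnitStr Z} {δ' : UnitStr Z'} {z : Z ⟶ Z'}
    (hz : z ≫ toUnit δ' = toUnit δ) : D.starMap z ≫ D.starUnit δ' = D.starUnit δ := by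
  apply eq_of_pairing (toUnit δ) (λ_ (𝟙_ P)).hom
  rw [D.starUnit_pairing]
  conv_lhs => rw [← hz]
  rw [← tensorHom_comp_tensorHom, Category.assoc, D.starUnit_pairing, D.starMap_pairing]

theorem starTensor_starUnit {Z Z₁ Z₂ : P} {δ : UnitStr Z} {δ₁ : UnitStr Z₁} {δ₂ : UnitStr Z₂}
    {z : Z ⟶ Z₁ ⊗ Z₂} (hz : z ≫ (toUnit δ₁ ⊗ₘ toUnit δ₂) ≫ (λ_ (𝟙_ P)).hom = toUnit δ) :
    D.starMap z ≫ D.starTensor Z₁ Z₂ ≫ (D.starUnit δ₁ ⊗ₘ D.starUnit δ₂) ≫ (λ_ (𝟙_ P)).hom =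
      D.starUnit δ := by
  apply eq_of_pairing (toUnit δ) (λ_ (𝟙_ P)).hom
  rw [D.starUnit_pairing]
  conv_lhs => rw [← hz]
  rw [← Category.id_comp ((toUnit δ₁ ⊗ₘ toUnit δ₂) ≫ _)]
  simp only [← tensorHom_comp_tensorHom, Category.assoc]
  rw [← reassoc_of% tensorμ_unit, tensorμ_natural_assoc,
    tensorHom_comp_tensorHom_assoc (toUnit δ₁ ⊗ₘ D.starUnit δ₁), D.starUnit_pairing,
    D.starUnit_pairing,
    id_tensorHom, D.starTensor_pairing, D.starMap_pairing]

theorem comp_starUnit_of_comm {A A' B Z Z' C : P} {δ : UnitStr Z} {δ' : UnitStr Z'} {x : A ⟶ A'}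
    {z : Z ⟶ Z'} {e : A ⟶ B} {e' : A' ⟶ C} {w : B ⟶ C} (hx : x ≫ e' = e ≫ w)
    (hz : z ≫ toUnit δ' = toUnit δ) :
    (x ⊗ₘ D.starMap z) ≫ (e' ⊗ₘ D.starUnit δ') ≫ (ρ_ C).hom =
      ((e ⊗ₘ D.starUnit δ) ≫ (ρ_ B).hom) ≫ w := by
  rw [tensorHom_comp_tensorHom_assoc, hx, D.starMap_starUnit hz, Category.assoc,
    ← rightUnitor_naturality, ← tensorHom_id, tensorHom_comp_tensorHom_assoc, Category.comp_id]

theorem split_starUnit_of_comm {A A₁ A₂ B B₁ B₂ Z Z₁ Z₂ : P} {δ : UnitStr Z} {δ₁ : UnitStr Z₁}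
    {δ₂ : UnitStr Z₂} {x : A ⟶ A₁ ⊗ A₂} {z : Z ⟶ Z₁ ⊗ Z₂} {e : A ⟶ B} {e₁ : A₁ ⟶ B₁}
    {e₂ : A₂ ⟶ B₂} {w : B ⟶ B₁ ⊗ B₂} (hx : x ≫ (e₁ ⊗ₘ e₂) = e ≫ w)
    (hz : z ≫ (toUnit δ₁ ⊗ₘ toUnit δ₂) ≫ (λ_ (𝟙_ P)).hom = toUnit δ) :
    ((x ⊗ₘ D.starMap z) ≫ D.split A₁ A₂ Z₁ Z₂) ≫
        (((e₁ ⊗ₘ D.starUnit δ₁) ≫ (ρ_ B₁).hom) ⊗ₘ ((e₂ ⊗ₘ D.starUnit δ₂) ≫ (ρ_ B₂).hom)) =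
      ((e ⊗ₘ D.starUnit δ) ≫ (ρ_ B).hom) ≫ w := by
  have r : tensorμ B₁ B₂ (𝟙_ P) (𝟙_ P) ≫ ((ρ_ B₁).hom ⊗ₘ (ρ_ B₂).hom) =
      (𝟙 (B₁ ⊗ B₂) ⊗ₘ (λ_ (𝟙_ P)).hom) ≫ (ρ_ (B₁ ⊗ B₂)).hom := by
    rw [tensor_right_unitality, id_tensorHom, whiskerLeft_hom_inv_assoc]
  rw [split, ← tensorHom_comp_tensorHom, Category.assoc, Category.assoc, ← tensorμ_natural_assoc,
    r, ← id_tensorHom]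
  simp only [tensorHom_comp_tensorHom_assoc, Category.assoc]
  rw [D.starTensor_starUnit hz, Category.comp_id, Category.id_comp, hx,
    ← rightUnitor_naturality, ← tensorHom_id, tensorHom_comp_tensorHom_assoc, Category.comp_id]

end RightInverses
end Picard

section Det

variable {E : Type u} [Category.{v} E] [Preadditive E] [ExactCategory E]
variable {P : Type w} [Category.{v₁} P] [MonoidalCategory P] [SymmetricCategory P]

open GrB

theorem GrB.isZero_od_degZero (X : E) : IsZero (od.obj (degZero.obj X)) :=
  isZero_biproduct fun j => isZero_degZeroObj X j.1 fun h => by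
    have := j.2
    rw [h] at this
    exact absurd this (by decide)

/-- The canonical isomorphism `X^ev ≅ X` for `X` in degree `0`. -/
def GrB.evDegZero (X : E) : ev.obj (degZero.obj X) ≅ X where
  hom := biproduct.π (fun j : ({i | Even i} : Set ℤ) => (degZero.obj X).obj j.1) ⟨0, Even.zero⟩
  inv := biproduct.ι (fun j : ({i | Even i} : Set ℤ) => (degZero.obj X).obj j.1) ⟨0, Even.zero⟩
  hom_inv_id := by
    apply biproduct.hom_ext'
    rintro ⟨j, hj⟩
    by_cases h : j = 0
    · subst h
      exact (biproduct.ι_π_self_assoc _ _ _).trans (Category.comp_id _).symm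
    · exact (isZero_degZeroObj X j h).eq_of_src _ _
  inv_hom_id := biproduct.ι_π_self _ _

theorem GrB.evDegZero_naturality {X Y : E} (a : X ⟶ Y) :
    ev.map (degZero.map a) ≫ (evDegZero Y).hom = (evDegZero X).hom ≫ a :=
  biproduct.map_π (fun j : ({i | Even i} : Set ℤ) => (degZero.map a).app j.1) ⟨0, Even.zero⟩

instance isIso_detFunctorHom {f g : DetFunctor E P} (t : f ⟶ g) : IsIso t := by
  refine ⟨⟨⟨t.iso.symm, fun S h => ?_⟩, DetFunctor.Hom.ext t.iso.self_symm_id,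
    DetFunctor.Hom.ext t.iso.symm_self_id⟩⟩
  rw [← cancel_epi (t.iso.hom.app ⟨S.X₂⟩), ← reassoc_of% t.isHom S h, tensorHom_comp_tensorHom]
  simp

variable [PicardCategory P] (D : RightInverses P)

theorem DetFunctor.Hom.app_toUnit_zeroUnit {f f' : DetFunctor E P} (t : f ⟶ f') {Z : E}
    (hZ : IsZero Z) :
    t.iso.hom.app ⟨Z⟩ ≫ toUnit (f'.zeroUnit hZ) = toUnit (f.zeroUnit hZ) :=
  (isUnitHom_iff _ _ _).1 (t.isHom _ (DetFunctor.conflation_zero hZ))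

/-- The isomorphism `f₁(X^ev) ⊗ f₁(X^od)^* ≅ f₁(X)` for `X` in degree `0`. -/
def counitApp (f : DetFunctor E P) (X : E) :
    f.F.obj ⟨ev.obj (degZero.obj X)⟩ ⊗ D.star (f.F.obj ⟨od.obj (degZero.obj X)⟩) ≅ f.F.obj ⟨X⟩ :=
  asIso ((f.F.map ⟨evDegZero X⟩ ⊗ₘ D.starUnit (f.zeroUnit (isZero_od_degZero X))) ≫ (ρ_ _).hom)

/-- The morphism of determinant functors `W(R(f)) ⟶ f`. -/
def counit (f : DetFunctor E P) : (R D ⋙ W E P).obj f ⟶ f where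
  iso := NatIso.ofComponents (F := ((R D ⋙ W E P).obj f).F)
    (fun X => counitApp D f X.of) (fun {X Y} a => D.comp_starUnit_of_comm
      (map_comp_eq f.F (a := ev.mapIso (degZero.mapIso a.iso)) (b := evDegZero Y.of)
        (c := evDegZero X.of) (d := a.iso) (evDegZero_naturality a.iso.hom))
      (f.map_toUnit_zeroUnit _ _ _))
  isHom S h := D.split_starUnit_of_comm
    (f.naturality ((S.map degZero).map ev) S
      ((isExactFunctor_sumOn _).map_conflation _ (isExactFunctor_degZero.map_conflation S h)) h
      (evDegZero S.X₁) (evDegZero S.X₂) (evDegZero S.X₃)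
      (evDegZero_naturality S.f).symm (evDegZero_naturality S.g).symm).symm
    (f.iso_toUnit_zeroUnit ((S.map degZero).map od)
      ((isExactFunctor_sumOn _).map_conflation _ (isExactFunctor_degZero.map_conflation S h))
      (isZero_od_degZero _) (isZero_od_degZero _) (isZero_od_degZero _))

/-- The isomorphism `R ⋙ W ≅ 𝟭`. -/
def counitIso : R D ⋙ W E P ≅ 𝟭 (DetFunctor E P) :=
  NatIso.ofComponents (fun f => asIso (counit D f)) fun {f f'} t =>
    DetFunctor.hom_ext fun X => D.comp_starUnit_of_comm (t.iso.hom.naturality ⟨evDegZero X⟩).symm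
      (t.app_toUnit_zeroUnit (isZero_od_degZero X))

theorem W_isEquivalence : (W E P).IsEquivalence := by
  have := W_full (E := E) (P := P)
  have := W_faithful (E := E) (P := P)
  obtain ⟨D⟩ := nonempty_rightInverses (P := P)
  have : (W E P).EssSurj := ⟨fun f => ⟨(R D).obj f, ⟨(counitIso D).app f⟩⟩⟩
  exact { }

/-- A right quasi-inverse of an equivalence is a left quasi-inverse. -/
theorem nonempty_comp_iso_id {C C' : Type*} [Category* C] [Category* C'] (F : C ⥤ C')
    [F.IsEquivalence] {G : C' ⥤ C} (i : G ⋙ F ≅ 𝟭 C') : Nonempty (F ⋙ G ≅ 𝟭 C) := by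
  have j : F.inv ≅ G := Iso.compInverseIso (H := F.asEquivalence) i.symm
  exact ⟨Functor.isoWhiskerLeft F j.symm ≪≫ F.asEquivalence.unitIso.symm⟩

end Det

end DetFunctors

end

theorem mainTheorem6 {E : Type u} [Category.{v} E] [Preadditive E] [DetFunctors.ExactCategory E]
    {P : Type u₁} [Category.{v₁} P] [MonoidalCategory P] [SymmetricCategory P]
    [DetFunctors.PicardCategory P] :
    (DetFunctors.W E P).IsEquivalence ∧
    ∀ D : DetFunctors.RightInverses P,
      ∃ R : DetFunctors.DetFunctor E P ⥤
          DetFunctors.DetFunctorT P (DetFunctors.GrB.T (E := E)),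
        (∀ f : DetFunctors.DetFunctor E P, (R.obj f).data = DetFunctors.evOdData D f) ∧
        R ⋙ DetFunctors.DetFunctorT.forgetFunctor P DetFunctors.GrB.T =
          DetFunctors.evOdFunctor E D ∧
        Nonempty (R ⋙ DetFunctors.W E P ≅ 𝟭 (DetFunctors.DetFunctor E P)) ∧
        Nonempty (DetFunctors.W E P ⋙ R ≅
          𝟭 (DetFunctors.DetFunctorT P (DetFunctors.GrB.T (E := E)))) := by
  have hW := DetFunctors.W_isEquivalence (E := E) (P := P)
  exact ⟨hW, fun D => ⟨DetFunctors.R D, DetFunctors.R_obj_data D,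
    DetFunctors.R_comp_forgetFunctor D, ⟨DetFunctors.counitIso D⟩,
    DetFunctors.nonempty_comp_iso_id _ (DetFunctors.counitIso D)⟩⟩
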